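/- All graphs are finite, undirected and simple. For a graph $G$ and $U\subseteq V(G)$, let $N_G[U]$ be the set of vertices that lie in $U$ or have a neighbour in $U$. An instance of Secluded Steiner Tree without costs consists of a graph $G$, a set $S\subseteq V(G)$ of terminals and an integer $k\ge 0$; it is a yes-instance if $G$ has a (nonempty) connected subgraph $H$ with $S\subseteq V(H)$ and $|N_G[V(H)]|\le k$. Theorem. There is a true-biased Monte Carlo algorithm that, given an instance $(G,S,k)$ and a tree decomposition $(\{B_i\}_{i\in V(T)},T)$ of $G$ of width at most $t$, decides whether $(G,S,k)$ is a yes-instance in time $4^t\cdot N^{O(1)}$, where $N=|V(G)|+|V(T)|+\log k$ is the input size up to polynomial factors (so the time is $4^t\cdot n^{O(1)}$ for $n=|V(G)|$ whenever $k\le n$ and $|V(T)|=n^{O(1)}$). That is, there are a fixed program $P$ for a random access machine with logarithmic cost that can toss fair coins, and constants $C,d\in\mathbb{N}$, such that the following holds for all $G$, $S$, $k$, $t$ and every tree decomposition of $G$ of width at most $t$, where $\log k$ is read as the number of binary digits of $k$ (which is $0$ for $k=0$). (i) For every outcome of the coin tosses, $P$ halts on the input $(G,S,k,(\{B_i\},T))$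 within time $C\cdot 4^t\cdot N^d$. (ii) If $P$ answers yes for some outcome of the coin tosses, then $(G,S,k)$ is a yes-instance. (iii) If $(G,S,k)$ is a yes-instance, then $P$ answers yes with probability at least $1/2$. -/

import Mathlib

open MeasureTheory

/-! ## The problem -/

/-- The open neighbourhood `N_G(U)` of a set of vertices. -/
def openNbhd {V : Type*} (G : SimpleGraph V) (U : Set V) : Set V :=
  (⋃ u ∈ U, G.neighborSet u) \ U

/-- The closed neighbourhood `N_G[U] = N_G(U) ∪ U` of a set of vertices. -/
def closedNbhd {V : Type*} (G : SimpleGraph V) (U : Set V) : Set V :=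
  openNbhd G U ∪ U

/-- `(G, S, k)` is a yes-instance of Secluded Steiner Tree without costs: some connected subgraph
of `G` contains all terminals and has a closed neighbourhood of at most `k` vertices. -/
def IsSecludedSteinerYes {V : Type*} (G : SimpleGraph V) (S : Set V) (k : ℕ) : Prop :=
  ∃ H : G.Subgraph, H.Connected ∧ S ⊆ H.verts ∧ (closedNbhd G H.verts).ncard ≤ k

/-- A tree decomposition of `G` with set of nodes `ι`. -/
structure TreeDecomp {V : Type*} (G : SimpleGraph V) (ι : Type*) where
  /-- the tree -/
  tree : SimpleGraph ι
  isTree : tree.IsTree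
  /-- the bags -/
  bag : ι → Finset V
  vertex_mem : ∀ x : V, ∃ i, x ∈ bag i
  edge_mem : ∀ x y : V, G.Adj x y → ∃ i, x ∈ bag i ∧ y ∈ bag i
  connected : ∀ x : V, (tree.induce {i | x ∈ bag i}).Connected

/-- The width of the decomposition, `max |bag i| - 1`, is at most `t`. -/
def TreeDecomp.WidthLE {V : Type*} {G : SimpleGraph V} {ι : Type*} (D : TreeDecomp G ι)
    (t : ℕ) : Prop :=
  ∀ i, (D.bag i).card ≤ t + 1

/-! ## Randomized random access machines with logarithmic cost

Programs have finitely many variables and finitely many arrays with cells indexed by `ℕ`, all of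
which hold natural numbers. Every operation is charged the binary lengths of the numbers it handles,
addresses included. -/

namespace Ram

/-- A memory state, together with the fair coins that have not been tossed yet. -/
structure State where
  var : ℕ → ℕ
  arr : ℕ → ℕ → ℕ
  coins : ℕ → Bool

/-- Arithmetic operations and comparisons. -/
inductive Op where
  | add | sub | mul | div | mod | eq | lt

/-- Subtraction is truncated, division rounds down, and comparisons return `1` or `0`. -/
def Op.apply : Op → ℕ → ℕ → ℕ
  | .add, a, b => a + b
  | .sub, a, b => a - b
  | .mul, a, b => a * b
  | .div, a, b => a / b
  | .mod, a, b => a % b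
  | .eq, a, b => if a = b then 1 else 0
  | .lt, a, b => if a < b then 1 else 0

/-- Expressions: constants, variables, the array access `a[e]`, and binary operations. -/
inductive Exp where
  | const (c : ℕ)
  | var (x : ℕ)
  | get (a : ℕ) (e : Exp)
  | op (o : Op) (e₁ e₂ : Exp)

/-- The value of an expression. -/
def Exp.val (s : State) : Exp → ℕ
  | .const c => c
  | .var x => s.var x
  | .get a e => s.arr a (e.val s)
  | .op o e₁ e₂ => o.apply (e₁.val s) (e₂.val s)

/-- The logarithmic cost of evaluating an expression (`Nat.size` is the binary length). -/
def Exp.cost (s : State) : Exp → ℕ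
  | .const c => 1 + c.size
  | .var x => 1 + (s.var x).size
  | .get a e => e.cost s + 1 + (e.val s).size + (s.arr a (e.val s)).size
  | .op _ e₁ e₂ => e₁.cost s + e₂.cost s + 1 + (e₁.val s).size + (e₂.val s).size

/-- Programs. -/
inductive Prog where
  | skip
  /-- `x := e` -/
  | assign (x : ℕ) (e : Exp)
  /-- `a[i] := e` -/
  | store (a : ℕ) (i e : Exp)
  /-- toss a fair coin and put the outcome, `0` or `1`, into the variable `x` -/
  | flip (x : ℕ)
  | seq (p q : Prog)
  /-- if `e ≠ 0` then `p` else `q` -/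
  | cond (e : Exp) (p q : Prog)
  /-- while `e ≠ 0` do `p` -/
  | loop (e : Exp) (p : Prog)

/-- Write the value `v` to the variable `x`. -/
def State.setVar (s : State) (x v : ℕ) : State :=
  { s with var := Function.update s.var x v }

/-- Write the value `v` to the cell `a[i]`. -/
def State.setArr (s : State) (a i v : ℕ) : State :=
  { s with arr := Function.update s.arr a (Function.update (s.arr a) i v) }

/-- Put the next coin into the variable `x`. -/
def State.toss (s : State) (x : ℕ) : State :=
  { s with
    var := Function.update s.var x (if s.coins 0 then 1 else 0)
    coins := fun i => s.coins (i + 1) }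

/-- `Exec p s c s'`: started in the state `s`, the program `p` halts in the state `s'`, at total
cost (running time) `c`. -/
inductive Exec : Prog → State → ℕ → State → Prop
  | skip (s : State) : Exec .skip s 1 s
  | assign (x : ℕ) (e : Exp) (s : State) :
      Exec (.assign x e) s (e.cost s + 1 + (e.val s).size) (s.setVar x (e.val s))
  | store (a : ℕ) (i e : Exp) (s : State) :
      Exec (.store a i e) s (i.cost s + e.cost s + 1 + (i.val s).size + (e.val s).size)
        (s.setArr a (i.val s) (e.val s))
  | flip (x : ℕ) (s : State) : Exec (.flip x) s 1 (s.toss x)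
  | seq {p q : Prog} {s s' s'' : State} {c c' : ℕ} :
      Exec p s c s' → Exec q s' c' s'' → Exec (.seq p q) s (c + c') s''
  | cond_true {e : Exp} {p q : Prog} {s s' : State} {c : ℕ} :
      e.val s ≠ 0 → Exec p s c s' → Exec (.cond e p q) s (e.cost s + 1 + c) s'
  | cond_false {e : Exp} {p q : Prog} {s s' : State} {c : ℕ} :
      e.val s = 0 → Exec q s c s' → Exec (.cond e p q) s (e.cost s + 1 + c) s'
  | loop_stop {e : Exp} {p : Prog} {s : State} :
      e.val s = 0 → Exec (.loop e p) s (e.cost s + 1) s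
  | loop_step {e : Exp} {p : Prog} {s s' s'' : State} {c c' : ℕ} :
      e.val s ≠ 0 → Exec p s c s' → Exec (.loop e p) s' c' s'' →
      Exec (.loop e p) s (e.cost s + 1 + c + c') s''

/-- Once the coins are fixed, the run of a program is deterministic. -/
theorem Exec.unique {p : Prog} {s s₁ s₂ : State} {c₁ c₂ : ℕ}
    (h₁ : Exec p s c₁ s₁) (h₂ : Exec p s c₂ s₂) : c₁ = c₂ ∧ s₁ = s₂ := by
  induction h₁ generalizing c₂ s₂ with
  | skip | assign | store | flip => cases h₂; exact ⟨rfl, rfl⟩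
  | seq _ _ ih ih' =>
    cases h₂ with
    | seq k k' =>
      obtain ⟨rfl, rfl⟩ := ih k
      obtain ⟨rfl, rfl⟩ := ih' k'
      exact ⟨rfl, rfl⟩
  | cond_true he _ ih =>
    cases h₂ with
    | cond_true _ k => obtain ⟨rfl, rfl⟩ := ih k; exact ⟨rfl, rfl⟩
    | cond_false h => exact absurd h he
  | cond_false he _ ih =>
    cases h₂ with
    | cond_true h => exact absurd he h
    | cond_false _ k => obtain ⟨rfl, rfl⟩ := ih k; exact ⟨rfl, rfl⟩
  | loop_stop he =>
    cases h₂ with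
    | loop_stop => exact ⟨rfl, rfl⟩
    | loop_step h => exact absurd he h
  | loop_step he _ _ ih ih' =>
    cases h₂ with
    | loop_stop h => exact absurd h he
    | loop_step _ k k' =>
      obtain ⟨rfl, rfl⟩ := ih k
      obtain ⟨rfl, rfl⟩ := ih' k'
      exact ⟨rfl, rfl⟩

/-- The program halts within time `b`. -/
def HaltsWithin (p : Prog) (s : State) (b : ℕ) : Prop :=
  ∃ c s', Exec p s c s' ∧ c ≤ b

/-- The program halts with the answer yes, that is, with a nonzero value of the variable `0`. -/
def SaysYes (p : Prog) (s : State) : Prop :=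
  ∃ c s', Exec p s c s' ∧ s'.var 0 ≠ 0

/-- The distribution of an infinite sequence of independent fair coins. -/
noncomputable def coinMeasure : Measure (ℕ → Bool) :=
  Measure.infinitePi fun _ : ℕ => (PMF.uniformOfFintype Bool).toMeasure

end Ram

/-- The initial state of the machine. Variables `0`, `1`, `2` hold the number `n` of vertices, the
number `m` of nodes of the decomposition, and `k`. Arrays `0`, `1`, `2`, `3` hold the adjacency
matrix of the graph, the indicator vector of the terminals, the adjacency matrix of the tree, and
the node-vertex incidence matrix of the bags (matrices are stored row by row). All the rest is `0`.
No bound on the width is part of the input. -/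
noncomputable def secludedInput {n m : ℕ} (G : SimpleGraph (Fin n)) (S : Finset (Fin n)) (k : ℕ)
    (D : TreeDecomp G (Fin m)) (coins : ℕ → Bool) : Ram.State where
  var
    | 0 => n
    | 1 => m
    | 2 => k
    | _ => 0
  arr := by
    classical
    exact fun a i =>
      match a with
      | 0 => if ∃ u v : Fin n, i = u * n + v ∧ G.Adj u v then 1 else 0
      | 1 => if ∃ v : Fin n, i = v ∧ v ∈ S then 1 else 0
      | 2 => if ∃ p q : Fin m, i = p * m + q ∧ D.tree.Adj p q then 1 else 0
      | 3 => if ∃ (p : Fin m) (v : Fin n), i = p * n + v ∧ v ∈ D.bag p then 1 else 0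
      | _ => 0
  coins := coins

/-! ## A program logic with running times for the random access machine -/

namespace Ram

/-! The algorithm is Cut & Count, carried out modulo four. A vertex gets one of four states: 2 and 3
mean that it lies in the subgraph, on one of two sides of a cut; 1 means that it lies outside and is
not paid for; 0 means that it is not in the subgraph but is paid for, as a neighbour. An assignment
respects an edge if one end has state 0 or both ends have the same state. So 1 never meets 2 or 3,
the vertices of state other than 1 cover the closed neighbourhood of the chosen set
(`closedNbhd_subset`), and the two sides of the cut are not joined by an edge. Once the sides are
forgotten, an assignment with chosen set X comes from exactly 2^c cuts, where c is the number of
components of G[X] (`card_fiber`). For nonempty X this is 2 if G[X] is connected and a multiple of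
four otherwise. The empty set would contribute 1, but it is recognised by its weight zero, as all
vertex weights are positive.

Count the cuts that contain the terminals, separately for each number of paid vertices and each
total weight of X. A count with size at most k and nonzero weight that is not divisible by four must
come from a connected X, so a positive answer is never wrong (`isSecludedSteinerYes_of_card`).
Conversely, let c be the least possible size of a closed neighbourhood of a solution. For a
connected X and size c, minimality forces the paid vertices to be exactly the closed neighbourhood,
so X determines its assignment. If moreover a weight belongs to only one such X, the count is 2
modulo 4 (`card_mod_four`). Random weights from 1, …, 2^nb with 2^nb ≥ 2n isolate such an X with
probability at least 1/2: for each vertex, at most one value of its weight is bad once the other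
weights are fixed (`Ambiguous.eq`, `half_le_isolated`).

All counts are found at once by evaluating their generating function at z = 4^(n+1). There are at
most 4^n assignments, so no carries occur and the counts are the base z digits of one number with
polynomially many bits (`mod_four_digit`). This number is a sum over assignments of a product of
local factors. It is computed by eliminating leaves of the decomposition tree: a vertex of the leaf
bag that is missing from the neighbouring bag occurs in no other remaining bag, so the leaf can be
summed out into a table indexed by the restriction to the common vertices (`sum_assignments_union`,
`Round.total_eq`). A node is a plain product over its eliminated neighbours, so each bag costs
4^|bag| rounds of polynomial work and no convolution is needed.

For the machine model, `WP` is a total correctness logic in which the running time is a syntactic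
bound times the length of the numbers. The only exponentially long loop counts up to variable 20 and
is never nested in itself, so 4^t enters the bound linearly (`Prog.exists_steps_le`,
`depth_mainProg`). -/

/-- A factor by which the value of an expression may be longer than the contents of the memory. -/
def Exp.width : Exp → ℕ
  | .const c => c.size + 1
  | .var _ => 1
  | .get _ _ => 1
  | .op _ e₁ e₂ => e₁.width + e₂.width + 1

/-- A factor by which the cost of an expression may exceed the length of the memory contents. -/
def Exp.steps : Exp → ℕ
  | .const c => c.size + 1
  | .var _ => 1
  | .get _ e => e.steps + e.width + 1
  | .op _ e₁ e₂ => e₁.steps + e₂.steps + e₁.width + e₂.width + 1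

/-- A bound on the number of iterations of a loop that counts up to the variable `y`, given a bound
`b y` on the value of that variable. -/
def Exp.iterations (b : ℕ → ℕ) : Exp → ℕ
  | .op .lt _ (.var y) => b y
  | _ => 0

/-- A bound on the number of elementary steps of a program all of whose loops are counting loops,
given bounds `b` on the variables they count up to. -/
def Prog.steps (b : ℕ → ℕ) : Prog → ℕ
  | .skip => 1
  | .assign _ e => e.steps + e.width + 1
  | .store _ i e => i.steps + e.steps + i.width + e.width + 1
  | .flip _ => 1
  | .seq p q => p.steps b + q.steps b
  | .cond e p q => e.steps + 1 + p.steps b + q.steps b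
  | .loop e p => (e.iterations b + 1) * (e.steps + 1 + p.steps b)

/-- The variables a program writes to. -/
def Prog.vars : Prog → List ℕ
  | .skip => []
  | .assign x _ => [x]
  | .store _ _ _ => []
  | .flip x => [x]
  | .seq p q => p.vars ++ q.vars
  | .cond _ p q => p.vars ++ q.vars
  | .loop _ p => p.vars

/-- The arrays a program writes to. -/
def Prog.arrs : Prog → List ℕ
  | .skip => []
  | .assign _ _ => []
  | .store a _ _ => [a]
  | .flip _ => []
  | .seq p q => p.arrs ++ q.arrs
  | .cond _ p q => p.arrs ++ q.arrs
  | .loop _ p => p.arrs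

/-- The program tosses coins. -/
def Prog.tosses : Prog → Bool
  | .skip => false
  | .assign _ _ => false
  | .store _ _ _ => false
  | .flip _ => true
  | .seq p q => p.tosses || q.tosses
  | .cond _ p q => p.tosses || q.tosses
  | .loop _ p => p.tosses

/-- The states agree outside of the variables and arrays the program writes to, and in the coins
unless the program tosses some. -/
structure Prog.Frame (p : Prog) (s s' : State) : Prop where
  var : ∀ x, x ∉ p.vars → s'.var x = s.var x
  arr : ∀ a, a ∉ p.arrs → s'.arr a = s.arr a
  coins : p.tosses = false → s'.coins = s.coins

/-- All numbers in the memory have at most `L` binary digits. -/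
def State.Fits (L : ℕ) (s : State) : Prop :=
  (∀ x, s.var x < 2 ^ L) ∧ ∀ a i, s.arr a i < 2 ^ L

@[simp] theorem State.setVar_var (s : State) (x v y : ℕ) :
    (s.setVar x v).var y = if y = x then v else s.var y := by
  simp [State.setVar, Function.update_apply]

@[simp] theorem State.setVar_arr (s : State) (x v : ℕ) : (s.setVar x v).arr = s.arr := rfl

@[simp] theorem State.setVar_coins (s : State) (x v : ℕ) : (s.setVar x v).coins = s.coins := rfl

@[simp] theorem State.setArr_var (s : State) (a i v : ℕ) : (s.setArr a i v).var = s.var := rfl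

@[simp] theorem State.setArr_coins (s : State) (a i v : ℕ) : (s.setArr a i v).coins = s.coins := rfl

@[simp] theorem State.setArr_arr_self (s : State) (a i v : ℕ) :
    (s.setArr a i v).arr a = Function.update (s.arr a) i v := by
  simp [State.setArr]

theorem State.setArr_arr_of_ne (s : State) {a b : ℕ} (h : b ≠ a) (i v : ℕ) :
    (s.setArr a i v).arr b = s.arr b := by
  simp [State.setArr, h]

@[simp] theorem State.toss_var (s : State) (x y : ℕ) :
    (s.toss x).var y = if y = x then (if s.coins 0 then 1 else 0) else s.var y := by
  simp [State.toss, Function.update_apply]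

@[simp] theorem State.toss_arr (s : State) (x : ℕ) : (s.toss x).arr = s.arr := rfl

@[simp] theorem State.toss_coins (s : State) (x : ℕ) :
    (s.toss x).coins = fun i => s.coins (i + 1) := rfl

theorem State.Fits.setVar {L : ℕ} {s : State} (h : s.Fits L) {x v : ℕ} (hv : v < 2 ^ L) :
    (s.setVar x v).Fits L := by
  refine ⟨fun y => ?_, h.2⟩
  rw [State.setVar_var]
  split_ifs
  · exact hv
  · exact h.1 y

theorem State.Fits.setArr {L : ℕ} {s : State} (h : s.Fits L) {a i v : ℕ} (hv : v < 2 ^ L) :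
    (s.setArr a i v).Fits L := by
  refine ⟨h.1, fun b j => ?_⟩
  by_cases hb : b = a
  · subst hb
    rw [State.setArr_arr_self, Function.update_apply]
    split_ifs
    · exact hv
    · exact h.2 b j
  · rw [State.setArr_arr_of_ne _ hb]
    exact h.2 b j

/-- Products are the largest results. The extra digit is there for the comparison of 0 with 0, which
yields 1 from numbers of length zero. -/
theorem Op.size_apply_le (o : Op) (a b : ℕ) : (o.apply a b).size ≤ a.size + b.size + 1 := by
  have ha := Nat.lt_size_self a
  have hb := Nat.lt_size_self b
  have one : ∀ n : ℕ, 1 ≤ 2 ^ n := fun n => Nat.one_le_two_pow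
  have h1 := one a.size
  have h2 := one b.size
  have hle : ∀ c, c ≤ a ∨ c ≤ 1 → c < 2 ^ (a.size + b.size + 1) := by
    intro c hc
    rw [pow_succ, pow_add]
    have : 2 ^ a.size ≤ 2 ^ a.size * 2 ^ b.size := Nat.le_mul_of_pos_right _ h2
    omega
  rw [Nat.size_le]
  cases o with
  | add =>
    have h3 : 2 ^ a.size * 1 ≤ 2 ^ a.size * 2 ^ b.size := Nat.mul_le_mul_left _ h2
    have h4 : 1 * 2 ^ b.size ≤ 2 ^ a.size * 2 ^ b.size := Nat.mul_le_mul_right _ h1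
    rw [pow_succ, pow_add]
    simp only [Op.apply]
    omega
  | sub => exact hle _ (Or.inl (Nat.sub_le _ _))
  | mul =>
    have := Nat.mul_lt_mul'' ha hb
    rw [pow_succ, pow_add]
    simp only [Op.apply]
    omega
  | div => exact hle _ (Or.inl (Nat.div_le_self _ _))
  | mod => exact hle _ (Or.inl (Nat.mod_le _ _))
  | eq => exact hle _ (Or.inr (by simp only [Op.apply]; split_ifs <;> simp))
  | lt => exact hle _ (Or.inr (by simp only [Op.apply]; split_ifs <;> simp))

theorem Exp.size_val_le {L : ℕ} {s : State} (h : s.Fits L) (e : Exp) :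
    (e.val s).size ≤ e.width * (L + 1) := by
  induction e with
  | const c => simp only [Exp.val, Exp.width]; nlinarith
  | var x =>
    have := Nat.size_le.2 (h.1 x)
    simp only [Exp.val, Exp.width]; omega
  | get a e _ =>
    have := Nat.size_le.2 (h.2 a (e.val s))
    simp only [Exp.val, Exp.width]; omega
  | op o e₁ e₂ h₁ h₂ =>
    have := o.size_apply_le (e₁.val s) (e₂.val s)
    simp only [Exp.val, Exp.width]; nlinarith

/-- Separates the cost into a factor that depends only on the syntax and the length of the memory
contents, so that running times can be bounded without looking at states. The factor L + 1 instead
of L absorbs the unit charges. -/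
theorem Exp.cost_le {L : ℕ} {s : State} (h : s.Fits L) (e : Exp) :
    e.cost s ≤ e.steps * (L + 1) := by
  induction e with
  | const c => simp only [Exp.cost, Exp.steps]; nlinarith
  | var x =>
    have := Nat.size_le.2 (h.1 x)
    simp only [Exp.cost, Exp.steps]; omega
  | get a e ih =>
    have h₁ := Nat.size_le.2 (h.2 a (e.val s))
    have h₂ := e.size_val_le h
    simp only [Exp.cost, Exp.steps]; nlinarith
  | op o e₁ e₂ ih₁ ih₂ =>
    have h₁ := e₁.size_val_le h
    have h₂ := e₂.size_val_le h
    simp only [Exp.cost, Exp.steps]; nlinarith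

theorem Exec.frame {p : Prog} {s s' : State} {c : ℕ} (h : Exec p s c s') : p.Frame s s' := by
  induction h with
  | skip => exact ⟨fun _ _ => rfl, fun _ _ => rfl, fun _ => rfl⟩
  | assign x e s => exact ⟨fun y hy => by simp_all [Prog.vars], fun _ _ => rfl, fun _ => rfl⟩
  | store a i e s =>
    exact ⟨fun _ _ => rfl, fun b hb => State.setArr_arr_of_ne _ (by simp_all [Prog.arrs]) _ _,
      fun _ => rfl⟩
  | flip x s =>
    exact ⟨fun y hy => by simp_all [Prog.vars], fun _ _ => rfl, fun h => by simp [Prog.tosses] at h⟩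
  | seq _ _ ih ih' =>
    refine ⟨fun x hx => ?_, fun a ha => ?_, fun ht => ?_⟩
    · simp only [Prog.vars, List.mem_append, not_or] at hx
      rw [ih'.1 x hx.2, ih.1 x hx.1]
    · simp only [Prog.arrs, List.mem_append, not_or] at ha
      rw [ih'.2 a ha.2, ih.2 a ha.1]
    · simp only [Prog.tosses, Bool.or_eq_false_iff] at ht
      rw [ih'.3 ht.2, ih.3 ht.1]
  | cond_true _ _ ih =>
    exact ⟨fun x hx => ih.1 x fun h => hx (by simp [Prog.vars, h]),
      fun a ha => ih.2 a fun h => ha (by simp [Prog.arrs, h]),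
      fun ht => ih.3 (by simp_all [Prog.tosses])⟩
  | cond_false _ _ ih =>
    exact ⟨fun x hx => ih.1 x fun h => hx (by simp [Prog.vars, h]),
      fun a ha => ih.2 a fun h => ha (by simp [Prog.arrs, h]),
      fun ht => ih.3 (by simp_all [Prog.tosses])⟩
  | loop_stop => exact ⟨fun _ _ => rfl, fun _ _ => rfl, fun _ => rfl⟩
  | loop_step _ _ _ ih ih' =>
    exact ⟨fun x hx => (ih'.1 x hx).trans (ih.1 x hx), fun a ha => (ih'.2 a ha).trans (ih.2 a ha),
      fun ht => (ih'.3 ht).trans (ih.3 ht)⟩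

/-- Started in a state all of whose numbers have at most `L` digits, the program halts within its
step bound, in such a state again, and with the postcondition `Q`. -/
def WP (L : ℕ) (b : ℕ → ℕ) (p : Prog) (Q : State → Prop) (s : State) : Prop :=
  s.Fits L → ∃ c s', Exec p s c s' ∧ c ≤ p.steps b * (L + 1) ∧ s'.Fits L ∧ Q s'

/-- `for x := 0, …, y - 1 do p` -/
def Prog.count (x y : ℕ) (p : Prog) : Prog :=
  .seq (.assign x (.const 0))
    (.loop (.op .lt (.var x) (.var y)) (.seq p (.assign x (.op .add (.var x) (.const 1)))))

/-- `if e ≠ 0 then p` -/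
def Prog.when (e : Exp) (p : Prog) : Prog := .cond e p .skip

namespace WP

variable {L : ℕ} {b : ℕ → ℕ} {p q : Prog} {Q Q' : State → Prop} {s : State}

theorem mono (h : WP L b p Q s) (hQ : ∀ s', p.Frame s s' → s'.Fits L → Q s' → Q' s') :
    WP L b p Q' s := by
  intro hs
  obtain ⟨c, s', he, hc, hf, hq⟩ := h hs
  exact ⟨c, s', he, hc, hf, hQ s' he.frame hf hq⟩

theorem of_fits (h : s.Fits L → WP L b p Q s) : WP L b p Q s := fun hs => h hs hs

theorem skip (h : Q s) : WP L b .skip Q s :=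
  fun hs => ⟨_, _, .skip s, by simp [Prog.steps], hs, h⟩

theorem assign {x : ℕ} {e : Exp} (hv : e.val s < 2 ^ L) (h : Q (s.setVar x (e.val s))) :
    WP L b (.assign x e) Q s := by
  intro hs
  refine ⟨_, _, .assign x e s, ?_, hs.setVar hv, h⟩
  have h₁ := e.cost_le hs
  have h₂ := e.size_val_le hs
  simp only [Prog.steps]
  nlinarith

theorem store {a : ℕ} {i e : Exp} (hv : e.val s < 2 ^ L)
    (h : Q (s.setArr a (i.val s) (e.val s))) : WP L b (.store a i e) Q s := by
  intro hs
  refine ⟨_, _, .store a i e s, ?_, hs.setArr hv, h⟩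
  have h₁ := e.cost_le hs
  have h₂ := e.size_val_le hs
  have h₃ := i.cost_le hs
  have h₄ := i.size_val_le hs
  simp only [Prog.steps]
  nlinarith

theorem flip {x : ℕ} (hL : 0 < L) (h : Q (s.toss x)) : WP L b (.flip x) Q s := by
  intro hs
  refine ⟨_, _, .flip x s, by simp [Prog.steps], ⟨fun y => ?_, hs.2⟩, h⟩
  have := Nat.one_lt_two_pow hL.ne'
  rw [State.toss_var]
  split_ifs
  · exact this
  · omega
  · exact hs.1 y

theorem seq (h : WP L b p (WP L b q Q) s) : WP L b (.seq p q) Q s := by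
  intro hs
  obtain ⟨c, s', he, hc, hf, h'⟩ := h hs
  obtain ⟨c', s'', he', hc', hf', hq⟩ := h' hf
  refine ⟨_, s'', .seq he he', ?_, hf', hq⟩
  simp only [Prog.steps]
  nlinarith

theorem cond {e : Exp} (h₁ : e.val s ≠ 0 → WP L b p Q s) (h₂ : e.val s = 0 → WP L b q Q s) :
    WP L b (.cond e p q) Q s := by
  intro hs
  have hcost := e.cost_le hs
  by_cases he : e.val s = 0
  · obtain ⟨c, s', h, hc, hf, hq⟩ := h₂ he hs
    refine ⟨_, s', .cond_false he h, ?_, hf, hq⟩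
    simp only [Prog.steps]
    nlinarith
  · obtain ⟨c, s', h, hc, hf, hq⟩ := h₁ he hs
    refine ⟨_, s', .cond_true he h, ?_, hf, hq⟩
    simp only [Prog.steps]
    nlinarith

theorem when {e : Exp} (h₁ : e.val s ≠ 0 → WP L b p Q s) (h₂ : e.val s = 0 → Q s) :
    WP L b (.when e p) Q s :=
  cond h₁ fun h => skip (h₂ h)

/-- The body may write to neither the counter nor the limit, so the number of iterations is known in
advance and termination needs no separate argument. The invariant is restored after the increment,
and the frame relative to the initial state is passed on so that unchanged cells need not appear in
it. -/
theorem count {x y : ℕ} {I : ℕ → State → Prop} (hxy : x ≠ y) (hx : x ∉ p.vars) (hy : y ∉ p.vars)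
    (hb : s.var y ≤ b y) (h₀ : I 0 (s.setVar x 0))
    (hstep : ∀ j < s.var y, ∀ s', (Prog.count x y p).Frame s s' → s'.Fits L → s'.var x = j →
      I j s' → WP L b p (fun s'' => I (j + 1) (s''.setVar x (j + 1))) s')
    (hQ : ∀ s', (Prog.count x y p).Frame s s' → s'.Fits L → s'.var x = s.var y →
      I (s.var y) s' → Q s') :
    WP L b (.count x y p) Q s := by
  set F := (Prog.count x y p).Frame s with hF
  set body := Prog.seq p (.assign x (.op .add (.var x) (.const 1))) with hbody
  set test := Exp.op .lt (.var x) (.var y) with htest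
  set K := test.steps + 1 + body.steps b with hK
  -- Induction on the number d of iterations that remain. The factor d + 1 accounts for the final
  -- evaluation of the test.
  have key : ∀ d j s', j + d = s.var y → F s' → s'.Fits L → s'.var x = j → I j s' →
      ∃ c s'', Exec (.loop test body) s' c s'' ∧ c ≤ (d + 1) * K * (L + 1) ∧ s''.Fits L ∧
        F s'' ∧ s''.var x = s.var y ∧ I (s.var y) s'' := by
    intro d
    induction d with
    | zero =>
      intro j s' hj hf hfit hxj hI
      have hys : s'.var y = s.var y :=
        hf.1 y (by simp [Prog.count, Prog.vars, hy, Ne.symm hxy])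
      have hj' : j = s.var y := by omega
      have h0 : test.val s' = 0 := by simp [htest, Exp.val, Op.apply, hxj, hys, hj']
      refine ⟨_, s', Exec.loop_stop h0, ?_, hfit, hf, by rw [hxj, hj'], hj' ▸ hI⟩
      have := test.cost_le hfit
      nlinarith
    | succ d ih =>
      intro j s' hj hf hfit hxj hI
      have hys : s'.var y = s.var y :=
        hf.1 y (by simp [Prog.count, Prog.vars, hy, Ne.symm hxy])
      have h1 : test.val s' ≠ 0 := by
        have : j < s.var y := by omega
        simp [htest, Exp.val, Op.apply, hxj, hys, this]
      obtain ⟨c, s₁, he, hc, hf₁, hI₁⟩ := hstep j (by omega) s' hf hfit hxj hI hfit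
      have hfr := he.frame
      have hx₁ : s₁.var x = j := (hfr.1 x hx).trans hxj
      have hval : (Exp.op .add (.var x) (.const 1)).val s₁ = j + 1 := by
        simp [Exp.val, Op.apply, hx₁]
      -- The counter never exceeds the limit, which itself fits into the memory.
      have hlt : j + 1 < 2 ^ L := by
        have := hfit.1 y
        omega
      have hex := Exec.assign x (Exp.op .add (.var x) (.const 1)) s₁
      rw [hval] at hex
      have hF' : F (s₁.setVar x (j + 1)) := by
        refine ⟨fun w hw => ?_, fun a ha => ?_, fun ht => ?_⟩
        · have hw' := hw
          simp only [Prog.count, Prog.vars, List.mem_append, List.mem_singleton, not_or] at hw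
          rw [State.setVar_var, if_neg hw.1, hfr.1 w hw.2.1, hf.1 w hw']
        · have ha' := ha
          simp only [Prog.count, Prog.arrs, List.mem_append, not_or] at ha
          rw [State.setVar_arr, hfr.2 a ha.2.1, hf.2 a ha']
        · rw [State.setVar_coins, hfr.3 (by simp_all [Prog.count, Prog.tosses]), hf.3 ht]
      obtain ⟨c', s₂, he', hc', hrest⟩ := ih (j + 1) (s₁.setVar x (j + 1)) (by omega) hF'
        (hf₁.setVar hlt) (by simp) hI₁
      refine ⟨_, s₂, .loop_step h1 (.seq he hex) he', ?_, hrest⟩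
      have h₁ := test.cost_le hfit
      have h₂ := (Exp.op .add (.var x) (.const 1)).cost_le hf₁
      have h₃ := (Exp.op .add (.var x) (.const 1)).size_val_le hf₁
      rw [hval] at h₃
      have h₄ : body.steps b = p.steps b + ((Exp.op .add (.var x) (.const 1)).steps +
        (Exp.op .add (.var x) (.const 1)).width + 1) := rfl
      have h₅ : (d + 1 + 1) * K * (L + 1) = (d + 1) * K * (L + 1) + K * (L + 1) := by ring
      rw [h₅, hK, h₄]
      nlinarith
  intro hs
  have h0L : 0 < 2 ^ L := by positivity
  have hF0 : F (s.setVar x 0) := by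
    refine ⟨fun w hw => ?_, fun a ha => rfl, fun _ => rfl⟩
    simp only [Prog.count, Prog.vars, List.mem_append, List.mem_singleton, not_or] at hw
    rw [State.setVar_var, if_neg hw.1]
  obtain ⟨c, s', he, hc, hf, hF', hx', hI⟩ := key (s.var y) 0 (s.setVar x 0) (by simp) hF0
    (hs.setVar h0L) (by simp) h₀
  refine ⟨_, s', .seq (.assign x (.const 0) s) he, ?_, hf, hQ s' hF' hf hx' hI⟩
  have h₁ : (Prog.count x y p).steps b =
    ((Exp.const 0).steps + (Exp.const 0).width + 1) + (b y + 1) * K := rfl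
  have h₂ := (Exp.const 0).cost_le hs
  have h₃ := (Exp.const 0).size_val_le hs
  have h₄ : (s.var y + 1) * K * (L + 1) ≤ (b y + 1) * K * (L + 1) := by gcongr
  rw [h₁]
  nlinarith

end WP

end Ram

namespace Ram

/-! ### Step bounds are polynomial in the bounds on the loop variables -/

/-- The nesting depth of the loops of a program that count up to the variable `c`. -/
def Prog.depth (c : ℕ) : Prog → ℕ
  | .skip => 0
  | .assign _ _ => 0
  | .store _ _ _ => 0
  | .flip _ => 0
  | .seq p q => max (p.depth c) (q.depth c)
  | .cond _ p q => max (p.depth c) (q.depth c)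
  | .loop e p => e.iterations (fun y => if y = c then 1 else 0) + p.depth c

theorem Exp.iterations_le (c X A : ℕ) (e : Exp) (hX : 1 ≤ X) (hA : 1 ≤ A) :
    e.iterations (fun y => if y = c then A else X) + 1 ≤
      2 * A ^ e.iterations (fun y => if y = c then 1 else 0) * X := by
  have h : ∀ y, (if y = c then A else X) + 1 ≤ 2 * A ^ (if y = c then 1 else 0) * X := by
    intro y
    split_ifs
    · nlinarith
    · simp; omega
  unfold Exp.iterations
  split
  · exact h _
  · simp; omega

/-- A loop that counts up to `c` contributes a factor A, every other loop a factor X. The power of X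
may grow freely, and sequential parts simply add up its exponents; the exponent of A has to stay
exact, so there the maximum is taken. -/
theorem Prog.exists_steps_le (c : ℕ) (p : Prog) :
    ∃ C d : ℕ, ∀ X A : ℕ, 1 ≤ X → 1 ≤ A →
      p.steps (fun y => if y = c then A else X) ≤ C * A ^ p.depth c * X ^ d := by
  have add : ∀ {C₁ C₂ d₁ d₂ k₁ k₂ X A a b : ℕ}, 1 ≤ X → 1 ≤ A → a ≤ C₁ * A ^ k₁ * X ^ d₁ →
      b ≤ C₂ * A ^ k₂ * X ^ d₂ → a + b ≤ (C₁ + C₂) * A ^ max k₁ k₂ * X ^ (d₁ + d₂) := by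
    intro C₁ C₂ d₁ d₂ k₁ k₂ X A a b hX hA ha hb
    calc a + b ≤ C₁ * A ^ k₁ * X ^ d₁ + C₂ * A ^ k₂ * X ^ d₂ := add_le_add ha hb
      _ ≤ C₁ * A ^ max k₁ k₂ * X ^ (d₁ + d₂) + C₂ * A ^ max k₁ k₂ * X ^ (d₁ + d₂) := by
        gcongr <;> first | assumption | simp
      _ = _ := by ring
  induction p with
  | skip => exact ⟨1, 0, fun X A _ _ => by simp [Prog.steps, Prog.depth]⟩
  | assign x e => exact ⟨e.steps + e.width + 1, 0, fun X A _ _ => by simp [Prog.steps, Prog.depth]⟩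
  | store a i e =>
    exact ⟨i.steps + e.steps + i.width + e.width + 1, 0,
      fun X A _ _ => by simp [Prog.steps, Prog.depth]⟩
  | flip x => exact ⟨1, 0, fun X A _ _ => by simp [Prog.steps, Prog.depth]⟩
  | seq p q ihp ihq =>
    obtain ⟨C₁, d₁, h₁⟩ := ihp
    obtain ⟨C₂, d₂, h₂⟩ := ihq
    exact ⟨C₁ + C₂, d₁ + d₂, fun X A hX hA => add hX hA (h₁ X A hX hA) (h₂ X A hX hA)⟩
  | cond e p q ihp ihq =>
    obtain ⟨C₁, d₁, h₁⟩ := ihp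
    obtain ⟨C₂, d₂, h₂⟩ := ihq
    refine ⟨e.steps + 1 + (C₁ + C₂), d₁ + d₂, fun X A hX hA => ?_⟩
    have h := add hX hA (h₁ X A hX hA) (h₂ X A hX hA)
    have h' : 1 ≤ A ^ max (p.depth c) (q.depth c) * X ^ (d₁ + d₂) :=
      Nat.mul_pos (pow_pos hA _) (pow_pos hX _)
    simp only [Prog.steps, Prog.depth]
    nlinarith
  | loop e p ih =>
    obtain ⟨C, d, h⟩ := ih
    refine ⟨2 * (e.steps + 1 + C), d + 1, fun X A hX hA => ?_⟩
    have h₁ := h X A hX hA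
    have h₂ : 1 ≤ A ^ p.depth c * X ^ d := Nat.mul_pos (pow_pos hA _) (pow_pos hX _)
    have h₃ : e.steps + 1 + p.steps (fun y => if y = c then A else X) ≤
        (e.steps + 1 + C) * (A ^ p.depth c * X ^ d) := by nlinarith
    simp only [Prog.steps, Prog.depth]
    refine (Nat.mul_le_mul (e.iterations_le c X A hX hA) h₃).trans (le_of_eq ?_)
    ring

end Ram

/-! ## The program -/

namespace Secluded

open Ram

/-- `d := b ^ y`, with loop variable `x` -/
def powProg (d b x y : ℕ) : Prog :=
  .seq (.assign d (.const 1)) (.count x y (.assign d (.op .mul (.var d) (.var b))))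

/-- Variable `5` becomes the least `b` with `2 n ≤ 2 ^ b`, and variable `4` becomes `2 ^ b`. -/
def bitsProg : Prog :=
  .seq (.assign 4 (.const 1)) <| .seq (.assign 5 (.const 0)) <|
    .count 11 0 (.when (.op .lt (.var 4) (.op .mul (.const 2) (.var 0)))
      (.seq (.assign 4 (.op .mul (.const 2) (.var 4)))
        (.assign 5 (.op .add (.var 5) (.const 1)))))

/-- The numbers that depend on `n` only: `z`, the bits per weight, `W`, `z ^ W`, `Q`, `E`. -/
def constProg : Prog :=
  .seq (.assign 9 (.op .add (.var 0) (.const 1))) <|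
  .seq (.assign 10 (.const 4)) <|
  .seq (powProg 3 10 11 9) <|
  .seq bitsProg <|
  .seq (.assign 6 (.op .add (.op .mul (.var 0) (.var 4)) (.const 1))) <|
  .seq (powProg 7 3 11 6) <|
  .seq (powProg 8 7 11 9) <|
  .assign 10 (.op .mul (.var 9) (.var 6))

/-- Draw the weights: cell `v` of array `4` becomes `z` to the power of a random weight. -/
def weightProg : Prog :=
  .count 11 0 <|
    .seq (.assign 26 (.const 1)) <|
    .seq (.count 12 5 (.seq (.flip 25) (.assign 26
      (.op .mul (.op .mul (.var 26) (.var 26))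
        (.op .add (.const 1) (.op .mul (.var 25) (.op .sub (.var 3) (.const 1)))))))) <|
    .store 4 (.var 11) (.op .mul (.var 26) (.var 3))

/-- The cell `e₁ * x + e₂` of the array `a`. -/
abbrev cell (a : ℕ) (e₁ : Exp) (x : ℕ) (e₂ : Exp) : Exp :=
  .get a (.op .add (.op .mul e₁ (.var x)) e₂)

/-- Count the remaining neighbours of node `14` in variable `18`, and keep one in variable `19`. -/
def degProg : Prog :=
  .seq (.assign 18 (.const 0)) <| .seq (.assign 19 (.var 1)) <|
    .count 15 1 (.when (.op .mul (cell 2 (.var 14) 1 (.var 15)) (.op .eq (.get 6 (.var 15)) (.const 0)))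
      (.seq (.assign 18 (.op .add (.var 18) (.const 1))) (.assign 19 (.var 15))))

/-- Find a leaf `16` of the remaining tree, and its neighbour `17`. -/
def leafProg : Prog :=
  .count 14 1 (.when (.op .eq (.get 6 (.var 14)) (.const 0))
    (.seq degProg (.when (.op .lt (.var 18) (.const 2))
      (.seq (.assign 16 (.var 14)) (.assign 17 (.var 19))))))

/-- The number of assignments of the bag of node `16`. -/
def sizeProg : Prog :=
  .seq (.assign 20 (.const 1)) <|
    .count 11 0 (.when (cell 3 (.var 16) 0 (.var 11)) (.assign 20 (.op .mul (.const 4) (.var 20))))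

/-- Decode the number `21` into an assignment of the bag of node `16`. -/
def decodeProg : Prog :=
  .seq (.assign 22 (.var 21)) <|
    .count 11 0 (.cond (cell 3 (.var 16) 0 (.var 11))
      (.seq (.store 5 (.var 11) (.op .mod (.var 22) (.const 4)))
        (.assign 22 (.op .div (.var 22) (.const 4))))
      (.store 5 (.var 11) (.const 0)))

/-- Set `23` to `1` if the assignment respects all edges, and to `0` otherwise. -/
def checkProg : Prog :=
  .seq (.assign 23 (.const 1)) <|
    .count 12 0 (.count 11 0 (.when
      (.op .mul (.op .mul (cell 0 (.var 12) 0 (.var 11))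
        (.op .mul (.get 5 (.var 12)) (.get 5 (.var 11))))
        (.op .sub (.const 1) (.op .eq (.get 5 (.var 12)) (.get 5 (.var 11)))))
      (.assign 23 (.const 0))))

/-- Encode the restriction of the assignment to the bag of the node in variable `x`. -/
def codeProg (x : ℕ) : Prog :=
  .seq (.assign 24 (.const 0)) <|
    .count 11 0 (.assign 24 (.op .add (.op .mul (.const 4) (.var 24))
      (.op .mul (.get 5 (.var 11)) (cell 3 (.var x) 0 (.var 11)))))

/-- Multiply `23` by the table entries of the eliminated neighbours of node `16`. -/
def childProg : Prog :=
  .count 15 1 (.when (.op .eq (.get 6 (.var 15)) (.op .add (.var 16) (.const 1)))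
    (.seq (codeProg 15) (.assign 23
      (.op .mod (.op .mul (.var 23) (cell 7 (.var 24) 1 (.var 15))) (.var 8)))))

/-- The factor of the vertex `11` under the assignment. -/
abbrev factorExp : Exp :=
  .op .mul (.op .mul
    (.op .sub (.const 1) (.op .mul (.get 1 (.var 11)) (.op .lt (.get 5 (.var 11)) (.const 2))))
    (.op .add (.const 1) (.op .mul (.op .sub (.var 7) (.const 1))
      (.op .sub (.const 1) (.op .eq (.get 5 (.var 11)) (.const 1))))))
    (.op .add (.const 1) (.op .mul (.op .sub (.get 4 (.var 11)) (.const 1))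
      (.op .lt (.const 1) (.get 5 (.var 11)))))

/-- Multiply `23` by the factors of the vertices that are in the bag of node `16`, but not in the
bag of node `17`. -/
def forgetProg : Prog :=
  .count 11 0 (.when (.op .lt (cell 3 (.var 17) 0 (.var 11)) (cell 3 (.var 16) 0 (.var 11)))
    (.assign 23 (.op .mod (.op .mul (.var 23) factorExp) (.var 8))))

/-- Add the contribution of the assignment number `21` to the table of node `16`. -/
def entryProg : Prog :=
  .seq decodeProg <| .seq checkProg <| .seq childProg <| .seq forgetProg <| .seq (codeProg 17) <|
    .store 7 (.op .add (.op .mul (.var 24) (.var 1)) (.var 16))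
      (.op .mod (.op .add (cell 7 (.var 24) 1 (.var 16)) (.var 23)) (.var 8))

/-- Eliminate one node. -/
def roundProg : Prog :=
  .seq leafProg <| .seq (.store 6 (.var 16) (.op .add (.var 17) (.const 1))) <|
    .seq sizeProg (.count 21 20 entryProg)

/-- Look for a digit of the total that is not divisible by four. -/
def readProg : Prog :=
  .seq (.assign 27 (.get 7 (.var 16))) <| .seq (.assign 28 (.const 0)) <|
  .seq (.count 29 10 (.seq
    (.when (.op .mul (.op .mul (.op .mod (.var 27) (.const 4)) (.op .mod (.var 29) (.var 6)))
      (.op .sub (.const 1) (.op .lt (.var 2) (.op .div (.var 29) (.var 6)))))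
      (.assign 28 (.const 1)))
    (.assign 27 (.op .div (.var 27) (.var 3))))) <|
  .assign 0 (.var 28)

/-- The program. -/
def mainProg : Prog :=
  .seq constProg <| .seq weightProg <| .seq (.count 13 1 roundProg) readProg

/-- This is why the running time has the factor 4^t and not a power of it: the enumeration of the
assignments of a bag is the only loop that counts up to variable 20. -/
theorem depth_mainProg : mainProg.depth 20 = 1 := by decide

end Secluded

/-! ### Correctness of the initialisation: parameters and random weights -/

namespace Secluded

open Ram

/-- The parameters of a run of the program: the input, the number `nb` of random bits per weight,
the powers `pw` of `z` that encode the weights, a bound `L` on the lengths of the numbers, and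
bounds `b` on the loop variables. -/
structure Env where
  n : ℕ
  m : ℕ
  k : ℕ
  nb : ℕ
  L : ℕ
  b : ℕ → ℕ
  adj : ℕ → ℕ
  term : ℕ → ℕ
  tree : ℕ → ℕ
  bag : ℕ → ℕ
  pw : ℕ → ℕ

namespace Env

variable (e : Env)

/-- The base `z` exceeds the number 4^n of assignments, and it is divisible by four, so digits
modulo four can be read off. `W` exceeds every total weight, so position W * c + w encodes the pair
of a size c and a weight w. With sizes up to n there are (n + 1) * W positions, and the packed
number is less than `Q`. -/
def z : ℕ := 4 ^ (e.n + 1)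
def W : ℕ := e.n * 2 ^ e.nb + 1
def zW : ℕ := e.z ^ e.W
def Q : ℕ := e.zW ^ (e.n + 1)
def digits : ℕ := (e.n + 1) * e.W

/-- The constraints on the parameters. -/
structure Valid : Prop where
  nb_eq : e.nb = Nat.clog 2 (2 * e.n)
  Q_lt : e.Q < 2 ^ e.L
  m_lt : e.m + 1 < 2 ^ e.L
  n_b : e.n + 1 ≤ e.b 0
  m_b : e.m ≤ e.b 1
  nb_b : e.nb ≤ e.b 5
  W_b : e.W ≤ e.b 6
  n_b' : e.n + 1 ≤ e.b 9
  digits_b : e.digits ≤ e.b 10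

theorem one_lt_z : 1 < e.z := Nat.one_lt_pow (by omega) (by norm_num)

theorem W_pos : 0 < e.W := Nat.succ_pos _

theorem z_le_zW : e.z ≤ e.zW := Nat.le_self_pow e.W_pos.ne' _

theorem zW_le_Q : e.zW ≤ e.Q := Nat.le_self_pow (by omega) _

theorem Q_eq : e.Q = e.z ^ e.digits := by
  rw [Q, zW, digits, ← pow_mul, mul_comm]

theorem digits_lt_Q : e.digits < e.Q := by
  rw [Q_eq]
  exact Nat.lt_pow_self e.one_lt_z

theorem W_le_digits : e.W ≤ e.digits := Nat.le_mul_of_pos_left _ (by omega)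

theorem n_lt_digits : e.n < e.digits := by
  have := e.W_pos
  unfold digits
  nlinarith

theorem one_lt_Q : 1 < e.Q := e.one_lt_z.trans_le (e.z_le_zW.trans e.zW_le_Q)

theorem two_pow_nb_le : e.Valid → 2 ^ e.nb ≤ e.W := by
  intro h
  rw [W]
  -- For n = 0 the summand 1 in `W` is essential: then nb = 0 and both sides equal 1.
  rcases Nat.eq_zero_or_pos e.n with h0 | h0
  · have : e.nb = 0 := by rw [h.nb_eq, h0]; simp
    rw [this]
    simp
  · nlinarith [Nat.one_le_two_pow (n := e.nb)]

end Env

variable {L : ℕ} {b : ℕ → ℕ} {s : State}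

theorem wp_powProg {d c x y : ℕ} (hd : d ≠ c ∧ d ≠ x ∧ d ≠ y) (hx : x ≠ c ∧ x ≠ y)
    (hb : s.var y ≤ b y) (hL : s.var c ^ s.var y < 2 ^ L) (h1 : 1 ≤ s.var c) :
    WP L b (powProg d c x y) (fun s' => s'.var d = s.var c ^ s.var y) s := by
  obtain ⟨hd₁, hd₂, hd₃⟩ := hd
  obtain ⟨hx₁, hx₂⟩ := hx
  have h1L : 1 < 2 ^ L ∨ s.var c ^ s.var y = 1 := by
    have := Nat.one_le_pow (s.var y) _ h1
    omega
  refine WP.seq (WP.assign ?_ ?_)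
  · have := Nat.one_le_pow (s.var y) _ h1
    simp only [Exp.val]
    omega
  · refine WP.count (I := fun j s' => s'.var d = s.var c ^ j) hx₂ (by simpa [Prog.vars] using hd₂.symm)
      (by simpa [Prog.vars] using hd₃.symm) (by simpa [hd₃.symm] using hb) ?_ ?_ ?_
    · simp [Exp.val, hd₂]
    · intro j hj s' hF _ hxj hI
      simp only [State.setVar_var, hd₃.symm, if_false] at hj
      have hc : s'.var c = s.var c := by
        rw [hF.1 c (by simp [Prog.count, Prog.vars, hd₁.symm, hx₁.symm])]
        simp [hd₁.symm]
      have hval : (Exp.op .mul (.var d) (.var c)).val s' = s.var c ^ (j + 1) := by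
        simp [Exp.val, Op.apply, hI, hc, pow_succ]
      refine WP.assign ?_ ?_
      · rw [hval]
        exact (Nat.pow_le_pow_right h1 hj).trans_lt hL
      · rw [hval]
        simp [hd₂]
    · intro s' _ _ _ hI
      simpa [hd₃.symm] using hI

/-- The logarithm of 2n is at most n, so n rounds of conditional doubling suffice. After j of them
the exponent is the minimum of j and its final value. -/
theorem wp_bitsProg (hb : s.var 0 ≤ b 0) (hn : 4 * s.var 0 + 1 < 2 ^ L) :
    WP L b bitsProg (fun s' => s'.var 5 = Nat.clog 2 (2 * s.var 0) ∧
      s'.var 4 = 2 ^ Nat.clog 2 (2 * s.var 0)) s := by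
  set K := Nat.clog 2 (2 * s.var 0) with hK
  have hKn : K ≤ s.var 0 := by
    rw [hK, Nat.clog_le_iff_le_pow (by norm_num)]
    have := Nat.lt_two_pow_self (n := s.var 0 - 1)
    rcases Nat.eq_zero_or_pos (s.var 0) with h | h
    · simp [h]
    · obtain ⟨a, ha⟩ : ∃ a, s.var 0 = a + 1 := ⟨s.var 0 - 1, by omega⟩
      rw [ha, pow_succ]
      have := Nat.lt_two_pow_self (n := a)
      omega
  have hlt : ∀ j, 2 ^ j < 2 * s.var 0 ↔ j < K := by
    intro j
    rw [hK, Nat.lt_clog_iff_pow_lt (by norm_num)]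
  refine WP.seq (WP.assign ?_ (WP.seq (WP.assign ?_ ?_)))
  · simp only [Exp.val]; omega
  · simp only [Exp.val]; omega
  refine WP.count (I := fun j s' => s'.var 5 = min j K ∧ s'.var 4 = 2 ^ min j K)
    (by decide) (by decide) (by decide) (by simpa using hb) (by simp [Exp.val]) ?_ ?_
  · rintro j - s' hF - - ⟨h5, h4⟩
    have h0 : s'.var 0 = s.var 0 := by
      rw [hF.1 0 (by decide)]
      simp
    refine WP.when (fun h => ?_) (fun h => ?_)
    · simp only [Exp.val, Op.apply, h4, h0] at h
      have hlt' : 2 ^ min j K < 2 * s.var 0 := by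
        by_contra hc
        simp [hc] at h
      have hj : j < K := by
        have := (hlt _).1 hlt'
        omega
      rw [min_eq_left hj.le] at h4 h5 hlt'
      refine WP.seq (WP.assign ?_ (WP.assign ?_ ?_))
      · simp only [Exp.val, Op.apply, h4]
        omega
      · simp [Exp.val, Op.apply, h5]
        omega
      · simp [Exp.val, Op.apply, h5, h4, min_eq_left (show j + 1 ≤ K from hj), pow_succ, mul_comm]
    · simp only [Exp.val, Op.apply, h4, h0] at h
      have hlt' : ¬ 2 ^ min j K < 2 * s.var 0 := by
        intro hc
        simp [hc] at h
      have hj : K ≤ j := by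
        rw [hlt] at hlt'
        omega
      rw [min_eq_right hj] at h4 h5
      simp [h5, h4, min_eq_right (show K ≤ j + 1 by omega)]
  · rintro s' - - - ⟨h5, h4⟩
    have h0 : ((s.setVar 4 ((Exp.const 1).val s)).setVar 5
      ((Exp.const 0).val (s.setVar 4 ((Exp.const 1).val s)))).var 0 = s.var 0 := by simp
    rw [h0, min_eq_right hKn] at h4 h5
    exact ⟨h5, h4⟩

/-- The variables that hold the parameters have their intended values. -/
structure Env.Vars (e : Env) (s : State) : Prop where
  v0 : s.var 0 = e.n
  v1 : s.var 1 = e.m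
  v2 : s.var 2 = e.k
  v3 : s.var 3 = e.z
  v5 : s.var 5 = e.nb
  v6 : s.var 6 = e.W
  v7 : s.var 7 = e.zW
  v8 : s.var 8 = e.Q
  v10 : s.var 10 = e.digits

/-- Besides, the arrays that hold the input and the weights have their intended values. -/
structure Env.Holds (e : Env) (s : State) : Prop extends e.Vars s where
  a0 : s.arr 0 = e.adj
  a1 : s.arr 1 = e.term
  a2 : s.arr 2 = e.tree
  a3 : s.arr 3 = e.bag
  a4 : s.arr 4 = e.pw

theorem Env.Vars.of_frame {e : Env} {s s' : State} {p : Prog} (h : e.Vars s)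
    (hv : ∀ x ∈ p.vars, 10 < x) (hF : p.Frame s s') : e.Vars s' := by
  have key : ∀ x ≤ 10, s'.var x = s.var x := fun x hx => hF.1 x fun hm => by
    have := hv x hm
    omega
  constructor <;> rw [key _ (by norm_num)]
  exacts [h.v0, h.v1, h.v2, h.v3, h.v5, h.v6, h.v7, h.v8, h.v10]

theorem Env.Holds.of_frame {e : Env} {s s' : State} {p : Prog} (h : e.Holds s)
    (hv : ∀ x ∈ p.vars, 10 < x) (ha : ∀ a ∈ p.arrs, 4 < a) (hF : p.Frame s s') : e.Holds s' := by
  have key : ∀ a ≤ 4, s'.arr a = s.arr a := fun a hx => hF.2 a fun hm => by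
    have := ha a hm
    omega
  refine ⟨h.toVars.of_frame hv hF, ?_, ?_, ?_, ?_, ?_⟩ <;> rw [key _ (by norm_num)]
  exacts [h.a0, h.a1, h.a2, h.a3, h.a4]

theorem wp_constProg {e : Env} (he : e.Valid) (h0 : s.var 0 = e.n) (h1 : s.var 1 = e.m)
    (h2 : s.var 2 = e.k) : WP e.L e.b constProg e.Vars s := by
  have hQ := he.Q_lt
  have hdQ := e.digits_lt_Q
  have hnd := e.n_lt_digits
  have hWd := e.W_le_digits
  have hzz := e.z_le_zW
  have hzQ := e.zW_le_Q
  have hz1 := e.one_lt_z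
  have hM := e.two_pow_nb_le he
  have hz4 : 4 * (e.n + 1) ≤ e.z := by
    have := Nat.lt_pow_self (n := e.n) (a := 4) (by norm_num)
    rw [Env.z, pow_succ]
    omega
  have hb := he.n_b'
  have hb' := he.n_b
  have hb'' := he.W_b
  refine WP.seq (WP.assign ?_ (WP.seq (WP.assign ?_ (WP.seq ?_))))
  · simp only [Exp.val, Op.apply, h0]; omega
  · simp only [Exp.val]; omega
  refine (wp_powProg (by decide) (by decide) (by simpa [Exp.val, Op.apply, h0] using hb)
    (by simpa [Exp.val, Op.apply, h0, Env.z] using (show e.z < _ by omega)) (by simp [Exp.val])).mono ?_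
  intro s₁ hF₁ _ h3
  simp only [Exp.val, Op.apply, State.setVar_var, h0, reduceIte, Nat.reduceEqDiff] at h3
  have e₁ : s₁.var 0 = e.n ∧ s₁.var 1 = e.m ∧ s₁.var 2 = e.k ∧ s₁.var 9 = e.n + 1 := by
    refine ⟨?_, ?_, ?_, ?_⟩ <;> rw [hF₁.1 _ (by decide)] <;> simp [Exp.val, Op.apply, h0, h1, h2]
  obtain ⟨a0, a1, a2, a9⟩ := e₁
  refine WP.seq ((wp_bitsProg (by omega) (by omega)).mono ?_)
  rintro s₂ hF₂ - ⟨b5, b4⟩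
  rw [a0, ← he.nb_eq] at b4 b5
  have e₂ : s₂.var 0 = e.n ∧ s₂.var 1 = e.m ∧ s₂.var 2 = e.k ∧ s₂.var 3 = e.z ∧
      s₂.var 9 = e.n + 1 := by
    refine ⟨?_, ?_, ?_, ?_, ?_⟩ <;> rw [hF₂.1 _ (by decide)] <;> assumption
  obtain ⟨b0, b1, b2, b3, b9⟩ := e₂
  have hW : (Exp.op .add (.op .mul (.var 0) (.var 4)) (.const 1)).val s₂ = e.W := by
    simp [Exp.val, Op.apply, b0, b4, Env.W]
  refine WP.seq (WP.assign (by rw [hW]; omega) ?_)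
  rw [hW]
  refine WP.seq ((wp_powProg (by decide) (by decide) (by simpa using hb'') ?_ ?_).mono ?_)
  · simpa [b3, Env.zW] using (show e.zW < _ by omega)
  · simp [b3]; omega
  intro s₃ hF₃ _ c7
  simp only [State.setVar_var, b3, reduceIte, Nat.reduceEqDiff] at c7
  have e₃ : s₃.var 0 = e.n ∧ s₃.var 1 = e.m ∧ s₃.var 2 = e.k ∧ s₃.var 3 = e.z ∧
      s₃.var 5 = e.nb ∧ s₃.var 6 = e.W ∧ s₃.var 9 = e.n + 1 := by
    refine ⟨?_, ?_, ?_, ?_, ?_, ?_, ?_⟩ <;> rw [hF₃.1 _ (by decide)] <;> simp [*]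
  obtain ⟨c0, c1, c2, c3, c5, c6, c9⟩ := e₃
  change s₃.var 7 = e.zW at c7
  refine WP.seq ((wp_powProg (by decide) (by decide) (by omega) ?_ ?_).mono ?_)
  · rw [c7, c9]; exact hQ
  · omega
  intro s₄ hF₄ _ d8
  rw [c7, c9] at d8
  have e₄ : s₄.var 0 = e.n ∧ s₄.var 1 = e.m ∧ s₄.var 2 = e.k ∧ s₄.var 3 = e.z ∧
      s₄.var 5 = e.nb ∧ s₄.var 6 = e.W ∧ s₄.var 7 = e.zW ∧ s₄.var 9 = e.n + 1 := by
    refine ⟨?_, ?_, ?_, ?_, ?_, ?_, ?_, ?_⟩ <;> rw [hF₄.1 _ (by decide)] <;> assumption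
  obtain ⟨d0, d1, d2, d3, d5, d6, d7, d9⟩ := e₄
  have hd : (Exp.op .mul (.var 9) (.var 6)).val s₄ = e.digits := by
    simp [Exp.val, Op.apply, d9, d6, Env.digits]
  refine WP.assign (by rw [hd]; omega) ?_
  rw [hd]
  constructor <;> simp [*]
  rfl

/-- The number whose binary digits are the first `j` coins. -/
def draw (ω : ℕ → Bool) : ℕ → ℕ
  | 0 => 0
  | j + 1 => 2 * draw ω j + if ω j then 1 else 0

theorem draw_lt (ω : ℕ → Bool) (j : ℕ) : draw ω j < 2 ^ j := by
  induction j with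
  | zero => simp [draw]
  | succ j ih =>
    rw [draw, pow_succ]
    split_ifs <;> omega

/-- The weight of the vertex `v`, if `nb` random bits are used for every vertex. -/
def weight (nb : ℕ) (ω : ℕ → Bool) (v : ℕ) : ℕ := draw (fun i => ω (v * nb + i)) nb + 1

theorem weight_le (nb : ℕ) (ω : ℕ → Bool) (v : ℕ) : weight nb ω v ≤ 2 ^ nb := draw_lt _ _

/-- Horner's scheme in the exponent: squaring doubles the exponent and 1 + coin * (z - 1) adds the
coin to it. The last factor z makes the weight positive. Vertex v uses the nb coins from position v
* nb on. -/
theorem wp_weightProg {e : Env} (he : e.Valid) (hs : e.Vars s) :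
    WP e.L e.b weightProg
      (fun s' => ∀ v < e.n, s'.arr 4 v = e.z ^ weight e.nb s.coins v) s := by
  have hQ := he.Q_lt
  have hz1 := e.one_lt_z
  have hzQ := e.zW_le_Q
  have hM := e.two_pow_nb_le he
  have hb0 := he.n_b
  have hb5 := he.nb_b
  have hLpos : 0 < e.L := by
    rcases Nat.eq_zero_or_pos e.L with h | h
    · have := e.one_lt_Q
      rw [h] at hQ
      omega
    · exact h
  have hpow : ∀ j ≤ 2 ^ e.nb, e.z ^ j < 2 ^ e.L := fun j hj =>
    (Nat.pow_le_pow_right (by omega) (hj.trans hM)).trans_lt (hzQ.trans_lt hQ)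
  refine WP.count (I := fun j s' => (∀ v < j, s'.arr 4 v = e.z ^ weight e.nb s.coins v) ∧
    s'.coins = fun i => s.coins (j * e.nb + i)) (by decide) (by decide) (by decide)
    (by rw [hs.v0]; omega) (by simp) ?_ ?_
  · rintro j hj s₁ hF - h11 ⟨hI, hc⟩
    have hv := hs.of_frame (by decide) hF
    refine WP.seq (WP.assign (by simpa [Exp.val] using hpow 0 (by simp)) ?_)
    refine WP.seq ?_
    refine WP.count (I := fun i s' =>
      s'.var 26 = e.z ^ draw (fun l => s.coins (j * e.nb + l)) i ∧
      s'.coins = fun l => s.coins (j * e.nb + i + l)) (by decide) (by decide) (by decide)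
      (by simpa [hv.v5] using hb5) ?_ ?_ ?_
    · simp [Exp.val, draw, hc]
    · rintro i hi s₂ hF₂ - h12 ⟨h26, hc₂⟩
      have h3 : s₂.var 3 = e.z := by
        rw [hF₂.1 3 (by decide)]
        simp [hv.v3]
      simp only [State.setVar_var, Nat.reduceEqDiff, if_false, hv.v5] at hi
      have hval : (Exp.op .mul (.op .mul (.var 26) (.var 26)) (.op .add (.const 1)
          (.op .mul (.var 25) (.op .sub (.var 3) (.const 1))))).val (s₂.toss 25) =
          e.z ^ draw (fun l => s.coins (j * e.nb + l)) (i + 1) := by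
        simp only [Exp.val, Op.apply, State.toss_var, Nat.reduceEqDiff,
          if_false, if_true, h26, h3, draw, hc₂, add_zero]
        split_ifs
        · rw [pow_succ, two_mul, pow_add, one_mul, Nat.add_sub_cancel' hz1.le]
        · simp [two_mul, pow_add]
      refine WP.seq (WP.flip hLpos (WP.assign ?_ ?_))
      · rw [hval]
        refine hpow _ ((draw_lt _ _).le.trans (Nat.pow_le_pow_right (by norm_num) hi))
      · rw [hval]
        refine ⟨by simp, ?_⟩
        simp only [State.setVar_coins, State.toss_coins, hc₂]
        funext l
        congr 1
        ring
    · rintro s₂ hF₂ - - ⟨h26, hc₂⟩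
      have h3 : s₂.var 3 = e.z := by
        rw [hF₂.1 3 (by decide)]
        simp [hv.v3]
      have h11' : s₂.var 11 = j := by
        rw [hF₂.1 11 (by decide)]
        simp [h11]
      have h4 : s₂.arr 4 = s₁.arr 4 := by
        rw [hF₂.2 4 (by decide)]
        simp
      simp only [State.setVar_var, Nat.reduceEqDiff, if_false, hv.v5]
        at h26 hc₂
      have hval : (Exp.op .mul (.var 26) (.var 3)).val s₂ = e.z ^ weight e.nb s.coins j := by
        simp [Exp.val, Op.apply, h26, h3, weight, pow_succ]
      refine WP.store ?_ ?_
      · rw [hval]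
        exact hpow _ (weight_le _ _ _)
      · rw [hval]
        refine ⟨fun v hvj => ?_, ?_⟩
        · simp only [State.setVar_arr, State.setArr_arr_self, Exp.val, h11', h4,
            Function.update_apply]
          split_ifs with h
          · rw [h]
          · exact hI v (by omega)
        · simp only [State.setVar_coins, State.setArr_coins, hc₂]
          funext l
          congr 1
          ring
  · rintro s' - - - ⟨h, -⟩
    rwa [hs.v0] at h

end Secluded

/-! ### Correctness of the search for a leaf and of the enumeration of bag assignments -/

namespace Secluded

open Ram

variable {e : Env} {s : State}

/-- The neighbours of node `i` that have not been eliminated. -/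
def rest (e : Env) (par : ℕ → ℕ) (i : ℕ) (j : ℕ) : Finset ℕ :=
  (Finset.range j).filter fun l => e.tree (i * e.m + l) ≠ 0 ∧ par l = 0

/-- If no neighbour remains, the default m is kept. It serves as a fictitious node with an empty
bag, in favour of which the last node is eliminated. -/
theorem wp_degProg (he : e.Valid) (hs : e.Holds s) :
    WP e.L e.b degProg (fun s' => s'.var 18 = (rest e (s.arr 6) (s.var 14) e.m).card ∧
      (rest e (s.arr 6) (s.var 14) e.m = ∅ ∧ s'.var 19 = e.m ∨
        s'.var 19 ∈ rest e (s.arr 6) (s.var 14) e.m)) s := by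
  have hm := he.m_lt
  have hmb := he.m_b
  set N := rest e (s.arr 6) (s.var 14) with hN
  have hcard : ∀ j, (N j).card ≤ j := fun j =>
    (Finset.card_filter_le _ _).trans (Finset.card_range j).le
  have h0 : N 0 = ∅ := by simp [hN, rest]
  refine WP.seq (WP.assign (by simp [Exp.val]) (WP.seq (WP.assign ?_ ?_)))
  · simp [Exp.val, hs.v1]; omega
  refine WP.count (I := fun j s' => s'.var 18 = (N j).card ∧
    (N j = ∅ ∧ s'.var 19 = e.m ∨ s'.var 19 ∈ N j)) (by decide) (by decide) (by decide)
    (by simpa [hs.v1] using hmb) (by simp [Exp.val, h0, hs.v1]) ?_ ?_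
  · rintro j hj s₁ hF - h15 ⟨h18, h19⟩
    have hj' : j < e.m := by simpa [hs.v1] using hj
    have e₁ : s₁.var 1 = e.m ∧ s₁.var 14 = s.var 14 := by
      constructor <;> rw [hF.1 _ (by decide)] <;> simp [hs.v1]
    have e₂ : s₁.arr 2 = e.tree ∧ s₁.arr 6 = s.arr 6 := by
      constructor <;> rw [hF.2 _ (by decide)] <;> simp [hs.a2]
    have hsucc : N (j + 1) = if e.tree (s.var 14 * e.m + j) ≠ 0 ∧ s.arr 6 j = 0
        then insert j (N j) else N j := by
      simp only [hN, rest, Finset.range_add_one, Finset.filter_insert]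
    have hnot : j ∉ N j := by simp [hN, rest]
    have hval : (Exp.op .mul (cell 2 (.var 14) 1 (.var 15))
        (.op .eq (.get 6 (.var 15)) (.const 0))).val s₁ ≠ 0 ↔
        e.tree (s.var 14 * e.m + j) ≠ 0 ∧ s.arr 6 j = 0 := by
      simp [Exp.val, Op.apply, e₁.1, e₁.2, e₂.1, e₂.2, h15, and_comm]
    refine WP.when (fun h => ?_) (fun h => ?_)
    · rw [hval] at h
      rw [if_pos h] at hsucc
      refine WP.seq (WP.assign ?_ (WP.assign ?_ ?_))
      · have := hcard j
        simp only [Exp.val, Op.apply, h18]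
        omega
      · simp only [Exp.val, State.setVar_var, h15]
        simp
        omega
      · simp [Exp.val, Op.apply, h15, h18, hsucc, Finset.card_insert_of_notMem hnot]
    · have h' := mt hval.2 (not_not.2 h)
      rw [if_neg h'] at hsucc
      simpa [hsucc] using ⟨h18, h19⟩
  · rintro s' - - - h
    simpa [hs.v1] using h

/-- Node `i` has not been eliminated, and at most one of its neighbours has not. -/
def IsLeaf (e : Env) (par : ℕ → ℕ) (i : ℕ) : Prop :=
  par i = 0 ∧ (rest e par i e.m).card < 2

/-- The search does not stop early; later leaves overwrite earlier ones. The invariant is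
conditional because no leaf need have been seen yet. -/
theorem wp_leafProg (he : e.Valid) (hs : e.Holds s) (hleaf : ∃ i < e.m, IsLeaf e (s.arr 6) i) :
    WP e.L e.b leafProg (fun s' => s'.var 16 < e.m ∧ IsLeaf e (s.arr 6) (s'.var 16) ∧
      (rest e (s.arr 6) (s'.var 16) e.m = ∅ ∧ s'.var 17 = e.m ∨
        s'.var 17 ∈ rest e (s.arr 6) (s'.var 16) e.m)) s := by
  have hm := he.m_lt
  have hmb := he.m_b
  refine WP.count (I := fun j s' => (∃ i < j, IsLeaf e (s.arr 6) i) →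
    s'.var 16 < j ∧ IsLeaf e (s.arr 6) (s'.var 16) ∧
      (rest e (s.arr 6) (s'.var 16) e.m = ∅ ∧ s'.var 17 = e.m ∨
        s'.var 17 ∈ rest e (s.arr 6) (s'.var 16) e.m)) (by decide) (by decide) (by decide)
    (by simpa [hs.v1] using hmb) (by simp) ?_ ?_
  · rintro j hj s₁ hF - h14 hI
    rw [hs.v1] at hj
    have hs₁ := hs.of_frame (by decide) (by decide) hF
    have h6 : s₁.arr 6 = s.arr 6 := hF.2 6 (by decide)
    have keep : ¬ IsLeaf e (s.arr 6) j → ∀ s₂ : State, s₂.var 16 = s₁.var 16 →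
        s₂.var 17 = s₁.var 17 → (∃ i < j + 1, IsLeaf e (s.arr 6) i) →
        s₂.var 16 < j + 1 ∧ IsLeaf e (s.arr 6) (s₂.var 16) ∧
        (rest e (s.arr 6) (s₂.var 16) e.m = ∅ ∧ s₂.var 17 = e.m ∨
          s₂.var 17 ∈ rest e (s.arr 6) (s₂.var 16) e.m) := by
      rintro hn s₂ h16 h17 ⟨i, hi, hl⟩
      rw [h16, h17]
      have hij : i ≠ j := by
        rintro rfl
        exact hn hl
      have := hI ⟨i, by omega, hl⟩
      exact ⟨by omega, this.2⟩
    refine WP.when (fun h => ?_) (fun h => ?_)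
    · have hj0 : s.arr 6 j = 0 := by simpa [Exp.val, Op.apply, h6, h14] using h
      refine WP.seq ((wp_degProg he hs₁).mono ?_)
      rintro s₂ hF₂ - ⟨h18, h19⟩
      rw [h6, h14] at h18 h19
      have h14' : s₂.var 14 = j := by rw [hF₂.1 14 (by decide), h14]
      refine WP.when (fun h' => ?_) (fun h' => ?_)
      · have hlt : (rest e (s.arr 6) j e.m).card < 2 := by
          simpa [Exp.val, Op.apply, h18] using h'
        refine WP.seq (WP.assign ?_ (WP.assign ?_ ?_))
        · simp only [Exp.val, h14']; omega
        · have : s₂.var 19 ≤ e.m := by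
            rcases h19 with h19 | h19
            · exact h19.2.le
            · simp only [rest, Finset.mem_filter, Finset.mem_range] at h19
              omega
          simp only [Exp.val, State.setVar_var]
          simp
          omega
        · intro _
          simpa [Exp.val, h14'] using ⟨⟨hj0, hlt⟩, h19⟩
      · refine keep (fun hl => ?_) _ ?_ ?_
        · have := hl.2
          simp [Exp.val, Op.apply, h18] at h'
          omega
        · simp [hF₂.1 16 (by decide)]
        · simp [hF₂.1 17 (by decide)]
    · refine keep (fun hl => ?_) _ (by simp) (by simp)
      simp [Exp.val, Op.apply, h6, h14, hl.1] at h
  · rintro s' - - - h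
    rw [hs.v1] at h
    exact h hleaf

/-- The vertices below `j` in the bag of node `i`. -/
def bagSet (e : Env) (i j : ℕ) : Finset ℕ :=
  (Finset.range j).filter fun v => e.bag (i * e.n + v) ≠ 0

theorem bagSet_succ (e : Env) (i j : ℕ) :
    bagSet e i (j + 1) = if e.bag (i * e.n + j) ≠ 0 then insert j (bagSet e i j)
      else bagSet e i j := by
  simp only [bagSet, Finset.range_add_one, Finset.filter_insert]

theorem notMem_bagSet (e : Env) (i j : ℕ) : j ∉ bagSet e i j := by simp [bagSet]

theorem card_bagSet_le (e : Env) (i j : ℕ) : (bagSet e i j).card ≤ j :=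
  (Finset.card_filter_le _ _).trans (Finset.card_range j).le

theorem Env.Valid.four_pow_lt (he : e.Valid) {j : ℕ} (hj : j ≤ e.n + 1) : 4 ^ j < 2 ^ e.L :=
  (Nat.pow_le_pow_right (by norm_num) hj).trans_lt
    ((e.z_le_zW.trans e.zW_le_Q).trans_lt he.Q_lt)

theorem wp_sizeProg (he : e.Valid) (hs : e.Holds s) :
    WP e.L e.b sizeProg (fun s' => s'.var 20 = 4 ^ (bagSet e (s.var 16) e.n).card) s := by
  have hnb := he.n_b
  refine WP.seq (WP.assign ?_ ?_)
  · simpa [Exp.val] using he.four_pow_lt (Nat.zero_le _)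
  refine WP.count (I := fun j s' => s'.var 20 = 4 ^ (bagSet e (s.var 16) j).card)
    (by decide) (by decide) (by decide) (by simp [hs.v0]; omega) (by simp [Exp.val, bagSet]) ?_ ?_
  · rintro j hj s₁ hF - h11 hI
    have hj' : j < e.n := by simpa [hs.v0] using hj
    have e₁ : s₁.var 0 = e.n ∧ s₁.var 16 = s.var 16 := by
      constructor <;> rw [hF.1 _ (by decide)] <;> simp [hs.v0]
    have e₂ : s₁.arr 3 = e.bag := by
      rw [hF.2 _ (by decide)]
      simp [hs.a3]
    have hsucc := bagSet_succ e (s.var 16) j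
    have hval : (cell 3 (.var 16) 0 (.var 11)).val s₁ = e.bag (s.var 16 * e.n + j) := by
      simp [Exp.val, Op.apply, e₁.1, e₁.2, e₂, h11]
    refine WP.when (fun h => ?_) (fun h => ?_)
    · rw [hval] at h
      rw [if_pos h] at hsucc
      have hc : (Exp.op .mul (.const 4) (.var 20)).val s₁ =
          4 ^ (bagSet e (s.var 16) (j + 1)).card := by
        simp [Exp.val, Op.apply, hI, hsucc, Finset.card_insert_of_notMem (notMem_bagSet _ _ _),
          pow_succ, mul_comm]
      refine WP.assign ?_ ?_
      · rw [hc]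
        have := card_bagSet_le e (s.var 16) (j + 1)
        exact he.four_pow_lt (by omega)
      · rw [hc]
        simp
    · rw [hval] at h
      rw [if_neg (not_not.2 h)] at hsucc
      simpa [hsucc] using hI
  · rintro s' - - - h
    simpa [hs.v0] using h

/-- What is left of the number `c` after the digits of the vertices below `j` have been read. -/
def quot (B : ℕ → ℕ) (c : ℕ) : ℕ → ℕ
  | 0 => c
  | j + 1 => if B j ≠ 0 then quot B c j / 4 else quot B c j

theorem quot_le (B : ℕ → ℕ) (c j : ℕ) : quot B c j ≤ c := by
  induction j with
  | zero => exact le_rfl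
  | succ j ih =>
    rw [quot]
    split_ifs
    · exact (Nat.div_le_self _ _).trans ih
    · exact ih

/-- The assignment of the vertices `v` with `B v ≠ 0` whose number is `c`. -/
def decode (B : ℕ → ℕ) (c v : ℕ) : ℕ := if B v ≠ 0 then quot B c v % 4 else 0

theorem decode_lt (B : ℕ → ℕ) (c v : ℕ) : decode B c v < 4 := by
  rw [decode]
  split_ifs
  · exact Nat.mod_lt _ (by norm_num)
  · norm_num

theorem wp_decodeProg (he : e.Valid) (hs : e.Holds s) :
    WP e.L e.b decodeProg (fun s' => ∀ v < e.n,
      s'.arr 5 v = decode (fun v => e.bag (s.var 16 * e.n + v)) (s.var 21) v) s := by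
  have hnb := he.n_b
  have h4 : 4 < 2 ^ e.L := by simpa using he.four_pow_lt (j := 1) (by omega)
  refine WP.of_fits fun hfit => ?_
  have h21 := hfit.1 21
  set B : ℕ → ℕ := fun v => e.bag (s.var 16 * e.n + v) with hB
  refine WP.seq (WP.assign ?_ ?_)
  · exact h21
  refine WP.count (I := fun j s' => s'.var 22 = quot B (s.var 21) j ∧
    ∀ v < j, s'.arr 5 v = decode B (s.var 21) v)
    (by decide) (by decide) (by decide) (by simp [hs.v0]; omega) (by simp [Exp.val, quot]) ?_ ?_
  · rintro j hj s₁ hF - h11 ⟨h22, hI⟩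
    have e₁ : s₁.var 0 = e.n ∧ s₁.var 16 = s.var 16 := by
      constructor <;> rw [hF.1 _ (by decide)] <;> simp [hs.v0]
    have e₂ : s₁.arr 3 = e.bag := by
      rw [hF.2 _ (by decide)]
      simp [hs.a3]
    have hval : (cell 3 (.var 16) 0 (.var 11)).val s₁ = B j := by
      simp [Exp.val, Op.apply, e₁.1, e₁.2, e₂, h11, hB]
    have hq := quot_le B (s.var 21) j
    refine WP.cond (fun h => ?_) (fun h => ?_)
    · rw [hval] at h
      refine WP.seq (WP.store ?_ (WP.assign ?_ ?_))
      · simp only [Exp.val, Op.apply]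
        omega
      · simp only [Exp.val, Op.apply, State.setArr_var, h22]
        omega
      · refine ⟨by simp [Exp.val, Op.apply, h22, quot, h], fun v hv => ?_⟩
        simp only [State.setVar_arr, State.setArr_arr_self, Exp.val, h11, h22, Op.apply,
          Function.update_apply]
        split_ifs with hvj
        · simp [decode, hvj, h]
        · exact hI v (by omega)
    · rw [hval] at h
      refine WP.store ?_ ?_
      · simp only [Exp.val]
        omega
      · refine ⟨by simp [h22, quot, h], fun v hv => ?_⟩
        simp only [State.setVar_arr, State.setArr_arr_self, Exp.val, h11, Function.update_apply]
        split_ifs with hvj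
        · simp [decode, hvj, h]
        · exact hI v (by omega)
  · rintro s' - - - h
    simpa [hs.v0] using h.2

/-- The assignment `g` violates the edge between `u` and `v`. -/
def Clash (e : Env) (g : ℕ → ℕ) (u v : ℕ) : Prop :=
  e.adj (u * e.n + v) ≠ 0 ∧ g u ≠ 0 ∧ g v ≠ 0 ∧ g u ≠ g v

/-- The assignment `g` violates some edge. -/
def HasClash (e : Env) (g : ℕ → ℕ) : Prop := ∃ u < e.n, ∃ v < e.n, Clash e g u v

open Classical in
theorem wp_checkProg (he : e.Valid) (hs : e.Holds s) :
    WP e.L e.b checkProg (fun s' => s'.var 23 =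
      if HasClash e (s.arr 5) then 0 else 1) s := by
  have hnb := he.n_b
  have h1 : 1 < 2 ^ e.L := by simpa using he.four_pow_lt (j := 0) (by omega)
  refine WP.seq (WP.assign (by simpa [Exp.val] using h1) ?_)
  refine WP.count (I := fun j s' => s'.var 23 =
    if ∃ u < j, ∃ v < e.n, Clash e (s.arr 5) u v then 0 else 1)
    (by decide) (by decide) (by decide) (by simp [hs.v0]; omega) (by simp [Exp.val]) ?_ ?_
  · rintro u - s₁ hF - h12 hI
    have e₁ : s₁.var 0 = e.n := by
      rw [hF.1 _ (by decide)]
      simp [hs.v0]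
    refine WP.count (I := fun j s' => s'.var 23 =
      if (∃ u' < u, ∃ v < e.n, Clash e (s.arr 5) u' v) ∨ ∃ v < j, Clash e (s.arr 5) u v
      then 0 else 1)
      (by decide) (by decide) (by decide) (by simp [e₁]; omega) (by simpa using hI) ?_ ?_
    · rintro v - s₂ hF₂ - h11 hI₂
      have e₂ : s₂.var 0 = e.n ∧ s₂.var 12 = u := by
        constructor <;> rw [hF₂.1 _ (by decide)] <;> simp [e₁, h12]
      have e₃ : s₂.arr 0 = e.adj ∧ s₂.arr 5 = s.arr 5 := by
        constructor <;> rw [hF₂.2 _ (by decide), hF.2 _ (by decide)] <;> simp [hs.a0]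
      have hval : (Exp.op .mul (.op .mul (cell 0 (.var 12) 0 (.var 11))
          (.op .mul (.get 5 (.var 12)) (.get 5 (.var 11))))
          (.op .sub (.const 1) (.op .eq (.get 5 (.var 12)) (.get 5 (.var 11))))).val s₂ ≠ 0 ↔
          Clash e (s.arr 5) u v := by
        simp only [Exp.val, Op.apply, e₂.1, e₂.2, e₃.1, e₃.2, h11, Clash]
        by_cases h : s.arr 5 u = s.arr 5 v <;> simp [h]
      have hor : (∃ v' < v + 1, Clash e (s.arr 5) u v') ↔
          (∃ v' < v, Clash e (s.arr 5) u v') ∨ Clash e (s.arr 5) u v := by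
        constructor
        · rintro ⟨v', hv', h⟩
          rcases Nat.lt_succ_iff_lt_or_eq.1 hv' with h' | rfl
          · exact Or.inl ⟨v', h', h⟩
          · exact Or.inr h
        · rintro (⟨v', hv', h⟩ | h)
          · exact ⟨v', by omega, h⟩
          · exact ⟨v, by omega, h⟩
      refine WP.when (fun h => ?_) (fun h => ?_)
      · rw [hval] at h
        refine WP.assign (by simp [Exp.val]) ?_
        simp only [State.setVar_var, Exp.val]
        rw [if_pos (Or.inr (hor.2 (Or.inr h)))]
        simp
      · have h' := mt hval.2 (not_not.2 h)
        simp only [State.setVar_var, hor, h', or_false]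
        simpa using hI₂
    · rintro s₂ - - - h
      rw [State.setVar_var]
      simp only [e₁] at h
      clear hI
      simp only [Nat.reduceEqDiff, if_false, h]
      clear h
      congr 1
      apply propext
      constructor
      · rintro (⟨u', hu', h⟩ | h)
        · exact ⟨u', by omega, h⟩
        · exact ⟨u, by omega, h⟩
      · rintro ⟨u', hu', h⟩
        rcases Nat.lt_succ_iff_lt_or_eq.1 hu' with h' | rfl
        · exact Or.inl ⟨u', h', h⟩
        · exact Or.inr h
  · rintro s' - - - h
    simp only [State.setVar_var, if_false, hs.v0,
      show (0 : ℕ) ≠ 23 by decide] at h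
    rw [h]
    congr 1

/-- The code of an assignment of the first `j` vertices. -/
def code (g : ℕ → ℕ) : ℕ → ℕ
  | 0 => 0
  | j + 1 => 4 * code g j + g j

theorem code_lt {g : ℕ → ℕ} {j : ℕ} (hg : ∀ v < j, g v < 4) : code g j < 4 ^ j := by
  induction j with
  | zero => simp [code]
  | succ j ih =>
    have h₁ := ih fun v hv => hg v (by omega)
    have h₂ := hg j (by omega)
    rw [code, pow_succ]
    omega

theorem code_congr {g h : ℕ → ℕ} {j : ℕ} (hgh : ∀ v < j, g v = h v) : code g j = code h j := by
  induction j with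
  | zero => rfl
  | succ j ih => rw [code, code, ih fun v hv => hgh v (by omega), hgh j (by omega)]

theorem code_injective {g h : ℕ → ℕ} {j : ℕ} (hg : ∀ v < j, g v < 4) (hh : ∀ v < j, h v < 4)
    (heq : code g j = code h j) : ∀ v < j, g v = h v := by
  induction j with
  | zero => simp
  | succ j ih =>
    have h₁ := hg j (by omega)
    have h₂ := hh j (by omega)
    rw [code, code] at heq
    intro v hv
    rcases Nat.lt_succ_iff_lt_or_eq.1 hv with h' | rfl
    · exact ih (fun v hv => hg v (by omega)) (fun v hv => hh v (by omega)) (by omega) v h'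
    · omega

/-- The code of the restriction of the assignment `g` to the bag of node `i`. -/
def bagCode (e : Env) (g : ℕ → ℕ) (i : ℕ) : ℕ := code (fun v => g v * e.bag (i * e.n + v)) e.n

/-- A code has a base 4 digit for every vertex of the graph, which is zero outside the bag. As a
table index it can be almost 4^n, but with logarithmic cost only its length is charged. -/
theorem wp_codeProg (he : e.Valid) (hs : e.Holds s) {x : ℕ} (hx : x ≠ 24 ∧ x ≠ 11)
    (hdig : ∀ v < e.n, s.arr 5 v < 4) (hbag : ∀ v < e.n, e.bag (s.var x * e.n + v) ≤ 1) :
    WP e.L e.b (codeProg x) (fun s' => s'.var 24 = bagCode e (s.arr 5) (s.var x)) s := by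
  have hnb := he.n_b
  obtain ⟨hx₁, hx₂⟩ := hx
  have hg : ∀ v < e.n, s.arr 5 v * e.bag (s.var x * e.n + v) < 4 := fun v hv => by
    have h₁ := hdig v hv
    have h₂ := hbag v hv
    nlinarith
  refine WP.seq (WP.assign (by simp [Exp.val]) ?_)
  refine WP.count (I := fun j s' => s'.var 24 =
    code (fun v => s.arr 5 v * e.bag (s.var x * e.n + v)) j)
    (by decide) (by simp [Prog.vars]) (by simp [Prog.vars]) (by simp [hs.v0]; omega) (by simp [Exp.val, code]) ?_ ?_
  · rintro j hj s₁ hF - h11 hI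
    have hj' : j < e.n := by simpa [hs.v0] using hj
    have e₁ : s₁.var 0 = e.n ∧ s₁.var x = s.var x := by
      constructor
      · rw [hF.1 _ (by simp [Prog.count, Prog.vars])]
        simp [hs.v0]
      · rw [hF.1 _ (by simp [Prog.count, Prog.vars, hx₁, hx₂])]
        simp [hx₁]
    have e₂ : s₁.arr 3 = e.bag ∧ s₁.arr 5 = s.arr 5 := by
      constructor <;> rw [hF.2 _ (by simp [Prog.count, Prog.arrs])] <;> simp [hs.a3]
    have hval : (Exp.op .add (.op .mul (.const 4) (.var 24))
        (.op .mul (.get 5 (.var 11)) (cell 3 (.var x) 0 (.var 11)))).val s₁ =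
        code (fun v => s.arr 5 v * e.bag (s.var x * e.n + v)) (j + 1) := by
      simp [Exp.val, Op.apply, e₁.1, e₁.2, e₂.1, e₂.2, h11, hI, code]
    refine WP.assign ?_ ?_
    · rw [hval]
      exact (code_lt fun v hv => hg v (by omega)).trans (he.four_pow_lt (by omega))
    · rw [hval]
      simp
  · rintro s' - - - h
    simpa [hs.v0, bagCode] using h

end Secluded

/-! ### Correctness of the table updates, with table entries read modulo `Q` -/

namespace Secluded

open Ram

variable {e : Env} {s : State}

/-- The constraints on the parameters, those on the arrays included. -/
structure Env.Fine (e : Env) : Prop extends e.Valid where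
  bag_le : ∀ i, e.bag i ≤ 1
  tree_irrefl : ∀ i < e.m, e.tree (i * e.m + i) = 0
  pw_pos : ∀ v < e.n, 1 ≤ e.pw v
  size_b : ∀ i < e.m, 4 ^ (bagSet e i e.n).card ≤ e.b 20

/-- The product of the table entries of the eliminated nodes that are attached to node `i`. -/
def children (e : Env) (par tab g : ℕ → ℕ) (i j : ℕ) : ZMod e.Q :=
  ∏ l ∈ (Finset.range j).filter (fun l => par l = i + 1), (tab (bagCode e g l * e.m + l) : ZMod e.Q)

theorem mod_Q_lt (e : Env) (a : ℕ) : a % e.Q < e.Q := Nat.mod_lt _ (by have := e.one_lt_Q; omega)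

theorem wp_childProg (he : e.Fine) (hs : e.Holds s) (hdig : ∀ v < e.n, s.arr 5 v < 4)
    (h23 : s.var 23 < e.Q) :
    WP e.L e.b childProg (fun s' => s'.var 23 < e.Q ∧ (s'.var 23 : ZMod e.Q) =
      s.var 23 * children e (s.arr 6) (s.arr 7) (s.arr 5) (s.var 16) e.m) s := by
  have hmb := he.m_b
  refine WP.count (I := fun j s' => s'.var 23 < e.Q ∧ (s'.var 23 : ZMod e.Q) =
    s.var 23 * children e (s.arr 6) (s.arr 7) (s.arr 5) (s.var 16) j)
    (by decide) (by decide) (by decide) (by rw [hs.v1]; exact hmb)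
    (by simpa [children] using h23) ?_ ?_
  · rintro j - s₁ hF - h15 ⟨hlt, hI⟩
    have hs₁ := hs.of_frame (by decide) (by decide) hF
    have e₁ : s₁.var 16 = s.var 16 := hF.1 _ (by decide)
    have e₂ : s₁.arr 5 = s.arr 5 ∧ s₁.arr 6 = s.arr 6 ∧ s₁.arr 7 = s.arr 7 :=
      ⟨hF.2 _ (by decide), hF.2 _ (by decide), hF.2 _ (by decide)⟩
    have hval : (Exp.op .eq (.get 6 (.var 15)) (.op .add (.var 16) (.const 1))).val s₁ ≠ 0 ↔
        s.arr 6 j = s.var 16 + 1 := by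
      simp [Exp.val, Op.apply, e₁, e₂.2.1, h15]
    refine WP.when (fun h => ?_) (fun h => ?_)
    · rw [hval] at h
      refine WP.seq ((wp_codeProg he.toValid hs₁ (by decide) (by rwa [e₂.1])
        (fun v _ => he.bag_le _)).mono ?_)
      intro s₂ hF₂ _ h24
      rw [e₂.1, h15] at h24
      have hs₂ := hs₁.of_frame (by decide) (by decide) hF₂
      have f₁ : s₂.var 23 = s₁.var 23 ∧ s₂.var 15 = j := by
        constructor
        · exact hF₂.1 _ (by decide)
        · rw [hF₂.1 _ (by decide), h15]
      have f₂ : s₂.arr 7 = s.arr 7 := by rw [hF₂.2 _ (by decide), e₂.2.2]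
      have hv : (Exp.op .mod (.op .mul (.var 23) (cell 7 (.var 24) 1 (.var 15))) (.var 8)).val s₂ =
          s₁.var 23 * s.arr 7 (bagCode e (s.arr 5) j * e.m + j) % e.Q := by
        simp [Exp.val, Op.apply, f₁.1, f₁.2, f₂, hs₂.v1, hs₂.v8, h24]
      refine WP.assign ?_ ?_
      · rw [hv]
        exact (mod_Q_lt _ _).trans he.Q_lt
      · rw [hv]
        refine ⟨by simpa using mod_Q_lt _ _, ?_⟩
        simp only [State.setVar_var, Nat.reduceEqDiff, if_false, if_true]
        rw [ZMod.natCast_mod, Nat.cast_mul, hI, children, children, Finset.range_add_one,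
          Finset.filter_insert, if_pos h, Finset.prod_insert (by simp)]
        ring
    · have h' := mt hval.2 (not_not.2 h)
      refine ⟨by simpa using hlt, ?_⟩
      simp only [State.setVar_var, Nat.reduceEqDiff, if_false]
      rw [hI, children, children, Finset.range_add_one, Finset.filter_insert, if_neg h']
  · rintro s' - - - h
    rwa [hs.v1] at h

/-- The factor of the vertex `v` in state `d`. -/
def factor (e : Env) (v d : ℕ) : ℕ :=
  (if d < 2 then 1 - e.term v else 1) * (if d = 1 then 1 else e.zW) *
    (if 1 < d then e.pw v else 1)

/-- The product of the factors of the vertices that are in the bag of node `i` but not in the bag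
of node `p`. -/
def forgotten (e : Env) (g : ℕ → ℕ) (i p j : ℕ) : ZMod e.Q :=
  ∏ v ∈ (Finset.range j).filter (fun v => e.bag (p * e.n + v) < e.bag (i * e.n + v)),
    (factor e v (g v) : ZMod e.Q)

theorem wp_forgetProg (he : e.Fine) (hs : e.Holds s) (h23 : s.var 23 < e.Q) :
    WP e.L e.b forgetProg (fun s' => s'.var 23 < e.Q ∧ (s'.var 23 : ZMod e.Q) =
      s.var 23 * forgotten e (s.arr 5) (s.var 16) (s.var 17) e.n) s := by
  have hnb := he.n_b
  refine WP.count (I := fun j s' => s'.var 23 < e.Q ∧ (s'.var 23 : ZMod e.Q) =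
    s.var 23 * forgotten e (s.arr 5) (s.var 16) (s.var 17) j)
    (by decide) (by decide) (by decide) (by rw [hs.v0]; omega)
    (by simpa [forgotten] using h23) ?_ ?_
  · rintro j hj s₁ hF - h11 ⟨hlt, hI⟩
    rw [hs.v0] at hj
    have hs₁ := hs.of_frame (by decide) (by decide) hF
    have e₁ : s₁.var 16 = s.var 16 ∧ s₁.var 17 = s.var 17 :=
      ⟨hF.1 _ (by decide), hF.1 _ (by decide)⟩
    have e₂ : s₁.arr 5 = s.arr 5 := hF.2 _ (by decide)
    have hval : (Exp.op .lt (cell 3 (.var 17) 0 (.var 11)) (cell 3 (.var 16) 0 (.var 11))).val s₁ ≠ 0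
        ↔ e.bag (s.var 17 * e.n + j) < e.bag (s.var 16 * e.n + j) := by
      simp [Exp.val, Op.apply, e₁.1, e₁.2, hs₁.v0, hs₁.a3, h11]
    refine WP.when (fun h => ?_) (fun h => ?_)
    · rw [hval] at h
      have hf : factorExp.val s₁ = factor e j (s.arr 5 j) := by
        -- With truncated subtraction, 1 + (a - 1) gives back a only if a is positive.
        have hz : 1 ≤ e.zW := e.one_lt_z.le.trans e.z_le_zW
        have hp := he.pw_pos j hj
        simp only [Exp.val, Op.apply, hs₁.v7, hs₁.a1, hs₁.a4, e₂, h11, factor]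
        congr 1
        · congr 1
          · split_ifs <;> simp
          · split_ifs
            · simp
            · simp; omega
        · split_ifs
          · simp; omega
          · simp
      have hv : (Exp.op .mod (.op .mul (.var 23) factorExp) (.var 8)).val s₁ =
          s₁.var 23 * factor e j (s.arr 5 j) % e.Q := by
        rw [← hf, ← hs₁.v8]
        rfl
      refine WP.assign ?_ ?_
      · rw [hv]
        exact (mod_Q_lt _ _).trans he.Q_lt
      · rw [hv]
        refine ⟨by simpa using mod_Q_lt _ _, ?_⟩
        simp only [State.setVar_var, Nat.reduceEqDiff, if_false, if_true]
        rw [ZMod.natCast_mod, Nat.cast_mul, hI, forgotten, forgotten, Finset.range_add_one,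
          Finset.filter_insert, if_pos h, Finset.prod_insert (by simp)]
        ring
    · have h' := mt hval.2 (not_not.2 h)
      refine ⟨by simpa using hlt, ?_⟩
      simp only [State.setVar_var, Nat.reduceEqDiff, if_false]
      rw [hI, forgotten, forgotten, Finset.range_add_one, Finset.filter_insert, if_neg h']
  · rintro s' - - - h
    rwa [hs.v0] at h

open Classical in
/-- The contribution of the assignment `g` to the table of node `i`, which is eliminated in favour
of node `p`. -/
noncomputable def entry (e : Env) (par tab : ℕ → ℕ) (i p : ℕ) (g : ℕ → ℕ) : ZMod e.Q :=
  (if HasClash e g then 0 else 1) * children e par tab g i e.m *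
    forgotten e g i p e.n

theorem bagCode_congr {g h : ℕ → ℕ} (hgh : ∀ v < e.n, g v = h v) (i : ℕ) :
    bagCode e g i = bagCode e h i :=
  code_congr fun v hv => by rw [hgh v hv]

/-- Only the columns of the eliminated nodes attached to i are read. This makes the contribution
insensitive to the writes into column i while the loop over the assignments is running. -/
theorem entry_congr {par tab tab' g h : ℕ → ℕ} {i p : ℕ} (hgh : ∀ v < e.n, g v = h v)
    (htab : ∀ l < e.m, par l = i + 1 → ∀ q, tab (q * e.m + l) = tab' (q * e.m + l)) :
    entry e par tab i p g = entry e par tab' i p h := by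
  unfold entry
  congr 1
  · congr 1
    · have : HasClash e g ↔ HasClash e h := by
        constructor <;> rintro ⟨u, hu, v, hv, hc⟩ <;> refine ⟨u, hu, v, hv, ?_⟩ <;>
          simpa [Clash, hgh u hu, hgh v hv] using hc
      by_cases hc : HasClash e g
      · rw [if_pos hc, if_pos (this.1 hc)]
      · rw [if_neg hc, if_neg (mt this.2 hc)]
    · refine Finset.prod_congr rfl fun l hl => ?_
      simp only [Finset.mem_filter, Finset.mem_range] at hl
      rw [bagCode_congr hgh, htab l hl.1 hl.2]
  · refine Finset.prod_congr rfl fun v hv => ?_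
    simp only [Finset.mem_filter, Finset.mem_range] at hv
    rw [hgh v hv.1]

/-- The assignment of the bag of node `i` with number `c`. -/
def bagDecode (e : Env) (i c : ℕ) : ℕ → ℕ := decode (fun v => e.bag (i * e.n + v)) c

theorem wp_entryProg (he : e.Fine) (hs : e.Holds s) :
    WP e.L e.b entryProg (fun s' => ∃ x < e.Q,
      s'.arr 7 = Function.update (s.arr 7)
        (bagCode e (bagDecode e (s.var 16) (s.var 21)) (s.var 17) * e.m + s.var 16) x ∧
      (x : ZMod e.Q) =
        s.arr 7 (bagCode e (bagDecode e (s.var 16) (s.var 21)) (s.var 17) * e.m + s.var 16) +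
        entry e (s.arr 6) (s.arr 7) (s.var 16) (s.var 17) (bagDecode e (s.var 16) (s.var 21))) s := by
  have hQ := e.one_lt_Q
  refine WP.seq ((wp_decodeProg he.toValid hs).mono ?_)
  intro s₁ hF₁ _ hg
  have hs₁ := hs.of_frame (by decide) (by decide) hF₁
  have hdig : ∀ v < e.n, s₁.arr 5 v < 4 := fun v hv => by
    rw [hg v hv]
    exact decode_lt _ _ _
  refine WP.seq ((wp_checkProg he.toValid hs₁).mono ?_)
  intro s₂ hF₂ _ h23
  have hs₂ := hs₁.of_frame (by decide) (by decide) hF₂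
  have e₂ : s₂.arr 5 = s₁.arr 5 := hF₂.2 _ (by decide)
  refine WP.seq ((wp_childProg he hs₂ (by rwa [e₂]) ?_).mono ?_)
  · rw [h23]
    split_ifs <;> omega
  rintro s₃ hF₃ - ⟨h23', hv₃⟩
  have hs₃ := hs₂.of_frame (by decide) (by decide) hF₃
  refine WP.seq ((wp_forgetProg he hs₃ h23').mono ?_)
  rintro s₄ hF₄ - ⟨h23'', hv₄⟩
  have hs₄ := hs₃.of_frame (by decide) (by decide) hF₄
  have e₃ : s₃.arr 5 = s₁.arr 5 := by rw [hF₃.2 _ (by decide), e₂]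
  have e₄ : s₄.arr 5 = s₁.arr 5 := by rw [hF₄.2 _ (by decide), e₃]
  refine WP.seq ((wp_codeProg he.toValid hs₄ (by decide) (by rwa [e₄])
    (fun v _ => he.bag_le _)).mono ?_)
  intro s₅ hF₅ _ h24
  have hs₅ := hs₄.of_frame (by decide) (by decide) hF₅
  have k : ∀ x, x ∉ entryProg.vars → s₅.var x = s.var x ∧ s₄.var x = s.var x ∧
      s₃.var x = s.var x ∧ s₂.var x = s.var x := by
    intro x hx
    simp only [entryProg, Prog.vars, List.mem_append, not_or] at hx
    have h₁ := hF₁.1 x hx.1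
    have h₂ := (hF₂.1 x hx.2.1).trans h₁
    have h₃ := (hF₃.1 x hx.2.2.1).trans h₂
    have h₄ := (hF₄.1 x hx.2.2.2.1).trans h₃
    exact ⟨(hF₅.1 x hx.2.2.2.2.1).trans h₄, h₄, h₃, h₂⟩
  have k6 : s₂.arr 6 = s.arr 6 := by rw [hF₂.2 _ (by decide), hF₁.2 _ (by decide)]
  have k7' : s₂.arr 7 = s.arr 7 := by rw [hF₂.2 _ (by decide), hF₁.2 _ (by decide)]
  have k7 : s₅.arr 7 = s.arr 7 := by
    rw [hF₅.2 _ (by decide), hF₄.2 _ (by decide), hF₃.2 _ (by decide), k7']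
  obtain ⟨k16, k16', k16₃, k16₂⟩ := k 16 (by decide)
  obtain ⟨k17, k17', k17₃, -⟩ := k 17 (by decide)
  have k23 : s₅.var 23 = s₄.var 23 := hF₅.1 _ (by decide)
  have hcode : s₅.var 24 = bagCode e (bagDecode e (s.var 16) (s.var 21)) (s.var 17) := by
    rw [h24, k17', e₄]
    exact bagCode_congr hg _
  set a := bagCode e (bagDecode e (s.var 16) (s.var 21)) (s.var 17) * e.m + s.var 16 with ha
  have hi : (Exp.op .add (.op .mul (.var 24) (.var 1)) (.var 16)).val s₅ = a := by
    simp [Exp.val, Op.apply, hcode, hs₅.v1, k16, ha]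
  have hx : (Exp.op .mod (.op .add (cell 7 (.var 24) 1 (.var 16)) (.var 23)) (.var 8)).val s₅ =
      (s.arr 7 a + s₄.var 23) % e.Q := by
    simp [Exp.val, Op.apply, hcode, hs₅.v1, hs₅.v8, k16, ha, k7, k23]
  refine WP.store ?_ ?_
  · rw [hx]
    exact (mod_Q_lt _ _).trans he.Q_lt
  · rw [hx, hi]
    refine ⟨_, mod_Q_lt _ _, by rw [State.setArr_arr_self, k7], ?_⟩
    rw [ZMod.natCast_mod, Nat.cast_add]
    congr 1
    rw [hv₄, hv₃, h23, k6, k7', k16₂, k16₃, k17₃, e₂, e₃]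
    rw [← entry_congr (g := s₁.arr 5) (h := bagDecode e (s.var 16) (s.var 21)) hg
      (fun _ _ _ _ => rfl), entry]
    congr 2
    split_ifs <;> simp

theorem Env.Holds.setArr_six {s : State} (hs : e.Holds s) (i v : ℕ) :
    e.Holds (s.setArr 6 i v) := by
  refine ⟨⟨?_, ?_, ?_, ?_, ?_, ?_, ?_, ?_, ?_⟩, ?_, ?_, ?_, ?_, ?_⟩
  all_goals first
    | rw [State.setArr_arr_of_ne _ (by decide)]
    | skip
  exacts [hs.v0, hs.v1, hs.v2, hs.v3, hs.v5, hs.v6, hs.v7, hs.v8, hs.v10, hs.a0, hs.a1, hs.a2,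
    hs.a3, hs.a4]

theorem rest_irrefl (he : e.Fine) {par : ℕ → ℕ} {i p : ℕ} (hi : i < e.m)
    (h : rest e par i e.m = ∅ ∧ p = e.m ∨ p ∈ rest e par i e.m) : p ≠ i ∧ p ≤ e.m := by
  rcases h with ⟨-, rfl⟩ | h
  · omega
  · simp only [rest, Finset.mem_filter, Finset.mem_range] at h
    refine ⟨?_, h.1.le⟩
    rintro rfl
    exact h.2.1 (he.tree_irrefl _ hi)

/-- The effect of one round on the tables: node `i` is eliminated in favour of node `p`. -/
structure Round (e : Env) (s s' : State) (i p : ℕ) : Prop where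
  lt : i < e.m
  leaf : IsLeaf e (s.arr 6) i
  nbr : rest e (s.arr 6) i e.m = ∅ ∧ p = e.m ∨ p ∈ rest e (s.arr 6) i e.m
  var_eq : s'.var 16 = i
  par_eq : s'.arr 6 = Function.update (s.arr 6) i (p + 1)
  bounded : ∀ a, s'.arr 7 a < e.Q
  other : ∀ a, a % e.m ≠ i → s'.arr 7 a = s.arr 7 a
  tab_eq : ∀ q, (s'.arr 7 (q * e.m + i) : ZMod e.Q) = s.arr 7 (q * e.m + i) +
    ∑ c ∈ (Finset.range (4 ^ (bagSet e i e.n).card)).filter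
      (fun c => bagCode e (bagDecode e i c) p = q),
      entry e (Function.update (s.arr 6) i (p + 1)) (s.arr 7) i p (bagDecode e i c)

theorem wp_roundProg (he : e.Fine) (hs : e.Holds s) (hleaf : ∃ i < e.m, IsLeaf e (s.arr 6) i)
    (h7 : ∀ a, s.arr 7 a < e.Q) :
    WP e.L e.b roundProg (fun s' => ∃ i p, Round e s s' i p) s := by
  have hm := he.m_lt
  refine WP.seq ((wp_leafProg he.toValid hs hleaf).mono ?_)
  rintro s₁ hF₁ - ⟨hlt, hl, hnbr⟩
  obtain ⟨hpi, hpm⟩ := rest_irrefl he hlt hnbr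
  have hs₁ := hs.of_frame (by decide) (by decide) hF₁
  set i := s₁.var 16 with hi
  set p := s₁.var 17 with hp
  refine WP.seq (WP.store ?_ ?_)
  · simp only [Exp.val, Op.apply, ← hp]
    omega
  have hst : s₁.setArr 6 ((Exp.var 16).val s₁) ((Exp.op .add (.var 17) (.const 1)).val s₁) =
      s₁.setArr 6 i (p + 1) := rfl
  rw [hst]
  have hs₂ := hs₁.setArr_six i (p + 1)
  refine WP.seq ((wp_sizeProg he.toValid hs₂).mono ?_)
  intro s₃ hF₃ _ h20
  have hs₃ := hs₂.of_frame (by decide) (by decide) hF₃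
  rw [State.setArr_var, ← hi] at h20
  have e₃ : s₃.var 16 = i ∧ s₃.var 17 = p := by
    constructor <;> rw [hF₃.1 _ (by decide)] <;> rfl
  have e₆ : s₃.arr 6 = Function.update (s.arr 6) i (p + 1) := by
    rw [hF₃.2 _ (by decide), State.setArr_arr_self, hF₁.2 _ (by decide)]
  have e₇ : s₃.arr 7 = s.arr 7 := by
    rw [hF₃.2 _ (by decide), State.setArr_arr_of_ne _ (by decide), hF₁.2 _ (by decide)]
  set par := Function.update (s.arr 6) i (p + 1) with hpar
  refine WP.count (I := fun j s' => (∀ a, s'.arr 7 a < e.Q) ∧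
    (∀ a, a % e.m ≠ i → s'.arr 7 a = s.arr 7 a) ∧
    ∀ q, (s'.arr 7 (q * e.m + i) : ZMod e.Q) = s.arr 7 (q * e.m + i) +
      ∑ c ∈ (Finset.range j).filter (fun c => bagCode e (bagDecode e i c) p = q),
        entry e par (s.arr 7) i p (bagDecode e i c))
    (by decide) (by decide) (by decide) (by rw [h20]; exact he.size_b i hlt) ?_ ?_ ?_
  · simpa [e₇] using h7
  · rintro c - s₄ hF₄ - h21 ⟨hb, ho, ht⟩
    have hs₄ := hs₃.of_frame (by decide) (by decide) hF₄
    have f₁ : s₄.var 16 = i ∧ s₄.var 17 = p := by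
      constructor <;> rw [hF₄.1 _ (by decide)]
      exacts [e₃.1, e₃.2]
    have f₂ : s₄.arr 6 = par := by rw [hF₄.2 _ (by decide), e₆]
    refine (wp_entryProg he hs₄).mono ?_
    rintro s₅ hF₅ - ⟨x, hxQ, h7', hx⟩
    rw [f₁.1, f₁.2, h21] at h7' hx
    rw [f₂] at hx
    have hcol : ∀ q l, l < e.m → (q * e.m + l) % e.m = l := fun q l hl => by
      rw [mul_comm, Nat.mul_add_mod, Nat.mod_eq_of_lt hl]
    -- The loop has changed column i only, and i is not attached to itself because its entry in
    -- `par` is p + 1 with p ≠ i. So the old table may be used.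
    have hent : entry e par (s₄.arr 7) i p (bagDecode e i c) =
        entry e par (s.arr 7) i p (bagDecode e i c) := by
      refine entry_congr (fun _ _ => rfl) fun l hl hpl q => ho _ ?_
      rw [hcol q l hl]
      rintro rfl
      rw [hpar, Function.update_self] at hpl
      omega
    rw [hent] at hx
    refine ⟨fun a => ?_, fun a ha => ?_, fun q => ?_⟩
    · rw [State.setVar_arr, h7', Function.update_apply]
      split_ifs
      · exact hxQ
      · exact hb a
    · rw [State.setVar_arr, h7', Function.update_apply, if_neg, ho a ha]
      rintro rfl
      exact ha (hcol _ _ hlt)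
    · rw [State.setVar_arr, h7', Function.update_apply, Finset.range_add_one,
        Finset.filter_insert]
      have hmpos : 0 < e.m := by omega
      by_cases hq : bagCode e (bagDecode e i c) p = q
      · rw [if_pos (by rw [hq]), if_pos hq, hx, hq, ht q, Finset.sum_insert (by simp)]
        ring
      · rw [if_neg, if_neg hq, ht q]
        intro h
        exact hq (Nat.eq_of_mul_eq_mul_right hmpos (Nat.add_right_cancel h)).symm
  · rintro s' hF' - - ⟨hb, ho, ht⟩
    rw [h20] at ht
    refine ⟨i, p, hlt, hl, hnbr, ?_, ?_, hb, ho, ht⟩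
    · rw [hF'.1 _ (by decide), e₃.1]
    · rw [hF'.2 _ (by decide), e₆]

end Secluded

/-! ## Leaves of trees -/

namespace SimpleGraph

variable {ι : Type*} {T : SimpleGraph ι} {A : Set ι} {i : ι}

/-- A vertex with at most one neighbour is never in the interior of a path. This is used both for
the remaining tree and for the nodes whose bags contain a given vertex. -/
theorem Preconnected.induce_diff_singleton (h : (T.induce A).Preconnected)
    (hi : {j ∈ A | T.Adj i j}.Subsingleton) : (T.induce (A \ {i})).Preconnected := by
  have h' := h.induce_of_degree_eq_one (s := {x | (x : ι) ≠ i}) (by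
    rintro ⟨v, hv⟩ hvi ⟨a, ha⟩ hav ⟨b, hb⟩ hbv
    simp only [Set.mem_ofPred_eq, not_not] at hvi
    subst hvi
    exact Subtype.ext (hi ⟨ha, hav⟩ ⟨hb, hbv⟩))
  refine h'.map ⟨fun x => ⟨x.1.1, x.1.2, x.2⟩, fun hxy => hxy⟩ ?_
  rintro ⟨x, hx⟩
  exact ⟨⟨⟨x, hx.1⟩, hx.2⟩, rfl⟩

/-- A connected induced part of a forest is a tree, so it has a vertex of degree one unless it is a
single vertex, which has no neighbours at all. -/
theorem IsAcyclic.exists_leaf [Finite ι] (hT : T.IsAcyclic) (h : (T.induce A).Preconnected)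
    (hA : A.Nonempty) : ∃ i ∈ A, {j ∈ A | T.Adj i j}.Subsingleton := by
  classical
  have := Fintype.ofFinite A
  rcases A.subsingleton_or_nontrivial with hs | hs
  · obtain ⟨i, hi⟩ := hA
    exact ⟨i, hi, fun a ha b hb => hs ha.1 hb.1⟩
  · have : Nontrivial A := hs.coe_sort
    have hc : (T.induce A).Connected := ⟨h⟩
    have ht : (T.induce A).IsTree := ⟨hc, hT.induce A⟩
    obtain ⟨⟨i, hi⟩, hd⟩ := ht.exists_vert_degree_one_of_nontrivial
    rw [degree_eq_one_iff_existsUnique_adj] at hd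
    obtain ⟨w, -, hw⟩ := hd
    refine ⟨i, hi, fun a ha b hb => ?_⟩
    have h₁ := hw ⟨a, ha.1⟩ ha.2
    have h₂ := hw ⟨b, hb.1⟩ hb.2
    exact congrArg Subtype.val (h₁.trans h₂.symm)

theorem Preconnected.exists_adj_mem (h : (T.induce A).Preconnected) {j : ι} (hi : i ∈ A)
    (hj : j ∈ A) (hij : i ≠ j) : ∃ p ∈ A, T.Adj i p := by
  have : Nontrivial A := ⟨⟨⟨i, hi⟩, ⟨j, hj⟩, fun h => hij (congrArg Subtype.val h)⟩⟩
  obtain ⟨⟨p, hp⟩, hadj⟩ := h.exists_adj_of_nontrivial ⟨i, hi⟩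
  exact ⟨p, hp, hadj⟩

end SimpleGraph

/-! ## Elimination of a bag from a sum over assignments -/

namespace Secluded

variable {V R : Type*} [Fintype V] [DecidableEq V] [CommSemiring R]

/-- The assignments of four states to the vertices in `U`. -/
def assignments (U : Finset V) : Finset (V → ℕ) :=
  Fintype.piFinset fun v => if v ∈ U then Finset.range 4 else {0}

/-- The restriction of an assignment to `U`. -/
def mask (U : Finset V) (g : V → ℕ) (v : V) : ℕ := if v ∈ U then g v else 0

theorem mem_assignments {U : Finset V} {g : V → ℕ} :
    g ∈ assignments U ↔ (∀ v ∈ U, g v < 4) ∧ ∀ v ∉ U, g v = 0 := by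
  rw [assignments, Fintype.mem_piFinset]
  constructor
  · intro h
    refine ⟨fun v hv => ?_, fun v hv => ?_⟩ <;> simpa [hv] using h v
  · rintro ⟨h₁, h₂⟩ v
    by_cases hv : v ∈ U
    · simpa [hv] using h₁ v hv
    · simpa [hv] using h₂ v hv

theorem lt_four_of_mem_assignments {U : Finset V} {g : V → ℕ} (h : g ∈ assignments U) (v : V) :
    g v < 4 := by
  rw [mem_assignments] at h
  by_cases hv : v ∈ U
  · exact h.1 v hv
  · rw [h.2 v hv]
    norm_num

theorem card_assignments (U : Finset V) : (assignments U).card = 4 ^ U.card := by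
  rw [assignments, Fintype.card_piFinset]
  have : ∀ v, (if v ∈ U then Finset.range 4 else {0}).card = if v ∈ U then 4 else 1 := fun v => by
    split_ifs <;> simp
  simp only [this]
  rw [Finset.prod_ite_mem, Finset.univ_inter, Finset.prod_const]

theorem mask_mem_assignments {U : Finset V} {g : V → ℕ} (hg : ∀ v, g v < 4) :
    mask U g ∈ assignments U := by
  rw [mem_assignments]
  exact ⟨fun v hv => by simpa [mask, hv] using hg v, fun v hv => by simp [mask, hv]⟩

theorem mask_eq_self {U : Finset V} {g : V → ℕ} (hg : g ∈ assignments U) : mask U g = g := by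
  rw [mem_assignments] at hg
  funext v
  by_cases hv : v ∈ U
  · simp [mask, hv]
  · simp [mask, hv, hg.2 v hv]

/-- The algebra of eliminating a leaf with bag B whose neighbour has the bag P. Everything B shares
with the remaining vertices U lies in P, so an assignment of U ∪ B is the same as a pair of
assignments of U and of B that agree on B ∩ P, and the factors of B \ P can be summed out.
Invariance under `mask` says that F depends only on U and φ only on B. -/
theorem sum_assignments_union {U B P : Finset V} (hBP : B ∩ U ⊆ P) (hPU : P ⊆ U)
    (F φ : (V → ℕ) → R) (ψ : V → ℕ → R) (hF : ∀ g, F (mask U g) = F g)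
    (hφ : ∀ g, φ (mask B g) = φ g) :
    ∑ f ∈ assignments (U ∪ B), F f * φ f * ∏ v ∈ U ∪ B, ψ v (f v) =
      ∑ f ∈ assignments U, F f * (∏ v ∈ U, ψ v (f v)) *
        ∑ g ∈ (assignments B).filter (fun g => ∀ v ∈ B ∩ P, g v = f v),
          φ g * ∏ v ∈ B \ P, ψ v (g v) := by
  have hdiff : B \ P = B \ U := by
    ext v
    simp only [Finset.mem_sdiff]
    refine ⟨fun h => ⟨h.1, fun hU => h.2 (hBP (Finset.mem_inter.2 ⟨h.1, hU⟩))⟩,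
      fun h => ⟨h.1, fun hP => h.2 (hPU hP)⟩⟩
  have hmem : ∀ {v}, v ∈ B → v ∈ U → v ∈ B ∩ P := fun hB hU =>
    Finset.mem_inter.2 ⟨hB, hBP (Finset.mem_inter.2 ⟨hB, hU⟩)⟩
  simp only [Finset.mul_sum]
  rw [Finset.sum_sigma']
  refine Finset.sum_bij' (fun f _ => ⟨mask U f, mask B f⟩)
    (fun x _ v => if v ∈ U then x.1 v else x.2 v) ?_ ?_ ?_ ?_ ?_
  · intro f hf
    have hf4 := lt_four_of_mem_assignments hf
    rw [Finset.mem_sigma, Finset.mem_filter]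
    refine ⟨mask_mem_assignments hf4, mask_mem_assignments hf4, fun v hv => ?_⟩
    rw [Finset.mem_inter] at hv
    simp [mask, hv.1, hPU hv.2]
  · rintro ⟨f, g⟩ h
    rw [Finset.mem_sigma, Finset.mem_filter] at h
    obtain ⟨hf, hg, -⟩ := h
    rw [mem_assignments]
    refine ⟨fun v _ => ?_, fun v hv => ?_⟩
    · simp only
      split_ifs
      · exact lt_four_of_mem_assignments hf v
      · exact lt_four_of_mem_assignments hg v
    · rw [Finset.mem_union, not_or] at hv
      simpa [hv.1] using (mem_assignments.1 hg).2 v hv.2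
  · intro f hf
    funext v
    simp only [mask]
    split_ifs with h₁ h₂
    · rfl
    · rfl
    · exact ((mem_assignments.1 hf).2 v (by simp [h₁, h₂])).symm
  · rintro ⟨f, g⟩ h
    rw [Finset.mem_sigma, Finset.mem_filter] at h
    obtain ⟨hf, hg, hfg⟩ := h
    simp only at hf hg hfg
    congr 1
    · funext v
      simp only [mask]
      split_ifs with h₁
      · rfl
      · exact ((mem_assignments.1 hf).2 v h₁).symm
    · funext v
      simp only [mask]
      split_ifs with h₁ h₂
      · exact (hfg v (hmem h₁ h₂)).symm
      · rfl
      · exact ((mem_assignments.1 hg).2 v h₁).symm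
  · intro f _
    simp only [hF, hφ, hdiff]
    have h₁ : ∏ v ∈ U, ψ v (mask U f v) = ∏ v ∈ U, ψ v (f v) :=
      Finset.prod_congr rfl fun v hv => by simp [mask, hv]
    have h₂ : ∏ v ∈ B \ U, ψ v (mask B f v) = ∏ v ∈ B \ U, ψ v (f v) :=
      Finset.prod_congr rfl fun v hv => by simp [mask, (Finset.mem_sdiff.1 hv).1]
    rw [h₁, h₂, ← Finset.union_sdiff_self_eq_union, Finset.prod_union Finset.disjoint_sdiff]
    ring

end Secluded

/-! ### From the tables to the sum over all assignments -/

namespace Secluded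

open Ram

variable {e : Env}

/-- The bag of node `i`. -/
def bagFin (e : Env) (i : ℕ) : Finset (Fin e.n) :=
  Finset.univ.filter fun v => e.bag (i * e.n + v) ≠ 0

theorem mem_bagFin {i : ℕ} {v : Fin e.n} : v ∈ bagFin e i ↔ e.bag (i * e.n + v) ≠ 0 := by
  simp [bagFin]

/-- Extension of an assignment by zero. -/
def ext {n : ℕ} (g : Fin n → ℕ) (v : ℕ) : ℕ := if h : v < n then g ⟨v, h⟩ else 0

@[simp] theorem ext_coe {n : ℕ} (g : Fin n → ℕ) (v : Fin n) : ext g v = g v := by simp [ext]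

theorem ext_of_lt {n : ℕ} (g : Fin n → ℕ) {v : ℕ} (hv : v < n) : ext g v = g ⟨v, hv⟩ := by
  simp [ext, hv]

/-- The arrays describe a tree decomposition with tree `T`. -/
structure Env.Decomp (e : Env) (T : SimpleGraph (Fin e.m)) : Prop where
  tree_iff : ∀ i j : Fin e.m, e.tree (i * e.m + j) ≠ 0 ↔ T.Adj i j
  acyclic : T.IsAcyclic
  conn : T.Preconnected
  pos : 0 < e.m
  vertex : ∀ v : Fin e.n, ∃ i : Fin e.m, v ∈ bagFin e i
  edge : ∀ u v : Fin e.n, e.adj (u * e.n + v) ≠ 0 →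
    ∃ i : Fin e.m, u ∈ bagFin e i ∧ v ∈ bagFin e i
  bag_conn : ∀ v : Fin e.n, (T.induce {i : Fin e.m | v ∈ bagFin e i}).Preconnected
  root : ∀ v < e.n, e.bag (e.m * e.n + v) = 0

/-! ### The numbering of the assignments of a bag -/

theorem eq_of_decode_eq {B : ℕ → ℕ} {c c' j : ℕ} (h : ∀ v < j, decode B c v = decode B c' v)
    (hq : quot B c j = quot B c' j) : c = c' := by
  induction j with
  | zero => exact hq
  | succ j ih =>
    refine ih (fun v hv => h v (by omega)) ?_
    have hj := h j (by omega)
    simp only [quot, decode] at hq hj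
    split_ifs at hq hj with hB
    · omega
    · exact hq

theorem quot_lt {B : ℕ → ℕ} {c : ℕ} (j a : ℕ)
    (hc : c < 4 ^ (((Finset.range j).filter fun v => B v ≠ 0).card + a)) : quot B c j < 4 ^ a := by
  induction j generalizing a with
  | zero => simpa [quot] using hc
  | succ j ih =>
    rw [Finset.range_add_one, Finset.filter_insert] at hc
    rw [quot]
    split_ifs with hB
    · rw [if_pos hB, Finset.card_insert_of_notMem (by simp)] at hc
      have := ih (a + 1) (by rwa [add_assoc, add_comm 1 a] at hc)
      rw [pow_succ] at this
      omega
    · rw [if_neg hB] at hc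
      exact ih a hc

theorem card_bagFin (e : Env) (i : ℕ) : (bagFin e i).card = (bagSet e i e.n).card := by
  rw [bagFin, bagSet, Finset.card_filter, Finset.card_filter, Finset.sum_range]

/-- The digits read together with the final quotient determine the number, and below 4^|bag| the
final quotient is zero. Hence decoding is injective, and it is onto because there are just as many
assignments. -/
theorem image_bagDecode (e : Env) (i : ℕ) :
    (Finset.range (4 ^ (bagSet e i e.n).card)).image (fun c (v : Fin e.n) => bagDecode e i c v) =
      assignments (bagFin e i) ∧
    Set.InjOn (fun c (v : Fin e.n) => bagDecode e i c v)
      (Finset.range (4 ^ (bagSet e i e.n).card) : Set ℕ) := by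
  have hinj : Set.InjOn (fun c (v : Fin e.n) => bagDecode e i c v)
      (Finset.range (4 ^ (bagSet e i e.n).card) : Set ℕ) := by
    intro c hc c' hc' h
    rw [Finset.mem_coe, Finset.mem_range] at hc hc'
    refine eq_of_decode_eq (j := e.n) (fun v hv => congrFun h ⟨v, hv⟩) ?_
    have h₁ := quot_lt (B := fun v => e.bag (i * e.n + v)) e.n 0 hc
    have h₂ := quot_lt (B := fun v => e.bag (i * e.n + v)) e.n 0 hc'
    omega
  refine ⟨Finset.eq_of_subset_of_card_le ?_ ?_, hinj⟩
  · intro g hg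
    obtain ⟨c, -, rfl⟩ := Finset.mem_image.1 hg
    rw [mem_assignments]
    refine ⟨fun v _ => decode_lt _ _ _, fun v hv => ?_⟩
    rw [mem_bagFin, not_not] at hv
    simp [bagDecode, decode, hv]
  · rw [card_assignments, Finset.card_image_of_injOn hinj, Finset.card_range, card_bagFin]

theorem sum_bagDecode {R : Type*} [AddCommMonoid R] (i : ℕ) (P : (ℕ → ℕ) → Prop) [DecidablePred P]
    (F : (ℕ → ℕ) → R) (hP : ∀ g h : ℕ → ℕ, (∀ v < e.n, g v = h v) → (P g ↔ P h))
    (hF : ∀ g h : ℕ → ℕ, (∀ v < e.n, g v = h v) → F g = F h) :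
    ∑ c ∈ (Finset.range (4 ^ (bagSet e i e.n).card)).filter (fun c => P (bagDecode e i c)),
      F (bagDecode e i c) = ∑ g ∈ (assignments (bagFin e i)).filter (fun g => P (ext g)),
      F (ext g) := by
  have hext : ∀ c, ∀ v < e.n, bagDecode e i c v = ext (fun w : Fin e.n => bagDecode e i c w) v :=
    fun c v hv => by rw [ext_of_lt _ hv]
  obtain ⟨himg, hinj⟩ := image_bagDecode e i
  rw [← himg, Finset.sum_filter, Finset.sum_filter, Finset.sum_image hinj]
  refine Finset.sum_congr rfl fun c _ => ?_
  rw [hF _ _ (hext c)]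
  exact if_congr (hP _ _ (hext c)) rfl rfl

/-! ### The value of a partially eliminated decomposition -/

open Classical in
/-- The factor of node `i`. -/
noncomputable def nodeFactor (e : Env) (par tab : ℕ → ℕ) (i : ℕ) (g : Fin e.n → ℕ) : ZMod e.Q :=
  (if HasClash e (ext (mask (bagFin e i) g)) then 0 else 1) *
    children e par tab (ext (mask (bagFin e i) g)) i e.m

/-- The vertices in the bags of the nodes in `A`. -/
def support (e : Env) (A : Finset (Fin e.m)) : Finset (Fin e.n) := A.biUnion fun i => bagFin e i

/-- The sum over all assignments of the vertices in the bags of the nodes in `A`. -/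
noncomputable def total (e : Env) (par tab : ℕ → ℕ) (A : Finset (Fin e.m)) : ZMod e.Q :=
  ∑ g ∈ assignments (support e A), (∏ i ∈ A, nodeFactor e par tab i g) *
    ∏ v ∈ support e A, (factor e v (g v) : ZMod e.Q)

theorem mask_mask_of_subset {V : Type*} [DecidableEq V] {U B : Finset V} (h : B ⊆ U) (g : V → ℕ) :
    mask B (mask U g) = mask B g := by
  funext v
  by_cases hv : v ∈ B
  · simp [mask, hv, h hv]
  · simp [mask, hv]

theorem bag_eq (he : e.Fine) (i : ℕ) (v : Fin e.n) :
    e.bag (i * e.n + v) = if v ∈ bagFin e i then 1 else 0 := by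
  have := he.bag_le (i * e.n + v)
  split_ifs with h <;> rw [mem_bagFin] at h <;> omega

/-- The leaf i stores under the code of its assignment restricted to the bag of p; the node p looks
up the code of its own assignment restricted to the bag of i. Both functions vanish outside the
common vertices, so the lookup finds the sum over exactly those assignments of the leaf that agree
there. -/
theorem bagCode_eq_iff (he : e.Fine) {i p : ℕ} {g f : Fin e.n → ℕ}
    (hg : g ∈ assignments (bagFin e i)) (hf : ∀ v, f v < 4) :
    bagCode e (ext g) p = bagCode e (ext (mask (bagFin e p) f)) i ↔
      ∀ v ∈ bagFin e i ∩ bagFin e p, g v = f v := by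
  have key : ∀ v : Fin e.n, (ext g v * e.bag (p * e.n + v) =
      ext (mask (bagFin e p) f) v * e.bag (i * e.n + v)) ↔
      (v ∈ bagFin e i ∩ bagFin e p → g v = f v) := by
    intro v
    rw [bag_eq he, bag_eq he, ext_coe, ext_coe, mask, Finset.mem_inter]
    by_cases h₁ : v ∈ bagFin e i <;> by_cases h₂ : v ∈ bagFin e p <;>
      simp [h₁, h₂, (mem_assignments.1 hg).2 v]
  constructor
  · intro h v hv
    refine (key v).1 (code_injective ?_ ?_ h v v.2) hv
    · intro w hw
      have h₁ := lt_four_of_mem_assignments hg ⟨w, hw⟩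
      have h₂ := he.bag_le (p * e.n + w)
      rw [ext_of_lt _ hw]
      nlinarith
    · intro w hw
      have h₁ := hf ⟨w, hw⟩
      have h₂ := he.bag_le (i * e.n + w)
      rw [ext_of_lt _ hw, mask]
      split_ifs
      · nlinarith
      · simp
  · intro h
    exact code_congr fun v hv => (key ⟨v, hv⟩).2 (h ⟨v, hv⟩)

theorem forgotten_eq (he : e.Fine) (i p : ℕ) (g : Fin e.n → ℕ) :
    forgotten e (ext g) i p e.n =
      ∏ v ∈ bagFin e i \ bagFin e p, (factor e v (g v) : ZMod e.Q) := by
  rw [forgotten, Finset.prod_filter, Finset.prod_range]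
  have : bagFin e i \ bagFin e p = Finset.univ.filter
      (fun v : Fin e.n => e.bag (p * e.n + v) < e.bag (i * e.n + v)) := by
    ext v
    rw [Finset.mem_sdiff, Finset.mem_filter, bag_eq he, bag_eq he]
    by_cases h₁ : v ∈ bagFin e i <;> by_cases h₂ : v ∈ bagFin e p <;> simp [h₁, h₂]
  rw [this, Finset.prod_filter]
  simp

theorem entry_eq (he : e.Fine) {par tab : ℕ → ℕ} {i p : ℕ} (hpi : p ≠ i) (hi : par i = 0)
    {g : Fin e.n → ℕ} (hg : g ∈ assignments (bagFin e i)) :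
    entry e (Function.update par i (p + 1)) tab i p (ext g) = nodeFactor e par tab i g *
      ∏ v ∈ bagFin e i \ bagFin e p, (factor e v (g v) : ZMod e.Q) := by
  rw [entry, forgotten_eq he, nodeFactor, mask_eq_self hg]
  congr 2
  refine Finset.prod_congr (Finset.filter_congr fun l _ => ?_) fun _ _ => rfl
  -- The mark p + 1 just given to i does not attach i to itself, and neither did its former mark 0.
  by_cases h : l = i
  · subst h
    simp [hi, hpi]
  · simp [Function.update_of_ne h]

/-- The new table entries of the eliminated node. -/
theorem Round.tab_column (he : e.Fine) {s s' : State} {i p : ℕ} (h : Round e s s' i p)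
    (hzero : ∀ q, s.arr 7 (q * e.m + i) = 0) (q : ℕ) :
    (s'.arr 7 (q * e.m + i) : ZMod e.Q) =
      ∑ g ∈ (assignments (bagFin e i)).filter (fun g => bagCode e (ext g) p = q),
        nodeFactor e (s.arr 6) (s.arr 7) i g *
          ∏ v ∈ bagFin e i \ bagFin e p, (factor e v (g v) : ZMod e.Q) := by
  rw [h.tab_eq q, hzero, Nat.cast_zero, zero_add]
  rw [sum_bagDecode i (fun g => bagCode e g p = q)
    (fun g => entry e (Function.update (s.arr 6) i (p + 1)) (s.arr 7) i p g)
    (fun g g' hg => by rw [bagCode_congr hg]) (fun g g' hg => entry_congr hg fun _ _ _ _ => rfl)]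
  refine Finset.sum_congr rfl fun g hg => ?_
  exact entry_eq he (rest_irrefl he h.lt h.nbr).1 h.leaf.1 (Finset.mem_filter.1 hg).1

/-- Eliminating a node in favour of another one preserves the total. -/
theorem Round.total_eq (he : e.Fine) {s s' : State} {i p : Fin e.m} (h : Round e s s' i p)
    (hzero : ∀ q, s.arr 7 (q * e.m + i) = 0) {A : Finset (Fin e.m)} (hi : i ∈ A)
    (hp : p ∈ A.erase i)
    (hsep : bagFin e i ∩ support e (A.erase i) ⊆ bagFin e p) :
    total e (s'.arr 6) (s'.arr 7) (A.erase i) = total e (s.arr 6) (s.arr 7) A := by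
  have hpi : p ≠ i := (Finset.mem_erase.1 hp).1
  have hpi' : (p : ℕ) ≠ i := fun h => hpi (Fin.ext h)
  have hsub : ∀ l ∈ A.erase i, bagFin e l ⊆ support e (A.erase i) := fun l hl =>
    Finset.subset_biUnion_of_mem (fun i : Fin e.m => bagFin e i) hl
  have hunion : support e A = support e (A.erase i) ∪ bagFin e i := by
    rw [support, support, ← Finset.insert_erase hi, Finset.biUnion_insert, Finset.union_comm,
      Finset.erase_insert (Finset.notMem_erase _ _)]
  -- Among the remaining nodes only p changes its factor: it gains the new child i. The other table
  -- columns that are read have not been touched.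
  have hfac : ∀ l ∈ A.erase i, ∀ g : Fin e.n → ℕ,
      nodeFactor e (s'.arr 6) (s'.arr 7) l g = nodeFactor e (s.arr 6) (s.arr 7) l g *
        if l = p then (s'.arr 7 (bagCode e (ext (mask (bagFin e p) g)) i * e.m + i) : ZMod e.Q)
          else 1 := by
    intro l hl g
    have hli : l ≠ i := (Finset.mem_erase.1 hl).1
    have htab : ∀ x < e.m, s.arr 6 x = l + 1 → ∀ q,
        s'.arr 7 (q * e.m + x) = s.arr 7 (q * e.m + x) := by
      intro x hx hxl q
      refine h.other _ ?_
      rw [mul_comm, Nat.mul_add_mod, Nat.mod_eq_of_lt hx]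
      rintro rfl
      rw [h.leaf.1] at hxl
      omega
    rw [nodeFactor, nodeFactor, mul_assoc]
    congr 1
    have hset : (Finset.range e.m).filter (fun x => s'.arr 6 x = l + 1) =
        if l = p then insert (i : ℕ) ((Finset.range e.m).filter (fun x => s.arr 6 x = l + 1))
        else (Finset.range e.m).filter (fun x => s.arr 6 x = l + 1) := by
      ext x
      rw [h.par_eq, Finset.mem_filter, Finset.mem_range]
      by_cases hx : x = i
      · subst hx
        split_ifs with hlp
        · simp [hlp]
        · have : (p : ℕ) ≠ l := fun h => hlp (Fin.ext h.symm)
          simp [h.leaf.1, this]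
      · rw [Function.update_of_ne hx]
        split_ifs with hlp
        · simp [hx]
        · simp
    have hrest : ∀ g' : ℕ → ℕ, ∏ x ∈ (Finset.range e.m).filter (fun x => s.arr 6 x = l + 1),
        (s'.arr 7 (bagCode e g' x * e.m + x) : ZMod e.Q) =
        children e (s.arr 6) (s.arr 7) g' l e.m := fun g' =>
      Finset.prod_congr rfl fun x hx => by
        rw [Finset.mem_filter, Finset.mem_range] at hx
        rw [htab x hx.1 hx.2]
    rw [children, hset]
    split_ifs with hlp
    · rw [Finset.prod_insert (by simp [h.leaf.1]), hrest, mul_comm, hlp]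
    · rw [hrest, mul_one]
  have hmask : ∀ {U : Finset (Fin e.n)} {l : ℕ}, bagFin e l ⊆ U → ∀ g,
      nodeFactor e (s.arr 6) (s.arr 7) l (mask U g) = nodeFactor e (s.arr 6) (s.arr 7) l g :=
    fun hU g => by rw [nodeFactor, nodeFactor, mask_mask_of_subset hU]
  have key := sum_assignments_union hsep (hsub p hp)
    (fun g => ∏ l ∈ A.erase i, nodeFactor e (s.arr 6) (s.arr 7) l g)
    (nodeFactor e (s.arr 6) (s.arr 7) i) (fun v d => (factor e v d : ZMod e.Q))
    (fun g => Finset.prod_congr rfl fun l hl => hmask (hsub l hl) g)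
    (fun g => hmask subset_rfl g)
  simp only [Finset.prod_erase_mul _ _ hi] at key
  rw [total, total, hunion, key]
  refine Finset.sum_congr rfl fun f hf => ?_
  rw [Finset.prod_congr rfl fun l hl => hfac l hl f, Finset.prod_mul_distrib,
    Finset.prod_ite_eq' _ _ fun _ => _, if_pos hp, h.tab_column he hzero]
  have hf4 := lt_four_of_mem_assignments hf
  rw [Finset.filter_congr fun g hg => bagCode_eq_iff he hg hf4, mul_right_comm]
  congr!

/-- Eliminating the last node leaves the total in the table. -/
theorem Round.last_eq (he : e.Fine) {s s' : State} {i : Fin e.m} (h : Round e s s' i e.m)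
    (hroot : ∀ v < e.n, e.bag (e.m * e.n + v) = 0)
    (hzero : ∀ q, s.arr 7 (q * e.m + i) = 0) :
    (s'.arr 7 i : ZMod e.Q) = total e (s.arr 6) (s.arr 7) {i} := by
  -- The fictitious parent has an empty bag, so every assignment is stored under code 0, in cell 0 *
  -- m + i, and all vertices of the last bag are summed out.
  have hbag : bagFin e e.m = ∅ := by
    ext v
    simp [mem_bagFin, hroot v v.2]
  have hcode : ∀ g, bagCode e g e.m = 0 := by
    intro g
    have : ∀ j, code (fun _ => 0) j = 0 := fun j => by
      induction j with
      | zero => rfl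
      | succ j ih => rw [code, ih]
    rw [bagCode, ← this e.n]
    exact code_congr fun v hv => by rw [hroot v hv, mul_zero]
  have := h.tab_column he hzero 0
  rw [zero_mul, zero_add] at this
  rw [this, total, support, Finset.singleton_biUnion, hbag]
  simp [hcode]

/-- The nodes that have not been eliminated. -/
def alive (e : Env) (par : ℕ → ℕ) : Finset (Fin e.m) := Finset.univ.filter fun i => par i = 0

theorem mem_alive {par : ℕ → ℕ} {i : Fin e.m} : i ∈ alive e par ↔ par i = 0 := by simp [alive]

theorem mem_rest (T : SimpleGraph (Fin e.m)) (hT : e.Decomp T) {par : ℕ → ℕ} {i j : Fin e.m} :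
    (j : ℕ) ∈ rest e par i e.m ↔ j ∈ alive e par ∧ T.Adj i j := by
  rw [rest, Finset.mem_filter, Finset.mem_range, hT.tree_iff, mem_alive]
  simp [and_comm]

/-- The invariant of the elimination. -/
structure Inv (e : Env) (T : SimpleGraph (Fin e.m)) (Z : ZMod e.Q) (s : State) : Prop where
  zero : ∀ i ∈ alive e (s.arr 6), ∀ q, s.arr 7 (q * e.m + i) = 0
  conn : (T.induce (alive e (s.arr 6) : Set (Fin e.m))).Preconnected
  bag_conn : ∀ v, (T.induce {i | i ∈ alive e (s.arr 6) ∧ v ∈ bagFin e i}).Preconnected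
  total_eq : total e (s.arr 6) (s.arr 7) (alive e (s.arr 6)) = Z

theorem Inv.exists_leaf {T : SimpleGraph (Fin e.m)} (hT : e.Decomp T) {Z : ZMod e.Q} {s : State}
    (h : Inv e T Z s) (hne : (alive e (s.arr 6)).Nonempty) : ∃ i < e.m, IsLeaf e (s.arr 6) i := by
  obtain ⟨i, hi, hs⟩ := hT.acyclic.exists_leaf h.conn hne
  refine ⟨i, i.2, mem_alive.1 hi, Nat.lt_succ_of_le (Finset.card_le_one.2 ?_)⟩
  intro a ha b hb
  have lt : ∀ {x}, x ∈ rest e (s.arr 6) i e.m → x < e.m := fun hx =>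
    Finset.mem_range.1 (Finset.mem_filter.1 hx).1
  have ha' := (mem_rest (j := ⟨a, lt ha⟩) T hT).1 ha
  have hb' := (mem_rest (j := ⟨b, lt hb⟩) T hT).1 hb
  exact congrArg Fin.val (hs ⟨ha'.1, ha'.2⟩ ⟨hb'.1, hb'.2⟩)

theorem Round.alive_eq {s s' : State} {i : Fin e.m} {p : ℕ} (h : Round e s s' i p) :
    alive e (s'.arr 6) = (alive e (s.arr 6)).erase i := by
  ext j
  rw [Finset.mem_erase, mem_alive, mem_alive, h.par_eq]
  by_cases hj : j = i
  · simp [hj]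
  · have : (j : ℕ) ≠ i := fun h => hj (Fin.ext h)
    simp [Function.update_of_ne this, hj]

/-- The removed node is a leaf of the remaining tree, so connectedness survives, and the total is
preserved by `Round.total_eq`. If nothing remains, the neighbour must be the fictitious one and the
total has arrived in the table. -/
theorem Inv.round (he : e.Fine) {T : SimpleGraph (Fin e.m)} (hT : e.Decomp T) {Z : ZMod e.Q}
    {s s' : State} (h : Inv e T Z s) {i p : ℕ} (hr : Round e s s' i p) :
    ((alive e (s'.arr 6)).Nonempty → Inv e T Z s') ∧
      (¬ (alive e (s'.arr 6)).Nonempty → (s'.arr 7 i : ZMod e.Q) = Z) ∧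
      (alive e (s'.arr 6)).card + 1 = (alive e (s.arr 6)).card := by
  obtain ⟨i, rfl⟩ : ∃ i' : Fin e.m, (i' : ℕ) = i := ⟨⟨i, hr.lt⟩, rfl⟩
  have hia : i ∈ alive e (s.arr 6) := mem_alive.2 hr.leaf.1
  have hal := hr.alive_eq
  refine ⟨fun hne => ?_, fun hne => ?_, by rw [hal, Finset.card_erase_add_one hia]⟩
  · obtain ⟨j, hj⟩ := hne
    rw [hal, Finset.mem_erase] at hj
    obtain ⟨q, hq, hadj⟩ := h.conn.exists_adj_mem hia hj.2 (Ne.symm hj.1)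
    have hqr : (q : ℕ) ∈ rest e (s.arr 6) i e.m := (mem_rest T hT).2 ⟨hq, hadj⟩
    have huniq : ∀ x : Fin e.m, x ∈ alive e (s.arr 6) → T.Adj i x → x = q := fun x hx hix =>
      Fin.ext (Finset.card_le_one.1 (Nat.lt_succ_iff.1 hr.leaf.2) _
        ((mem_rest T hT).2 ⟨hx, hix⟩) _ hqr)
    have hpq : p = q := by
      rcases hr.nbr with ⟨hemp, -⟩ | hp
      · rw [hemp] at hqr
        simp at hqr
      · exact Finset.card_le_one.1 (Nat.lt_succ_iff.1 hr.leaf.2) _ hp _ hqr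
    subst hpq
    have hqe : q ∈ (alive e (s.arr 6)).erase i := Finset.mem_erase.2 ⟨hadj.ne', hq⟩
    refine ⟨fun l hl c => ?_, ?_, fun v => ?_, ?_⟩
    · rw [hal, Finset.mem_erase] at hl
      rw [hr.other _ ?_, h.zero l hl.2]
      rw [mul_comm, Nat.mul_add_mod, Nat.mod_eq_of_lt l.2]
      exact fun h => hl.1 (Fin.ext h)
    · rw [hal, Finset.coe_erase]
      exact h.conn.induce_diff_singleton fun a ha b hb =>
        (huniq a ha.1 ha.2).trans (huniq b hb.1 hb.2).symm
    · have : {l | l ∈ alive e (s'.arr 6) ∧ v ∈ bagFin e l} =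
          {l | l ∈ alive e (s.arr 6) ∧ v ∈ bagFin e l} \ {i} := by
        ext l
        simp only [hal, Finset.mem_erase, Set.mem_ofPred_eq, Set.mem_sdiff, Set.mem_singleton_iff]
        tauto
      rw [this]
      exact (h.bag_conn v).induce_diff_singleton fun a ha b hb =>
        (huniq a ha.1.1 ha.2).trans (huniq b hb.1.1 hb.2).symm
    · rw [hal, hr.total_eq he (h.zero i hia) hia hqe, h.total_eq]
      intro v hv
      rw [Finset.mem_inter, support, Finset.mem_biUnion] at hv
      obtain ⟨hvi, l, hl, hvl⟩ := hv
      rw [Finset.mem_erase] at hl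
      -- A vertex shared with another remaining bag occurs, by connectedness of its nodes, in the
      -- bag of a neighbour of i; the only remaining neighbour is q.
      obtain ⟨x, hx, hix⟩ := (h.bag_conn v).exists_adj_mem ⟨hia, hvi⟩ ⟨hl.2, hvl⟩ (Ne.symm hl.1)
      rw [← huniq x hx.1 hix]
      exact hx.2
  · rw [Finset.not_nonempty_iff_eq_empty, hal] at hne
    have hsing : alive e (s.arr 6) = {i} := by
      rw [← Finset.insert_erase hia, hne]
      rfl
    have hpm : p = e.m := by
      rcases hr.nbr with ⟨-, hp⟩ | hp
      · exact hp
      · have hlt := Finset.mem_range.1 (Finset.mem_filter.1 hp).1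
        have := (mem_rest (j := ⟨p, hlt⟩) T hT).1 hp
        rw [hsing, Finset.mem_singleton] at this
        exact absurd this.1.symm this.2.ne
    subst hpm
    rw [hr.last_eq he hT.root (h.zero i hia), ← hsing, h.total_eq]

open Classical in
/-- The sum over all assignments of all vertices. -/
noncomputable def fullTotal (e : Env) : ZMod e.Q :=
  ∑ g ∈ assignments (Finset.univ : Finset (Fin e.n)), (if HasClash e (ext g) then 0 else 1) *
    ∏ v : Fin e.n, (factor e v (g v) : ZMod e.Q)

/-- No node has children yet, so the node factors only test edges inside bags. Every edge lies in
some bag, hence these tests together detect precisely the violated edges of the graph. -/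
theorem Inv.init {T : SimpleGraph (Fin e.m)} (hT : e.Decomp T) {s : State}
    (h6 : ∀ i, s.arr 6 i = 0) (h7 : ∀ i, s.arr 7 i = 0) : Inv e T (fullTotal e) s := by
  have hal : alive e (s.arr 6) = Finset.univ := by
    ext i
    simp [mem_alive, h6]
  refine ⟨fun _ _ _ => h7 _, ?_, fun v => ?_, ?_⟩
  · rw [hal]
    exact hT.conn.map ⟨fun x => ⟨x, by simp⟩, fun h => h⟩ fun x => ⟨x, rfl⟩
  · have : {i | i ∈ alive e (s.arr 6) ∧ v ∈ bagFin e i} = {i : Fin e.m | v ∈ bagFin e i} := by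
      ext i
      simp [hal]
    rw [this]
    exact hT.bag_conn v
  · have hsup : support e (alive e (s.arr 6)) = Finset.univ := by
      ext v
      obtain ⟨i, hi⟩ := hT.vertex v
      simp only [support, Finset.mem_biUnion, Finset.mem_univ, iff_true]
      exact ⟨i, by simp [hal], hi⟩
    rw [total, fullTotal, hsup, hal]
    refine Finset.sum_congr rfl fun g _ => ?_
    congr 1
    have hch : ∀ (i : ℕ) g', children e (s.arr 6) (s.arr 7) g' i e.m = 1 := fun i g' => by
      simp [children, h6]
    simp only [nodeFactor, hch, mul_one]
    by_cases hc : HasClash e (ext g)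
    · rw [if_pos hc]
      obtain ⟨u, hu, v, hv, hadj, h₁, h₂, h₃⟩ := hc
      obtain ⟨i, hui, hvi⟩ := hT.edge ⟨u, hu⟩ ⟨v, hv⟩ hadj
      refine Finset.prod_eq_zero (Finset.mem_univ i) (if_pos ?_)
      have hu' : ext (mask (bagFin e i) g) u = ext g u := by
        rw [ext_of_lt _ hu, ext_of_lt _ hu, mask, if_pos hui]
      have hv' : ext (mask (bagFin e i) g) v = ext g v := by
        rw [ext_of_lt _ hv, ext_of_lt _ hv, mask, if_pos hvi]
      exact ⟨u, hu, v, hv, hadj, by rwa [hu'], by rwa [hv'], by rwa [hu', hv']⟩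
    · rw [if_neg hc]
      refine Finset.prod_eq_one fun i _ => if_neg fun hc' => hc ?_
      obtain ⟨u, hu, v, hv, hadj, h₁, h₂, h₃⟩ := hc'
      have key : ∀ {x} (hx : x < e.n), ext (mask (bagFin e i) g) x ≠ 0 →
          ext (mask (bagFin e i) g) x = ext g x := by
        intro x hx hne
        rw [ext_of_lt _ hx, mask] at hne ⊢
        rw [ext_of_lt _ hx]
        split_ifs at hne ⊢
        · rfl
        · simp at hne
      have hu' := key hu h₁
      have hv' := key hv h₂
      rw [hu'] at h₁ h₃
      rw [hv'] at h₂ h₃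
      exact ⟨u, hu, v, hv, hadj, h₁, h₂, h₃⟩

theorem wp_rounds (he : e.Fine) {T : SimpleGraph (Fin e.m)} (hT : e.Decomp T) {s : State}
    (hs : e.Holds s) (h6 : ∀ i, s.arr 6 i = 0) (h7 : ∀ i, s.arr 7 i = 0) :
    WP e.L e.b (.count 13 1 roundProg) (fun s' => s'.arr 7 (s'.var 16) < e.Q ∧
      (s'.arr 7 (s'.var 16) : ZMod e.Q) = fullTotal e) s := by
  have hQ := e.one_lt_Q
  have hpos := hT.pos
  -- Each round removes one node. While nodes remain, the total is an invariant; when none is left,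
  -- it is found in column `16`, that of the node removed last, under code 0.
  refine WP.count (I := fun r s' => (∀ a, s'.arr 7 a < e.Q) ∧
    (alive e (s'.arr 6)).card + r = e.m ∧
    ((alive e (s'.arr 6)).Nonempty → Inv e T (fullTotal e) s') ∧
    (¬ (alive e (s'.arr 6)).Nonempty → (s'.arr 7 (s'.var 16) : ZMod e.Q) = fullTotal e))
    (by decide) (by decide) (by decide) (by rw [hs.v1]; exact he.m_b) ?_ ?_ ?_
  · have hcard : (alive e (s.arr 6)).card = e.m := by
      have : alive e (s.arr 6) = Finset.univ := by
        ext i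
        simp [mem_alive, h6]
      rw [this, Finset.card_univ, Fintype.card_fin]
    refine ⟨fun a => ?_, by simpa using hcard, fun _ => Inv.init hT h6 h7, fun hne => ?_⟩
    · rw [State.setVar_arr, h7]
      omega
    · rw [State.setVar_arr, ← Finset.card_pos, hcard] at hne
      exact absurd hpos hne
  · rintro r hr s₁ hF - - ⟨hb, hcard, hinv, -⟩
    rw [hs.v1] at hr
    have hs₁ := hs.of_frame (by decide) (by decide) hF
    have hne : (alive e (s₁.arr 6)).Nonempty := by
      rw [← Finset.card_pos]
      omega
    refine (wp_roundProg he hs₁ ((hinv hne).exists_leaf hT hne) hb).mono ?_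
    rintro s₂ - - ⟨i, p, hround⟩
    obtain ⟨h₁, h₂, h₃⟩ := (hinv hne).round he hT hround
    refine ⟨hround.bounded, ?_, fun h => ?_, fun h => ?_⟩
    · rw [State.setVar_arr]
      omega
    · have := h₁ h
      exact ⟨this.zero, this.conn, this.bag_conn, this.total_eq⟩
    · rw [State.setVar_arr, State.setVar_var, if_neg (by decide), hround.var_eq]
      exact h₂ h
  · rintro s' - - - ⟨hb, hcard, -, hz⟩
    rw [hs.v1] at hcard
    refine ⟨hb _, hz ?_⟩
    rw [← Finset.card_pos]
    omega

end Secluded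

namespace Secluded

open Ram

variable {e : Env}

/-! ### Reading off the answer -/

theorem wp_readProg (he : e.Valid) {s : State} (hs : e.Holds s) :
    WP e.L e.b readProg (fun s' => s'.var 0 ≠ 0 ↔ ∃ j < e.digits,
      s.arr 7 (s.var 16) / e.z ^ j % 4 ≠ 0 ∧ j % e.W ≠ 0 ∧ j / e.W ≤ e.k) s := by
  have hQ := he.Q_lt
  have h1Q := e.one_lt_Q
  have hdb := he.digits_b
  refine WP.of_fits fun hfit => ?_
  set x := s.arr 7 (s.var 16) with hx
  have hxL : x < 2 ^ e.L := hfit.2 _ _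
  refine WP.seq (WP.assign hxL (WP.seq (WP.assign (by simp [Exp.val]) (WP.seq ?_))))
  refine WP.count (I := fun j s' => s'.var 27 = x / e.z ^ j ∧ s'.var 28 ≤ 1 ∧
    (s'.var 28 ≠ 0 ↔ ∃ i < j, x / e.z ^ i % 4 ≠ 0 ∧ i % e.W ≠ 0 ∧ i / e.W ≤ e.k))
    (by decide) (by decide) (by decide) (by simpa [hs.v10] using hdb) ?_ ?_ ?_
  · simp [Exp.val, hx]
  · rintro j hj s₁ hF - h29 ⟨h27, hle, hI⟩
    have e₁ : s₁.var 6 = e.W ∧ s₁.var 2 = e.k ∧ s₁.var 3 = e.z := by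
      refine ⟨?_, ?_, ?_⟩ <;> rw [hF.1 _ (by decide)] <;> simp [hs.v6, hs.v2, hs.v3]
    obtain ⟨e6, e2, e3⟩ := e₁
    set P : ℕ → Prop := fun i => x / e.z ^ i % 4 ≠ 0 ∧ i % e.W ≠ 0 ∧ i / e.W ≤ e.k with hP
    have hor : (∃ i < j + 1, P i) ↔ (∃ i < j, P i) ∨ P j := by
      constructor
      · rintro ⟨i, hi, h⟩
        rcases Nat.lt_succ_iff_lt_or_eq.1 hi with h' | rfl
        · exact Or.inl ⟨i, h', h⟩
        · exact Or.inr h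
      · rintro (⟨i, hi, h⟩ | h)
        · exact ⟨i, by omega, h⟩
        · exact ⟨j, by omega, h⟩
    have hval : (Exp.op .mul (.op .mul (.op .mod (.var 27) (.const 4))
        (.op .mod (.var 29) (.var 6))) (.op .sub (.const 1)
        (.op .lt (.var 2) (.op .div (.var 29) (.var 6))))).val s₁ ≠ 0 ↔ P j := by
      simp only [Exp.val, Op.apply, e6, e2, h29, h27, hP]
      by_cases h : e.k < j / e.W
      · simp [h]
      · have h' : j / e.W ≤ e.k := not_lt.1 h
        simp [h, h']
    have hdiv : ∀ s₂ : State, s₂.var 27 = s₁.var 27 → s₂.var 3 = s₁.var 3 →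
        (Exp.op .div (.var 27) (.var 3)).val s₂ = x / e.z ^ (j + 1) := by
      intro s₂ h₁ h₂
      simp only [Exp.val, Op.apply, h₁, h₂, h27, e3]
      rw [Nat.div_div_eq_div_mul, pow_succ]
    have hlt : x / e.z ^ (j + 1) < 2 ^ e.L := (Nat.div_le_self _ _).trans_lt hxL
    refine WP.seq (WP.when (fun h => ?_) (fun h => ?_))
    · rw [hval] at h
      refine WP.assign (by simp only [Exp.val]; omega) (WP.assign ?_ ?_)
      · rw [hdiv _ (by simp) (by simp)]
        exact hlt
      · rw [hdiv _ (by simp) (by simp)]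
        refine ⟨by simp, by simp [Exp.val], ?_⟩
        rw [hor]
        simp [Exp.val, h]
    · have h' := mt hval.2 (not_not.2 h)
      refine WP.assign ?_ ?_
      · rw [hdiv _ rfl rfl]
        exact hlt
      · rw [hdiv _ rfl rfl]
        refine ⟨by simp, by simpa using hle, ?_⟩
        rw [hor]
        simpa [h'] using hI
  · rintro s' - - - ⟨-, hle, hI⟩
    refine WP.assign ?_ ?_
    · simp only [Exp.val]
      omega
    · simpa [Exp.val, hs.v10] using hI

/-! ### The digits of the total -/

theorem sum_digits_lt {z : ℕ} {c : ℕ → ℕ} (hc : ∀ i, c i < z) (N : ℕ) :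
    ∑ i ∈ Finset.range N, c i * z ^ i < z ^ N := by
  induction N with
  | zero => simp
  | succ N ih =>
    rw [Finset.sum_range_succ, pow_succ]
    have := hc N
    nlinarith [Nat.mul_le_mul_right (z ^ N) (show c N + 1 ≤ z from this)]

/-- Lower digits vanish in the division because they add up to less than z^j; higher ones vanish
modulo d because d divides z. -/
theorem sum_digits_div_mod {z d : ℕ} {c : ℕ → ℕ} (hc : ∀ i, c i < z) (hd : d ∣ z) {N j : ℕ}
    (hj : j < N) : (∑ i ∈ Finset.range N, c i * z ^ i) / z ^ j % d = c j % d := by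
  obtain ⟨r, rfl⟩ : ∃ r, N = j + 1 + r := ⟨N - (j + 1), by omega⟩
  have hz : 0 < z := (Nat.zero_le _).trans_lt (hc 0)
  have hsplit : ∑ i ∈ Finset.range (j + 1 + r), c i * z ^ i =
      ∑ i ∈ Finset.range j, c i * z ^ i +
        z ^ j * (c j + z * ∑ i ∈ Finset.range r, c (j + 1 + i) * z ^ i) := by
    rw [Finset.sum_range_add, Finset.sum_range_succ, add_assoc, mul_add, Finset.mul_sum,
      Finset.mul_sum]
    congr 1
    congr 1
    · ring
    · refine Finset.sum_congr rfl fun i _ => ?_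
      ring
  rw [hsplit, Nat.add_mul_div_left _ _ (by positivity), Nat.div_eq_of_lt (sum_digits_lt hc j),
    zero_add]
  obtain ⟨y, rfl⟩ := hd
  rw [mul_assoc, Nat.add_mul_mod_self_left]

/-- The weights are encoded correctly. -/
structure Env.Weighted (e : Env) (wt : ℕ → ℕ) : Prop where
  pw_eq : ∀ v < e.n, e.pw v = e.z ^ wt v
  wt_le : ∀ v < e.n, wt v ≤ 2 ^ e.nb
  term_le : ∀ v, e.term v ≤ 1

open Classical in
/-- The assignments that contain all terminals and respect all edges. -/
noncomputable def good (e : Env) : Finset (Fin e.n → ℕ) :=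
  (assignments Finset.univ).filter fun g => ¬ HasClash e (ext g) ∧ ∀ v : Fin e.n, e.term v ≠ 0 → 1 < g v

theorem good_subset (e : Env) : good e ⊆ assignments Finset.univ := by
  classical
  exact Finset.filter_subset _ _

/-- The number of vertices of the neighbourhood. -/
def size {n : ℕ} (g : Fin n → ℕ) : ℕ := (Finset.univ.filter fun v => g v ≠ 1).card

/-- The total weight of the vertices of the subgraph. -/
def cost {n : ℕ} (wt : ℕ → ℕ) (g : Fin n → ℕ) : ℕ :=
  ∑ v ∈ Finset.univ.filter (fun v => 1 < g v), wt v

/-- The first part of a factor is zero precisely at a terminal outside the subgraph. The other parts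
collect z^W for each paid vertex and z^(weight) for each vertex of the subgraph. -/
theorem prod_factor {wt : ℕ → ℕ} (hw : e.Weighted wt) {g : Fin e.n → ℕ} :
    ∏ v : Fin e.n, factor e v (g v) =
      if ∀ v : Fin e.n, e.term v ≠ 0 → 1 < g v then e.z ^ (e.W * size g + cost wt g) else 0 := by
  split_ifs with h
  · have hf : ∀ v : Fin e.n, factor e v (g v) =
        e.z ^ ((if g v ≠ 1 then e.W else 0) + if 1 < g v then wt v else 0) := by
      intro v
      have h₁ : (if g v < 2 then 1 - e.term v else 1) = 1 := by
        split_ifs with hlt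
        · have : e.term v = 0 := by
            by_contra hne
            have := h v hne
            omega
          rw [this]
        · rfl
      rw [factor, h₁, one_mul, pow_add, hw.pw_eq v v.2, Env.zW]
      congr 1
      · by_cases h1 : g v = 1 <;> simp [h1]
      · split_ifs <;> simp
    rw [Finset.prod_congr rfl fun v _ => hf v, Finset.prod_pow_eq_pow_sum, Finset.sum_add_distrib,
      ← Finset.sum_filter, ← Finset.sum_filter, Finset.sum_const, size, cost, smul_eq_mul,
      mul_comm e.W]
  · push Not at h
    obtain ⟨v, hv, hg⟩ := h
    refine Finset.prod_eq_zero (Finset.mem_univ v) ?_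
    have := hw.term_le v
    rw [factor, if_pos (by omega), show 1 - e.term v = 0 by omega]
    simp

theorem fullTotal_eq {wt : ℕ → ℕ} (hw : e.Weighted wt) :
    fullTotal e = ((∑ g ∈ good e, e.z ^ (e.W * size g + cost wt g) : ℕ) : ZMod e.Q) := by
  classical
  rw [fullTotal, good, Finset.sum_filter, Nat.cast_sum]
  refine Finset.sum_congr rfl fun g _ => ?_
  rw [← Nat.cast_prod, prod_factor hw]
  by_cases h₁ : HasClash e (ext g)
  · simp [h₁]
  · by_cases h₂ : ∀ v : Fin e.n, e.term v ≠ 0 → 1 < g v <;> simp [h₁, h₂]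

theorem size_le {n : ℕ} (g : Fin n → ℕ) : size g ≤ n :=
  (Finset.card_filter_le _ _).trans (by simp)

theorem cost_lt {wt : ℕ → ℕ} (hw : e.Weighted wt) (g : Fin e.n → ℕ) : cost wt g < e.W := by
  have h₁ : cost wt g ≤ (Finset.univ.filter fun v => 1 < g v).card * 2 ^ e.nb :=
    Finset.sum_le_card_nsmul _ _ _ fun v _ => hw.wt_le v v.2
  have h₂ : (Finset.univ.filter fun v => 1 < g v).card ≤ e.n :=
    (Finset.card_filter_le _ _).trans (by simp)
  rw [Env.W]
  nlinarith [Nat.mul_le_mul_right (2 ^ e.nb) h₂]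

/-- The count at a position is at most 4^n < z, so there are no carries, and the packed number is
smaller than `Q`, so its residue determines it. -/
theorem mod_four_digit {wt : ℕ → ℕ} (hw : e.Weighted wt) {x : ℕ} (hx : x < e.Q)
    (hxt : (x : ZMod e.Q) = fullTotal e) {j : ℕ} (hj : j < e.digits) :
    x / e.z ^ j % 4 =
      ((good e).filter fun g => e.W * size g + cost wt g = j).card % 4 := by
  set c : ℕ → ℕ := fun j => ((good e).filter fun g => e.W * size g + cost wt g = j).card with hc
  have hcz : ∀ i, c i < e.z := by
    intro i
    have h₁ : c i ≤ (good e).card := Finset.card_le_card (Finset.filter_subset _ _)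
    have h₂ : (good e).card ≤ 4 ^ e.n := by
      refine (Finset.card_le_card (good_subset e)).trans ?_
      rw [card_assignments]
      simp
    exact (h₁.trans h₂).trans_lt (Nat.pow_lt_pow_right (by norm_num) (Nat.lt_succ_self _))
  have hlt : ∀ g : Fin e.n → ℕ, e.W * size g + cost wt g < e.digits := by
    intro g
    have h₁ := size_le g
    have h₂ := cost_lt hw g
    rw [Env.digits]
    nlinarith [Nat.mul_le_mul_left e.W h₁]
  have hsum : ∑ g ∈ good e, e.z ^ (e.W * size g + cost wt g) =
      ∑ i ∈ Finset.range e.digits, c i * e.z ^ i := by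
    rw [← Finset.sum_fiberwise_of_maps_to (g := fun g => e.W * size g + cost wt g)
      (t := Finset.range e.digits) (fun g _ => Finset.mem_range.2 (hlt g))]
    refine Finset.sum_congr rfl fun i _ => ?_
    rw [Finset.sum_congr rfl fun g hg => by rw [(Finset.mem_filter.1 hg).2], Finset.sum_const,
      smul_eq_mul]
  have hxs : x = ∑ i ∈ Finset.range e.digits, c i * e.z ^ i := by
    rw [fullTotal_eq hw, hsum, ZMod.natCast_eq_natCast_iff'] at hxt
    rwa [Nat.mod_eq_of_lt hx, Nat.mod_eq_of_lt] at hxt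
    rw [e.Q_eq]
    exact sum_digits_lt hcz _
  rw [hxs]
  exact sum_digits_div_mod hcz ⟨4 ^ e.n, by rw [Env.z, pow_succ, mul_comm]⟩ hj

end Secluded

/-! ## Cuts that respect the edges of a graph -/

/-- Such a function is constant along walks, so it is the same as an arbitrary function on the
components. -/
theorem SimpleGraph.card_locallyConstant {X : Type*} [Finite X] (Γ : SimpleGraph X) :
    Nat.card {f : X → Bool // ∀ u v, Γ.Adj u v → f u = f v} =
      2 ^ Nat.card Γ.ConnectedComponent := by
  have key : ∀ f : X → Bool, (∀ u v, Γ.Adj u v → f u = f v) → ∀ u v (p : Γ.Walk u v), f u = f v := by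
    intro f hf u v p
    induction p with
    | nil => rfl
    | cons h _ ih => exact (hf _ _ h).trans ih
  rw [Nat.card_congr (β := Γ.ConnectedComponent → Bool)
    { toFun := fun f => SimpleGraph.ConnectedComponent.lift f.1 fun u v p _ => key f.1 f.2 u v p
      invFun := fun F => ⟨fun v => F (Γ.connectedComponentMk v), fun u v h =>
        congrArg F (SimpleGraph.ConnectedComponent.connectedComponentMk_eq_of_adj h)⟩
      left_inv := fun f => rfl
      right_inv := fun F => by
        funext c
        induction c using SimpleGraph.ConnectedComponent.ind
        rfl }]
  have : Finite Γ.ConnectedComponent := Quot.finite _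
  simp [Nat.card_fun]

namespace Secluded

variable {n : ℕ} {G : SimpleGraph (Fin n)} {S : Finset (Fin n)}

/-- The assignment respects the edges of the graph. -/
def Respects (G : SimpleGraph (Fin n)) (g : Fin n → ℕ) : Prop :=
  ∀ u v, G.Adj u v → g u = 0 ∨ g v = 0 ∨ g u = g v

open Classical in
/-- The assignments that respect the edges of `G` and contain `S`. -/
noncomputable def cuts (G : SimpleGraph (Fin n)) (S : Finset (Fin n)) : Finset (Fin n → ℕ) :=
  (assignments Finset.univ).filter fun g => Respects G g ∧ ∀ v ∈ S, 1 < g v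

theorem mem_cuts {g : Fin n → ℕ} :
    g ∈ cuts G S ↔ (∀ v, g v < 4) ∧ Respects G g ∧ ∀ v ∈ S, 1 < g v := by
  simp [cuts, mem_assignments]

/-- Forget which side of the cut a vertex is on. -/
def merge (g : Fin n → ℕ) (v : Fin n) : ℕ := if g v = 3 then 2 else g v

/-- The vertices of the subgraph. -/
def inner (g : Fin n → ℕ) : Set (Fin n) := {v | g v = 2}

theorem Respects.merge {g : Fin n → ℕ} (h : Respects G g) : Respects G (merge g) := by
  intro u v huv
  have := h u v huv
  simp only [Secluded.merge]
  split_ifs <;> omega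

/-- Outside the subgraph the assignment is prescribed. Inside, the choice between 2 and 3 has to be
constant along edges, that is, a free choice for every component; edges leaving the subgraph impose
nothing, since their outer ends have state 0. -/
theorem card_fiber {h : Fin n → ℕ} (hlt : ∀ v, h v < 3) (hr : Respects G h)
    (hS : ∀ v ∈ S, 1 < h v) : ((cuts G S).filter fun g => merge g = h).card =
      2 ^ Nat.card (G.induce (inner h)).ConnectedComponent := by
  classical
  rw [← SimpleGraph.card_locallyConstant, ← Nat.card_eq_finsetCard]
  have hin : ∀ {g : Fin n → ℕ} {v}, merge g = h → v ∈ inner h → g v = 2 ∨ g v = 3 := by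
    intro g v hg hv
    have : merge g v = 2 := by rw [hg]; exact hv
    rw [merge] at this
    split_ifs at this with h3
    · exact Or.inr h3
    · exact Or.inl this
  refine Nat.card_congr
    { toFun := fun g => ⟨fun v => decide (g.1 v = 3), fun u v huv => ?_⟩
      invFun := fun f => ⟨fun v => if hv : v ∈ inner h then if f.1 ⟨v, hv⟩ then 3 else 2 else h v,
        ?_⟩
      left_inv := fun g => ?_
      right_inv := fun f => ?_ }
  · obtain ⟨g, hg⟩ := g
    obtain ⟨hg, hm⟩ := Finset.mem_filter.1 hg
    have h₁ := hin hm u.2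
    have h₂ := hin hm v.2
    have h₃ := (mem_cuts.1 hg).2.1 u v huv
    have : g u = g v := by omega
    simp [this]
  · obtain ⟨f, hf⟩ := f
    rw [Finset.mem_filter, mem_cuts]
    have hinn : ∀ {v}, v ∈ inner h ↔ h v = 2 := Iff.rfl
    refine ⟨⟨fun v => ?_, fun u v huv => ?_, fun v hv => ?_⟩, ?_⟩
    · have := hlt v
      dsimp only
      split_ifs <;> omega
    · have h₁ := hr u v huv
      dsimp only
      by_cases hu : u ∈ inner h
      · by_cases hv : v ∈ inner h
        · rw [dif_pos hu, dif_pos hv]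
          simp [hf ⟨u, hu⟩ ⟨v, hv⟩ huv]
        · rw [dif_neg hv]
          rw [hinn] at hu hv
          omega
      · rw [dif_neg hu]
        by_cases hv : v ∈ inner h
        · rw [hinn] at hu hv
          omega
        · rw [dif_neg hv]
          exact h₁
    · have h₁ := hS v hv
      dsimp only
      split_ifs <;> omega
    · funext v
      simp only [merge]
      by_cases hv : v ∈ inner h
      · have hv' := hinn.1 hv
        rw [dif_pos hv]
        split_ifs <;> omega
      · have := hlt v
        rw [dif_neg hv, if_neg (by omega)]
  · obtain ⟨g, hg⟩ := g
    obtain ⟨hg, hm⟩ := Finset.mem_filter.1 hg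
    apply Subtype.ext
    funext v
    dsimp only
    by_cases hv : v ∈ inner h
    · rw [dif_pos hv]
      rcases hin hm hv with h₂ | h₂ <;> simp [h₂]
    · rw [dif_neg hv, ← hm, merge]
      have : h v ≠ 2 := hv
      rw [← hm, merge] at this
      split_ifs at this ⊢ <;> simp_all
  · apply Subtype.ext
    funext v
    simp [v.2]

/-- A nonempty disconnected graph has at least two components, and an empty fibre is harmless. The
empty set must be excluded: it has no components and exactly one cut. -/
theorem four_dvd_card_fiber {h : Fin n → ℕ} (hne : (inner h).Nonempty)
    (hc : ¬ (G.induce (inner h)).Connected) :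
    4 ∣ ((cuts G S).filter fun g => merge g = h).card := by
  rcases Finset.eq_empty_or_nonempty ((cuts G S).filter fun g => merge g = h) with he | ⟨g, hg⟩
  · simp [he]
  · obtain ⟨hg, hm⟩ := Finset.mem_filter.1 hg
    obtain ⟨hg4, hr, hS⟩ := mem_cuts.1 hg
    have hlt : ∀ v, h v < 3 := fun v => by
      have := hg4 v
      rw [← hm, merge]
      split_ifs <;> omega
    have hS' : ∀ v ∈ S, 1 < h v := fun v hv => by
      have := hS v hv
      rw [← hm, merge]
      split_ifs <;> omega
    rw [card_fiber hlt (hm ▸ hr.merge) hS']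
    have : Finite (G.induce (inner h)).ConnectedComponent := Quot.finite _
    have : Nonempty (inner h) := hne.to_subtype
    have hcard : 2 ≤ Nat.card (G.induce (inner h)).ConnectedComponent := by
      by_contra hlt
      refine hc ⟨fun u v => ?_⟩
      have hsub : Subsingleton (G.induce (inner h)).ConnectedComponent := by
        rw [← Finite.card_le_one_iff_subsingleton]
        omega
      exact SimpleGraph.ConnectedComponent.exact (Subsingleton.elim _ _)
    exact pow_dvd_pow 2 hcard

theorem card_fiber_of_connected {h : Fin n → ℕ} (hlt : ∀ v, h v < 3) (hr : Respects G h)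
    (hS : ∀ v ∈ S, 1 < h v) (hc : (G.induce (inner h)).Connected) :
    ((cuts G S).filter fun g => merge g = h).card = 2 := by
  rw [card_fiber hlt hr hS]
  have := hc.preconnected.subsingleton_connectedComponent
  have : Nonempty (G.induce (inner h)).ConnectedComponent := by
    obtain ⟨v⟩ := hc.nonempty
    exact ⟨(G.induce (inner h)).connectedComponentMk v⟩
  rw [Nat.card_of_subsingleton this.some, pow_one]

/-! ### Solutions -/

/-- Only the vertex set matters for the terminals and the neighbourhood, and adding all edges inside
it keeps a subgraph connected. -/
theorem isSecludedSteinerYes_iff {S : Set (Fin n)} {k : ℕ} : IsSecludedSteinerYes G S k ↔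
    ∃ X : Set (Fin n), (G.induce X).Connected ∧ S ⊆ X ∧ (closedNbhd G X).ncard ≤ k := by
  constructor
  · rintro ⟨H, hH, hS, hk⟩
    exact ⟨H.verts, hH.induce_verts, hS, hk⟩
  · rintro ⟨X, hX, hS, hk⟩
    exact ⟨(⊤ : G.Subgraph).induce X, SimpleGraph.connected_induce_iff.1 hX, hS, hk⟩

theorem mem_closedNbhd {X : Set (Fin n)} {v : Fin n} :
    v ∈ closedNbhd G X ↔ v ∈ X ∨ ∃ u ∈ X, G.Adj u v := by
  simp only [closedNbhd, openNbhd, Set.mem_union, Set.mem_sdiff, Set.mem_iUnion,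
    SimpleGraph.mem_neighborSet, exists_prop]
  by_cases hv : v ∈ X <;> simp [hv]

theorem size_merge (g : Fin n → ℕ) : size (merge g) = size g := by
  rw [size, size]
  congr 1
  refine Finset.filter_congr fun v _ => ?_
  rw [merge]
  split_ifs <;> omega

theorem cost_merge (wt : ℕ → ℕ) (g : Fin n → ℕ) : cost wt (merge g) = cost wt g := by
  rw [cost, cost]
  refine Finset.sum_congr (Finset.filter_congr fun v _ => ?_) fun _ _ => rfl
  rw [merge]
  split_ifs <;> omega

theorem closedNbhd_subset {g : Fin n → ℕ} (hr : Respects G g) :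
    closedNbhd G (inner g) ⊆ ↑(Finset.univ.filter fun v => g v ≠ 1) := by
  intro v hv
  rw [mem_closedNbhd] at hv
  simp only [Finset.coe_filter, Finset.mem_univ, true_and, Set.mem_ofPred_eq]
  rcases hv with hv | ⟨u, hu, huv⟩
  · have : g v = 2 := hv
    omega
  · have h₁ : g u = 2 := hu
    have h₂ := hr u v huv
    omega

theorem cost_eq_zero {wt : ℕ → ℕ} {g : Fin n → ℕ} (hg : ∀ v, g v < 3)
    (h : ¬ (inner g).Nonempty) : cost wt g = 0 := by
  rw [cost, Finset.sum_eq_zero]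
  intro v hv
  have h₁ := (Finset.mem_filter.1 hv).2
  have h₂ := hg v
  exact absurd ⟨v, show g v = 2 by omega⟩ h

/-- Summing up the cuts over the subgraphs they belong to. -/
theorem card_cuts_eq (wt : ℕ → ℕ) (c w : ℕ) :
    ((cuts G S).filter fun g => size g = c ∧ cost wt g = w).card =
      ∑ h ∈ ((cuts G S).image merge).filter fun h => size h = c ∧ cost wt h = w,
        ((cuts G S).filter fun g => merge g = h).card := by
  rw [Finset.card_eq_sum_card_fiberwise (f := merge)
    (t := ((cuts G S).image merge).filter fun h => size h = c ∧ cost wt h = w)]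
  · refine Finset.sum_congr rfl fun h hh => ?_
    rw [Finset.filter_filter]
    congr 1
    refine Finset.filter_congr fun g _ => ⟨fun hg => hg.2, fun hg => ⟨?_, hg⟩⟩
    have := (Finset.mem_filter.1 hh).2
    rwa [← hg, size_merge, cost_merge] at this
  · intro g hg
    have hg := Finset.mem_filter.1 (Finset.mem_coe.1 hg)
    rw [Finset.mem_coe, Finset.mem_filter, size_merge, cost_merge]
    exact ⟨Finset.mem_image_of_mem _ hg.1, hg.2⟩

theorem mem_image_merge {h : Fin n → ℕ} (hh : h ∈ (cuts G S).image merge) :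
    (∀ v, h v < 3) ∧ Respects G h ∧ ∀ v ∈ S, 1 < h v := by
  obtain ⟨g, hg, rfl⟩ := Finset.mem_image.1 hh
  obtain ⟨hg4, hr, hS⟩ := mem_cuts.1 hg
  refine ⟨fun v => ?_, hr.merge, fun v hv => ?_⟩
  · have := hg4 v
    rw [merge]
    split_ifs <;> omega
  · have := hS v hv
    rw [merge]
    split_ifs <;> omega

theorem subset_inner {h : Fin n → ℕ} (hlt : ∀ v, h v < 3) (hS : ∀ v ∈ S, 1 < h v) :
    (S : Set (Fin n)) ⊆ inner h := fun v hv => by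
  have h₁ := hS v hv
  have h₂ := hlt v
  exact show h v = 2 by omega

theorem ncard_closedNbhd_le {h : Fin n → ℕ} (hr : Respects G h) :
    (closedNbhd G (inner h)).ncard ≤ size h := by
  rw [size, ← Set.ncard_coe_finset]
  exact Set.ncard_le_ncard (closedNbhd_subset hr) (Set.toFinite _)

/-- A number of cuts that is not divisible by four reveals a solution. -/
theorem isSecludedSteinerYes_of_card {wt : ℕ → ℕ} {c w k : ℕ} (hw : w ≠ 0) (hck : c ≤ k)
    (h4 : ((cuts G S).filter fun g => size g = c ∧ cost wt g = w).card % 4 ≠ 0) :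
    IsSecludedSteinerYes G (S : Set (Fin n)) k := by
  rw [isSecludedSteinerYes_iff]
  by_contra hno
  push Not at hno
  refine h4 (Nat.mod_eq_zero_of_dvd ?_)
  rw [card_cuts_eq]
  refine Finset.dvd_sum fun h hh => ?_
  obtain ⟨hh', hsize, hcost⟩ := Finset.mem_filter.1 hh
  obtain ⟨hlt, hr, hS⟩ := mem_image_merge hh'
  -- This is the point of demanding a nonzero weight.
  have hne : (inner h).Nonempty := by
    by_contra hne
    exact hw (hcost.symm.trans (cost_eq_zero hlt hne))
  refine four_dvd_card_fiber hne fun hc => ?_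
  have := hno _ hc (subset_inner hlt hS)
  have := ncard_closedNbhd_le hr
  omega

/-- The vertex sets of the solutions with a smallest possible neighbourhood. -/
noncomputable def solutions (G : SimpleGraph (Fin n)) (S : Finset (Fin n)) (c : ℕ) :
    Set (Finset (Fin n)) :=
  {X | (G.induce (X : Set (Fin n))).Connected ∧ S ⊆ X ∧
    (closedNbhd G (X : Set (Fin n))).ncard = c}

/-- If there is exactly one lightest solution, then the number of its cuts is not divisible by
four. -/
theorem card_mod_four {wt : ℕ → ℕ} {c : ℕ} (hwt : ∀ v, 0 < wt v)
    (hmin : ∀ X : Set (Fin n), (G.induce X).Connected → (S : Set (Fin n)) ⊆ X →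
      c ≤ (closedNbhd G X).ncard)
    {X : Finset (Fin n)} (hX : X ∈ solutions G S c)
    (huniq : ∀ Y ∈ solutions G S c, ∑ v ∈ Y, wt v = ∑ v ∈ X, wt v → Y = X) :
    ∑ v ∈ X, wt v ≠ 0 ∧
    ((cuts G S).filter fun g => size g = c ∧ cost wt g = ∑ v ∈ X, wt v).card % 4 = 2 := by
  classical
  obtain ⟨hXc, hXS, hXn⟩ := hX
  have hXne : X.Nonempty := by
    obtain ⟨v⟩ := hXc.nonempty
    exact ⟨v.1, v.2⟩
  have hpos : 0 < ∑ v ∈ X, wt v := Finset.sum_pos (fun v _ => hwt v) hXne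
  refine ⟨hpos.ne', ?_⟩
  -- The cheapest assignment for X, which pays for nothing but the closed neighbourhood. It
  -- contributes 2, and every other assignment turns out to contribute a multiple of four.
  set h₀ : Fin n → ℕ := fun v => if v ∈ X then 2 else if v ∈ closedNbhd G (X : Set (Fin n))
    then 0 else 1 with hh₀
  have hin₀ : inner h₀ = X := by
    ext v
    simp only [inner, hh₀, Set.mem_ofPred_eq, Finset.mem_coe]
    split_ifs <;> simp_all
  have hlt₀ : ∀ v, h₀ v < 3 := fun v => by
    simp only [hh₀]
    split_ifs <;> omega
  have hr₀ : Respects G h₀ := by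
    intro u v huv
    simp only [hh₀]
    have hu : v ∈ X → u ∈ closedNbhd G (X : Set (Fin n)) := fun h =>
      mem_closedNbhd.2 (Or.inr ⟨v, h, huv.symm⟩)
    have hv : u ∈ X → v ∈ closedNbhd G (X : Set (Fin n)) := fun h =>
      mem_closedNbhd.2 (Or.inr ⟨u, h, huv⟩)
    split_ifs <;> simp_all
  have hS₀ : ∀ v ∈ S, 1 < h₀ v := fun v hv => by simp [hh₀, hXS hv]
  have hsize₀ : size h₀ = c := by
    rw [← hXn, size, ← Set.ncard_coe_finset]
    congr 1
    ext v
    simp only [hh₀, Finset.coe_filter, Finset.mem_univ, true_and, Set.mem_ofPred_eq]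
    have : v ∈ X → v ∈ closedNbhd G (X : Set (Fin n)) := fun h => mem_closedNbhd.2 (Or.inl h)
    split_ifs <;> simp_all
  have hcost : ∀ h : Fin n → ℕ, (∀ v, h v < 3) → cost wt h = ∑ v ∈ (inner h).toFinset, wt v := by
    intro h hlt
    rw [cost]
    refine Finset.sum_congr ?_ fun _ _ => rfl
    ext v
    have := hlt v
    rw [Finset.mem_filter, Set.mem_toFinset]
    change _ ↔ h v = 2
    simp only [Finset.mem_univ, true_and]
    omega
  have hcost₀ : cost wt h₀ = ∑ v ∈ X, wt v := by
    rw [hcost h₀ hlt₀]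
    refine Finset.sum_congr ?_ fun _ _ => rfl
    ext v
    rw [Set.mem_toFinset, hin₀, Finset.mem_coe]
  have hfib₀ := card_fiber_of_connected hlt₀ hr₀ hS₀ (by rw [hin₀]; exact hXc)
  have hmem₀ : h₀ ∈ ((cuts G S).image merge).filter
      fun h => size h = c ∧ cost wt h = ∑ v ∈ X, wt v := by
    rw [Finset.mem_filter]
    refine ⟨?_, hsize₀, hcost₀⟩
    have : 0 < ((cuts G S).filter fun g => merge g = h₀).card := by omega
    obtain ⟨g, hg⟩ := Finset.card_pos.1 this
    rw [Finset.mem_filter] at hg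
    exact Finset.mem_image.2 ⟨g, hg⟩
  rw [card_cuts_eq, ← Finset.add_sum_erase _ _ hmem₀, hfib₀]
  have hdvd : 4 ∣ ∑ h ∈ (((cuts G S).image merge).filter
      fun h => size h = c ∧ cost wt h = ∑ v ∈ X, wt v).erase h₀,
      ((cuts G S).filter fun g => merge g = h).card := by
    refine Finset.dvd_sum fun h hh => ?_
    rw [Finset.mem_erase, Finset.mem_filter] at hh
    obtain ⟨hne, hh, hs, hw⟩ := hh
    obtain ⟨hlt, hr, hS⟩ := mem_image_merge hh
    refine four_dvd_card_fiber ?_ fun hc => hne ?_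
    · by_contra hemp
      rw [cost_eq_zero hlt hemp] at hw
      omega
    have hle := hmin _ hc (subset_inner hlt hS)
    have hge := ncard_closedNbhd_le hr
    have hsol : (inner h).toFinset ∈ solutions G S c := by
      refine ⟨by rwa [Set.coe_toFinset], ?_, by rw [Set.coe_toFinset]; omega⟩
      intro v hv
      rw [Set.mem_toFinset]
      exact subset_inner hlt hS hv
    have hYX := huniq _ hsol (by rw [← hcost h hlt, hw])
    have hinX : inner h = X := by rw [← hYX, Set.coe_toFinset]
    -- The closed neighbourhood has at most `size h` = c vertices by inclusion and at least c by
    -- minimality. So the inclusion is an equality, and h is determined by its inner set, which is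
    -- X.
    have heq : closedNbhd G (inner h) = ↑(Finset.univ.filter fun v => h v ≠ 1) := by
      refine Set.eq_of_subset_of_ncard_le (closedNbhd_subset hr) ?_ (Set.toFinite _)
      rw [Set.ncard_coe_finset]
      change size h ≤ _
      omega
    funext v
    have h₁ : v ∈ closedNbhd G (X : Set (Fin n)) ↔ h v ≠ 1 := by
      rw [← hinX, heq]
      simp
    have h₂ : v ∈ X ↔ h v = 2 := by
      rw [← Finset.mem_coe, ← hinX]
      rfl
    have h₃ := hlt v
    simp only [hh₀]
    split_ifs with ha hb
    · exact h₂.1 ha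
    · have := h₁.1 hb
      have := mt h₂.2 ha
      omega
    · have := mt h₁.2 hb
      omega
  obtain ⟨y, hy⟩ := hdvd
  rw [hy]
  omega

end Secluded

/-! ## The isolation lemma -/

/-- The weight `w` does not decide whether the lightest sets of the family contain `v`. -/
def Ambiguous {V : Type*} (F : Set (Finset V)) (w : V → ℕ) (v : V) : Prop :=
  ∃ X ∈ F, ∃ Y ∈ F, v ∈ X ∧ v ∉ Y ∧ ∑ u ∈ X, w u = ∑ u ∈ Y, w u ∧
    (∀ Z ∈ F, v ∈ Z → ∑ u ∈ X, w u ≤ ∑ u ∈ Z, w u) ∧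
    ∀ Z ∈ F, v ∉ Z → ∑ u ∈ Y, w u ≤ ∑ u ∈ Z, w u

/-- If the lightest sets with and without v weigh the same, the weight of v is the difference of two
minima that involve only the other vertices. -/
theorem Ambiguous.eq {V : Type*} {F : Set (Finset V)} {w w' : V → ℕ} {v : V}
    (h : Ambiguous F w v) (h' : Ambiguous F w' v) (hw : ∀ u, u ≠ v → w u = w' u) : w v = w' v := by
  classical
  obtain ⟨X, hX, Y, hY, hvX, hvY, heq, hXmin, hYmin⟩ := h
  obtain ⟨X', hX', Y', hY', hvX', hvY', heq', hXmin', hYmin'⟩ := h'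
  have hout : ∀ Z : Finset V, v ∉ Z → ∑ u ∈ Z, w u = ∑ u ∈ Z, w' u := fun Z hZ =>
    Finset.sum_congr rfl fun u hu => hw u fun h => hZ (h ▸ hu)
  have h₁ := hYmin Y' hY' hvY'
  have h₂ := hYmin' Y hY hvY
  have h₃ := hout Y hvY
  have h₄ := hout Y' hvY'
  have h₅ := hXmin X' hX' hvX'
  have h₆ := hXmin' X hX hvX
  have h₇ := Finset.add_sum_erase X w hvX
  have h₈ := Finset.add_sum_erase X w' hvX
  have h₉ := Finset.add_sum_erase X' w hvX'
  have h₁₀ := Finset.add_sum_erase X' w' hvX'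
  have h₁₁ := hout (X.erase v) (Finset.notMem_erase v X)
  have h₁₂ := hout (X'.erase v) (Finset.notMem_erase v X')
  omega

/-- If a lightest set and another set have equal weight, both are lightest, and every vertex in
which they differ is ambiguous. -/
theorem exists_isolated {V : Type*} {F : Set (Finset V)} (hF : F.Nonempty) {w : V → ℕ}
    (h : ∀ v, ¬ Ambiguous F w v) :
    ∃ X ∈ F, ∀ Y ∈ F, ∑ u ∈ Y, w u = ∑ u ∈ X, w u → Y = X := by
  have hwf := WellFounded.has_min (InvImage.wf (fun X : Finset V => ∑ u ∈ X, w u) Nat.lt_wfRel.wf)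
    F hF
  obtain ⟨X, hX, hmin⟩ := hwf
  have hmin' : ∀ Y ∈ F, ∑ u ∈ X, w u ≤ ∑ u ∈ Y, w u := fun Y hY => not_lt.1 (hmin Y hY)
  refine ⟨X, hX, fun Y hY hYX => ?_⟩
  by_contra hne
  have hex : ∃ v, ¬ (v ∈ Y ↔ v ∈ X) := by
    by_contra hall
    push Not at hall
    exact hne (Finset.ext hall)
  obtain ⟨v, hv⟩ := hex
  by_cases hvX : v ∈ X
  · have hvY : v ∉ Y := fun h => hv (iff_of_true h hvX)
    exact h v ⟨X, hX, Y, hY, hvX, hvY, hYX.symm, fun Z hZ _ => hmin' Z hZ,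
      fun Z hZ _ => hYX ▸ hmin' Z hZ⟩
  · have hvY : v ∈ Y := by
      by_contra h
      exact hv (iff_of_false h hvX)
    exact h v ⟨Y, hY, X, hX, hvY, hvX, hYX, fun Z hZ _ => hYX ▸ hmin' Z hZ,
      fun Z hZ _ => hmin' Z hZ⟩

/-! ## Random weights from coin tosses -/

namespace Ram

/-- Reduces the probability of an event decided by the first K coins to counting: fixing these coins
gives a cylinder of measure 2^(-K). -/
theorem coinMeasure_prefix (K : ℕ) (A : Finset (Fin K → Bool)) :
    coinMeasure {ω | (fun i : Fin K => ω i) ∈ A} = A.card / 2 ^ K := by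
  have hpt : ∀ a : Fin K → Bool, {ω : ℕ → Bool | (fun i : Fin K => ω i) = a} =
      Set.pi (Finset.range K) (fun i => {if h : i < K then a ⟨i, h⟩ else false}) := by
    intro a
    ext ω
    simp only [Set.mem_ofPred_eq, Set.mem_pi, Finset.coe_range, Set.mem_Iio,
      Set.mem_singleton_iff]
    constructor
    · rintro rfl i hi
      simp [hi]
    · intro h
      funext i
      simpa using h i i.2
  have hmeas : ∀ a : Fin K → Bool,
      MeasurableSet {ω : ℕ → Bool | (fun i : Fin K => ω i) = a} := by
    intro a
    rw [hpt]
    exact MeasurableSet.pi (Finset.countable_toSet _) fun i _ => MeasurableSet.singleton _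
  have hmu : ∀ a : Fin K → Bool,
      coinMeasure {ω : ℕ → Bool | (fun i : Fin K => ω i) = a} = (2 ^ K)⁻¹ := by
    intro a
    rw [hpt, coinMeasure, Measure.infinitePi_pi _ fun i _ => MeasurableSet.singleton _]
    have : ∀ x : Bool, (PMF.uniformOfFintype Bool).toMeasure {x} = 2⁻¹ := fun x => by
      rw [PMF.toMeasure_apply_singleton _ _ (MeasurableSet.singleton _)]
      simp
    simp only [this, Finset.prod_const, Finset.card_range]
    rw [ENNReal.inv_pow]
  have hunion : {ω : ℕ → Bool | (fun i : Fin K => ω i) ∈ A} =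
      ⋃ a ∈ A, {ω : ℕ → Bool | (fun i : Fin K => ω i) = a} := by
    ext ω
    simp
  rw [hunion, measure_biUnion_finset _ fun a _ => hmeas a]
  · simp only [hmu, Finset.sum_const, nsmul_eq_mul]
    rfl
  · intro a _ b _ hab
    rw [Function.onFun, Set.disjoint_left]
    rintro ω rfl h
    exact hab h

end Ram

namespace Secluded

open Ram

theorem draw_congr {ω ω' : ℕ → Bool} {j : ℕ} (h : ∀ i < j, ω i = ω' i) : draw ω j = draw ω' j := by
  induction j with
  | zero => rfl
  | succ j ih => rw [draw, draw, ih fun i hi => h i (by omega), h j (by omega)]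

theorem draw_injective {ω ω' : ℕ → Bool} {j : ℕ} (h : draw ω j = draw ω' j) :
    ∀ i < j, ω i = ω' i := by
  induction j with
  | zero => simp
  | succ j ih =>
    rw [draw, draw] at h
    have hlast : ω j = ω' j := by
      by_cases h₁ : ω j <;> by_cases h₂ : ω' j <;> simp [h₁, h₂] at h ⊢ <;> omega
    have hrest : draw ω j = draw ω' j := by
      rw [hlast] at h
      omega
    intro i hi
    rcases Nat.lt_succ_iff_lt_or_eq.1 hi with h' | rfl
    · exact ih hrest i h'
    · exact hlast

/-- An infinite sequence of coins with the given beginning. -/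
def pad {K : ℕ} (x : Fin K → Bool) (i : ℕ) : Bool := if h : i < K then x ⟨i, h⟩ else false

theorem block_lt {n nb v i : ℕ} (hv : v < n) (hi : i < nb) : v * nb + i < n * nb := by
  have := Nat.mul_le_mul_right nb (show v + 1 ≤ n from hv)
  rw [add_mul] at this
  omega

theorem weight_pad {n nb : ℕ} (ω : ℕ → Bool) {v : ℕ} (hv : v < n) :
    weight nb (pad fun i : Fin (n * nb) => ω i) v = weight nb ω v := by
  rw [weight, weight]
  congr 1
  exact draw_congr fun i hi => by simp [pad, block_lt hv hi]

open Classical in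
-- Overwriting the coins of v by an arbitrary block β is injective on pairs of an ambiguous outcome
-- and a block: the image shows β and the coins of all other vertices, and by `Ambiguous.eq` these
-- determine the lost weight of v, hence its coins.
theorem card_ambiguous_le {n nb : ℕ} (F : Set (Finset (Fin n))) (v : Fin n) :
    (Finset.univ.filter fun x : Fin (n * nb) → Bool =>
      Ambiguous F (fun u : Fin n => weight nb (pad x) u) v).card * 2 ^ nb ≤ 2 ^ (n * nb) := by
  set A := Finset.univ.filter fun x : Fin (n * nb) → Bool =>
      Ambiguous F (fun u : Fin n => weight nb (pad x) u) v with hA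
  set f : (Fin (n * nb) → Bool) × (Fin nb → Bool) → Fin (n * nb) → Bool := fun y i =>
    if h : v * nb ≤ i ∧ (i : ℕ) - v * nb < nb then y.2 ⟨i - v * nb, h.2⟩ else y.1 i with hf
  have hcard : (A ×ˢ (Finset.univ : Finset (Fin nb → Bool))).card = A.card * 2 ^ nb := by
    rw [Finset.card_product]
    simp
  have hK : (Finset.univ : Finset (Fin (n * nb) → Bool)).card = 2 ^ (n * nb) := by simp
  rw [← hcard, ← hK]
  refine Finset.card_le_card_of_injOn f (fun _ _ => Finset.mem_coe.2 (Finset.mem_univ _)) ?_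
  rintro ⟨x, β⟩ hx ⟨x', β'⟩ hx' heq
  simp only [Finset.coe_product, Set.mem_prod, Finset.mem_coe, hA, Finset.mem_filter,
    Finset.mem_univ, true_and] at hx hx'
  have hx := hx.1
  have hx' := hx'.1
  have hβ : β = β' := by
    funext i
    have := congrFun heq ⟨v * nb + i, block_lt v.2 i.2⟩
    simpa [hf] using this
  have hoff : ∀ i : Fin (n * nb), ¬ (v * nb ≤ (i : ℕ) ∧ (i : ℕ) - v * nb < nb) → x i = x' i := by
    intro i hi
    have := congrFun heq i
    simpa [hf, hi] using this
  have hw : ∀ u : Fin n, u ≠ v → weight nb (pad x) u = weight nb (pad x') u := by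
    intro u huv
    rw [weight, weight]
    congr 1
    refine draw_congr fun i hi => ?_
    have hlt := block_lt u.2 hi
    simp only [pad, hlt, dif_pos]
    refine hoff _ fun hc => huv (Fin.ext ?_)
    obtain ⟨h₁, h₂⟩ := hc
    simp only at h₁ h₂
    rcases lt_trichotomy (u : ℕ) v with h | h | h
    · have := Nat.mul_le_mul_right nb (show (u : ℕ) + 1 ≤ v from h)
      rw [add_mul] at this
      omega
    · exact h
    · have := Nat.mul_le_mul_right nb (show (v : ℕ) + 1 ≤ u from h)
      rw [add_mul] at this
      omega
  have hv := hx.eq hx' hw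
  have hdraw : draw (fun i => pad x (v * nb + i)) nb = draw (fun i => pad x' (v * nb + i)) nb :=
    Nat.succ_injective hv
  have hxx : x = x' := by
    funext i
    by_cases hi : v * nb ≤ (i : ℕ) ∧ (i : ℕ) - v * nb < nb
    · have := draw_injective hdraw _ hi.2
      simpa [pad, Nat.add_sub_cancel' hi.1] using this
    · exact hoff i hi
  rw [hxx, hβ]

/-- With probability at least one half, random weights single out a set of the family. -/
theorem half_le_isolated {n nb : ℕ} (hnb : 2 * n ≤ 2 ^ nb) {F : Set (Finset (Fin n))}
    (hF : F.Nonempty) :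
    1 / 2 ≤ coinMeasure {ω | ∃ X ∈ F, ∀ Y ∈ F,
      ∑ u ∈ Y, weight nb ω u = ∑ u ∈ X, weight nb ω u → Y = X} := by
  classical
  set A : Fin n → Finset (Fin (n * nb) → Bool) := fun v => Finset.univ.filter fun x =>
    Ambiguous F (fun u : Fin n => weight nb (pad x) u) v with hA
  set B := Finset.univ.biUnion A with hB
  have hBcard : 2 * B.card ≤ 2 ^ (n * nb) := by
    -- Union bound over the vertices; with 2n ≤ 2^nb it leaves at most half of the outcomes.
    have h₁ : B.card * 2 ^ nb ≤ n * 2 ^ (n * nb) := by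
      calc B.card * 2 ^ nb ≤ (∑ v, (A v).card) * 2 ^ nb :=
            Nat.mul_le_mul_right _ Finset.card_biUnion_le
        _ = ∑ v, (A v).card * 2 ^ nb := Finset.sum_mul _ _ _
        _ ≤ ∑ _v : Fin n, 2 ^ (n * nb) := Finset.sum_le_sum fun v _ => card_ambiguous_le F v
        _ = n * 2 ^ (n * nb) := by simp
    rcases Nat.eq_zero_or_pos n with rfl | hn
    · have : B = ∅ := by
        rw [hB, Finset.univ_eq_empty, Finset.biUnion_empty]
      simp [this]
    · have h₂ : B.card * (2 * n) ≤ B.card * 2 ^ nb := Nat.mul_le_mul_left _ hnb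
      refine Nat.le_of_mul_le_mul_left ?_ hn
      calc n * (2 * B.card) = B.card * (2 * n) := by ring
        _ ≤ _ := h₂.trans h₁
  have hcompl : 2 ^ (n * nb) ≤ 2 * Bᶜ.card := by
    have : Bᶜ.card = 2 ^ (n * nb) - B.card := by rw [Finset.card_compl]; simp
    omega
  have hsub : {ω : ℕ → Bool | (fun i : Fin (n * nb) => ω i) ∈ Bᶜ} ⊆ {ω | ∃ X ∈ F, ∀ Y ∈ F,
      ∑ u ∈ Y, weight nb ω u = ∑ u ∈ X, weight nb ω u → Y = X} := by
    intro ω hω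
    refine exists_isolated hF fun v hv => ?_
    rw [Set.mem_ofPred_eq, Finset.mem_compl] at hω
    refine hω (Finset.mem_biUnion.2 ⟨v, Finset.mem_univ v, ?_⟩)
    rw [hA, Finset.mem_filter]
    refine ⟨Finset.mem_univ _, ?_⟩
    simpa only [weight_pad ω (Fin.is_lt _)] using hv
  refine le_trans ?_ (measure_mono hsub)
  rw [coinMeasure_prefix]
  rw [ENNReal.le_div_iff_mul_le (by simp) (by simp), one_div, mul_comm, ← div_eq_mul_inv]
  refine ENNReal.div_le_of_le_mul ?_
  rw [mul_comm _ (2 : ENNReal)]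
  exact_mod_cast hcompl

end Secluded

/-! ### Assembly: the answer of the whole program -/

namespace Secluded

open Ram

/-- The constraints on the input arrays, and the graph `G` with terminals `S` they describe. -/
structure Env.Describes (e : Env) (G : SimpleGraph (Fin e.n)) (S : Finset (Fin e.n)) : Prop where
  adj_iff : ∀ u v : Fin e.n, e.adj (u * e.n + v) ≠ 0 ↔ G.Adj u v
  term_iff : ∀ v : Fin e.n, e.term v ≠ 0 ↔ v ∈ S
  term_le : ∀ v, e.term v ≤ 1
  bag_le : ∀ i, e.bag i ≤ 1
  tree_irrefl : ∀ i < e.m, e.tree (i * e.m + i) = 0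
  size_b : ∀ i < e.m, 4 ^ (bagSet e i e.n).card ≤ e.b 20

theorem good_eq_cuts {e : Env} {G : SimpleGraph (Fin e.n)} {S : Finset (Fin e.n)}
    (h : e.Describes G S) : good e = cuts G S := by
  classical
  rw [good, cuts]
  refine Finset.filter_congr fun g _ => ?_
  refine and_congr ?_ (forall_congr' fun v => by rw [h.term_iff])
  constructor
  · intro hc u v huv
    by_contra hno
    push Not at hno
    refine hc ⟨u, u.2, v, v.2, (h.adj_iff u v).2 huv, ?_⟩
    simpa using hno
  · rintro hr ⟨u, hu, v, hv, hadj, h₁, h₂, h₃⟩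
    have := hr ⟨u, hu⟩ ⟨v, hv⟩ ((h.adj_iff ⟨u, hu⟩ ⟨v, hv⟩).1 hadj)
    rw [ext_of_lt _ hu] at h₁ h₃
    rw [ext_of_lt _ hv] at h₂ h₃
    tauto

/-- The condition under which the program answers yes when the vertices have weights `wt`. -/
def Accepts {n : ℕ} (G : SimpleGraph (Fin n)) (S : Finset (Fin n)) (k : ℕ) (wt : ℕ → ℕ) : Prop :=
  ∃ c w, c ≤ k ∧ w ≠ 0 ∧
    ((cuts G S).filter fun g => size g = c ∧ cost wt g = w).card % 4 ≠ 0

/-- Weights are less than `W`, so division with remainder by `W` recovers size and weight from a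
position. Counts outside the range of positions are zero and cannot be witnesses. -/
theorem exists_digit_iff {e : Env} {G : SimpleGraph (Fin e.n)} {S : Finset (Fin e.n)}
    (h : e.Describes G S) {wt : ℕ → ℕ} (hw : e.Weighted wt) {x : ℕ} (hx : x < e.Q)
    (hxt : (x : ZMod e.Q) = fullTotal e) :
    (∃ j < e.digits, x / e.z ^ j % 4 ≠ 0 ∧ j % e.W ≠ 0 ∧ j / e.W ≤ e.k) ↔
      Accepts G S e.k wt := by
  have hW := e.W_pos
  have hfil : ∀ j, ((good e).filter fun g => e.W * size g + cost wt g = j) =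
      (cuts G S).filter fun g => size g = j / e.W ∧ cost wt g = j % e.W := by
    intro j
    rw [good_eq_cuts h]
    refine Finset.filter_congr fun g _ => ?_
    have hlt := cost_lt hw g
    constructor
    · rintro rfl
      rw [Nat.mul_add_div hW, Nat.div_eq_of_lt hlt, Nat.mul_add_mod, Nat.mod_eq_of_lt hlt]
      exact ⟨rfl, rfl⟩
    · rintro ⟨h₁, h₂⟩
      rw [h₁, h₂, Nat.div_add_mod]
  constructor
  · rintro ⟨j, hj, h4, hm, hk⟩
    rw [mod_four_digit hw hx hxt hj, hfil] at h4
    exact ⟨_, _, hk, hm, h4⟩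
  · rintro ⟨c, w, hck, hw0, h4⟩
    have hne : ((cuts G S).filter fun g => size g = c ∧ cost wt g = w).Nonempty := by
      rw [← Finset.card_pos]
      omega
    obtain ⟨g, hg⟩ := hne
    obtain ⟨-, rfl, rfl⟩ := Finset.mem_filter.1 hg
    have hlt := cost_lt hw g
    have hd : (e.W * size g + cost wt g) / e.W = size g := by
      rw [Nat.mul_add_div hW, Nat.div_eq_of_lt hlt, add_zero]
    have hm : (e.W * size g + cost wt g) % e.W = cost wt g := by
      rw [Nat.mul_add_mod, Nat.mod_eq_of_lt hlt]
    have hj : e.W * size g + cost wt g < e.digits := by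
      have := size_le g
      rw [Env.digits]
      nlinarith [Nat.mul_le_mul_left e.W this]
    refine ⟨_, hj, ?_, by rwa [hm], by rwa [hd]⟩
    rw [mod_four_digit hw hx hxt hj, hfil, hd, hm]
    exact h4

theorem wp_mainProg {e : Env} (he : e.Valid) {G : SimpleGraph (Fin e.n)} {S : Finset (Fin e.n)}
    (hd : e.Describes G S) {T : SimpleGraph (Fin e.m)} (hT : e.Decomp T) {s : State}
    (h0 : s.var 0 = e.n) (h1 : s.var 1 = e.m) (h2 : s.var 2 = e.k) (a0 : s.arr 0 = e.adj)
    (a1 : s.arr 1 = e.term) (a2 : s.arr 2 = e.tree) (a3 : s.arr 3 = e.bag)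
    (a6 : ∀ i, s.arr 6 i = 0) (a7 : ∀ i, s.arr 7 i = 0) :
    WP e.L e.b mainProg
      (fun s' => s'.var 0 ≠ 0 ↔ Accepts G S e.k (weight e.nb s.coins)) s := by
  refine WP.seq ((wp_constProg he h0 h1 h2).mono ?_)
  intro s₁ hF₁ _ hv₁
  have hc₁ : s₁.coins = s.coins := hF₁.3 (by decide)
  refine WP.seq ((wp_weightProg he hv₁).mono ?_)
  intro s₂ hF₂ _ hpw
  rw [hc₁] at hpw
  -- The encoded weights are known only after the coins have been tossed. None of the other
  -- parameters depends on them, so all constraints carry over.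
  set e' : Env := { e with pw := s₂.arr 4 } with he'
  have hval : e'.Valid := ⟨he.1, he.2, he.3, he.4, he.5, he.6, he.7, he.8, he.9⟩
  have hfine : e'.Fine := by
    refine ⟨hval, hd.bag_le, hd.tree_irrefl, fun v hv => ?_, hd.size_b⟩
    change 1 ≤ s₂.arr 4 v
    rw [hpw v hv]
    exact Nat.one_le_pow _ _ (by have := e.one_lt_z; omega)
  have hv₂ : e.Vars s₂ := hv₁.of_frame (by decide) hF₂
  have harr : ∀ a, a ∉ weightProg.arrs → a ∉ constProg.arrs → s₂.arr a = s.arr a :=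
    fun a ha hb => (hF₂.2 a ha).trans (hF₁.2 a hb)
  have hs₂ : e'.Holds s₂ :=
    ⟨⟨hv₂.1, hv₂.2, hv₂.3, hv₂.4, hv₂.5, hv₂.6, hv₂.7, hv₂.8, hv₂.9⟩,
      (harr 0 (by decide) (by decide)).trans a0, (harr 1 (by decide) (by decide)).trans a1,
      (harr 2 (by decide) (by decide)).trans a2, (harr 3 (by decide) (by decide)).trans a3, rfl⟩
  have hT' : e'.Decomp T := ⟨hT.1, hT.2, hT.3, hT.4, hT.5, hT.6, hT.7, hT.8⟩
  have hw : e'.Weighted (weight e.nb s.coins) :=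
    ⟨hpw, fun v _ => weight_le _ _ _, hd.term_le⟩
  have hd' : e'.Describes G S := ⟨hd.1, hd.2, hd.3, hd.4, hd.5, hd.6⟩
  refine WP.seq ((wp_rounds hfine hT' hs₂ (fun i => ?_) (fun i => ?_)).mono ?_)
  · rw [harr 6 (by decide) (by decide), a6]
  · rw [harr 7 (by decide) (by decide), a7]
  rintro s₃ hF₃ - ⟨hlt, hz⟩
  refine (wp_readProg hval (hs₂.of_frame (by decide) (by decide) hF₃)).mono ?_
  intro s₄ _ _ h
  rw [h]
  exact exists_digit_iff hd' hw hlt hz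

theorem isSecludedSteinerYes_of_accepts {n : ℕ} {G : SimpleGraph (Fin n)} {S : Finset (Fin n)}
    {k : ℕ} {wt : ℕ → ℕ} (h : Accepts G S k wt) : IsSecludedSteinerYes G (S : Set (Fin n)) k := by
  obtain ⟨c, w, hck, hw, h4⟩ := h
  exact isSecludedSteinerYes_of_card hw hck h4

/-- The isolation lemma is applied to the solutions with the smallest neighbourhood only, not to all
solutions with a neighbourhood of at most k vertices, since minimality is what leaves no freedom in
the choice of the paid vertices. -/
theorem half_le_accepts {n nb : ℕ} (hnb : 2 * n ≤ 2 ^ nb) {G : SimpleGraph (Fin n)}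
    {S : Finset (Fin n)} {k : ℕ} (h : IsSecludedSteinerYes G (S : Set (Fin n)) k) :
    1 / 2 ≤ coinMeasure {ω | Accepts G S k (weight nb ω)} := by
  classical
  rw [isSecludedSteinerYes_iff] at h
  have hex : ∃ c, ∃ X : Set (Fin n), (G.induce X).Connected ∧ (S : Set (Fin n)) ⊆ X ∧
      (closedNbhd G X).ncard = c := by
    obtain ⟨X, hX, hS, -⟩ := h
    exact ⟨_, X, hX, hS, rfl⟩
  have hmin : ∀ X : Set (Fin n), (G.induce X).Connected → (S : Set (Fin n)) ⊆ X →
      Nat.find hex ≤ (closedNbhd G X).ncard := fun X hX hS => Nat.find_min' hex ⟨X, hX, hS, rfl⟩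
  have hck : Nat.find hex ≤ k := by
    obtain ⟨X, hX, hS, hk⟩ := h
    exact (hmin X hX hS).trans hk
  have hF : (solutions G S (Nat.find hex)).Nonempty := by
    obtain ⟨X, hX, hS, hc⟩ := Nat.find_spec hex
    refine ⟨X.toFinset, by rwa [Set.coe_toFinset], fun v hv => ?_, by rwa [Set.coe_toFinset]⟩
    rw [Set.mem_toFinset]
    exact hS hv
  refine (half_le_isolated hnb hF).trans (measure_mono ?_)
  rintro ω ⟨X, hX, huniq⟩
  obtain ⟨hne, h2⟩ := card_mod_four (wt := weight nb ω) (fun v => Nat.succ_pos _) hmin hX huniq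
  exact ⟨_, _, hck, hne, by omega⟩

theorem cell_inj {n p q : ℕ} {u v : Fin n} (h : p * n + u = q * n + v) : p = q ∧ u = v := by
  have hn : 0 < n := (Nat.zero_le _).trans_lt u.2
  have h₁ : (p * n + u) / n = p := by
    rw [mul_comm, Nat.mul_add_div hn, Nat.div_eq_of_lt u.2, add_zero]
  have h₂ : (q * n + v) / n = q := by
    rw [mul_comm, Nat.mul_add_div hn, Nat.div_eq_of_lt v.2, add_zero]
  have hpq : p = q := by rw [← h₁, ← h₂, h]
  refine ⟨hpq, Fin.ext ?_⟩
  subst hpq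
  omega

/-- The parameters of the run on the given input. -/
noncomputable def inputEnv {n m : ℕ} (G : SimpleGraph (Fin n)) (S : Finset (Fin n)) (k t : ℕ)
    (D : TreeDecomp G (Fin m)) : Env where
  n := n
  m := m
  k := k
  nb := Nat.clog 2 (2 * n)
  -- The product is the binary logarithm of `Q`; the remaining summands make room for m + 1 and for
  -- k.
  L := 2 * (n + 1) * ((n + 1) * (n * 2 ^ Nat.clog 2 (2 * n) + 1)) + m + k.size + 1
  -- A bag has at most t + 1 vertices, hence at most 4^(t+1) assignments.
  b := fun y => if y = 20 then 4 * 4 ^ t else 12 * (n + m + k.size) ^ 3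
  adj := (secludedInput G S k D fun _ => false).arr 0
  term := (secludedInput G S k D fun _ => false).arr 1
  tree := (secludedInput G S k D fun _ => false).arr 2
  bag := (secludedInput G S k D fun _ => false).arr 3
  pw := fun _ => 0

/-! ### The encoding of the input, and polynomial bounds on the parameters -/

section

variable {n m : ℕ} (G : SimpleGraph (Fin n)) (S : Finset (Fin n)) (k t : ℕ)
  (D : TreeDecomp G (Fin m))

theorem secludedInput_arr_le (ω : ℕ → Bool) (a i : ℕ) : (secludedInput G S k D ω).arr a i ≤ 1 := by
  simp only [secludedInput]
  split <;> first | (split_ifs <;> simp) | simp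

theorem adj_ne_zero (u v : Fin n) :
    (inputEnv G S k t D).adj (u * n + v) ≠ 0 ↔ G.Adj u v := by
  simp only [inputEnv, secludedInput]
  constructor
  · intro h
    by_contra hno
    refine h (if_neg ?_)
    rintro ⟨u', v', he, hadj⟩
    obtain ⟨h₁, rfl⟩ := cell_inj he
    rw [← Fin.ext h₁] at hadj
    exact hno hadj
  · intro h
    rw [if_pos ⟨u, v, rfl, h⟩]
    simp

theorem tree_ne_zero (i j : Fin m) :
    (inputEnv G S k t D).tree (i * m + j) ≠ 0 ↔ D.tree.Adj i j := by
  simp only [inputEnv, secludedInput]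
  constructor
  · intro h
    by_contra hno
    refine h (if_neg ?_)
    rintro ⟨u', v', he, hadj⟩
    obtain ⟨h₁, rfl⟩ := cell_inj he
    rw [← Fin.ext h₁] at hadj
    exact hno hadj
  · intro h
    rw [if_pos ⟨i, j, rfl, h⟩]
    simp

theorem bag_ne_zero (p : ℕ) (v : Fin n) :
    (inputEnv G S k t D).bag (p * n + v) ≠ 0 ↔ ∃ i : Fin m, (i : ℕ) = p ∧ v ∈ D.bag i := by
  simp only [inputEnv, secludedInput]
  constructor
  · intro h
    by_contra hno
    refine h (if_neg ?_)
    rintro ⟨i, v', he, hv⟩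
    obtain ⟨h₁, rfl⟩ := cell_inj he
    exact hno ⟨i, h₁.symm, hv⟩
  · rintro ⟨i, rfl, hv⟩
    rw [if_pos ⟨i, v, rfl, hv⟩]
    simp

theorem mem_bagFin_input (i : Fin m) (v : Fin n) :
    v ∈ bagFin (inputEnv G S k t D) i ↔ v ∈ D.bag i := by
  refine (mem_bagFin (e := inputEnv G S k t D) (i := i) (v := v)).trans
    ((bag_ne_zero G S k t D i v).trans ⟨?_, fun h => ⟨i, rfl, h⟩⟩)
  rintro ⟨j, hj, hv⟩
  rwa [← Fin.ext hj]

theorem pos_of_treeDecomp {n m : ℕ} (G : SimpleGraph (Fin n)) (D : TreeDecomp G (Fin m)) : 0 < m := by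
  obtain ⟨i⟩ := D.isTree.connected.nonempty
  exact (Nat.zero_le _).trans_lt i.2

theorem decomp_input : (inputEnv G S k t D).Decomp D.tree where
  tree_iff := tree_ne_zero G S k t D
  acyclic := D.isTree.isAcyclic
  conn := D.isTree.connected.preconnected
  pos := pos_of_treeDecomp G D
  vertex v := by
    obtain ⟨i, hi⟩ := D.vertex_mem v
    exact ⟨i, (mem_bagFin_input G S k t D i v).2 hi⟩
  edge u v h := by
    obtain ⟨i, hu, hv⟩ := D.edge_mem u v ((adj_ne_zero G S k t D u v).1 h)
    exact ⟨i, (mem_bagFin_input G S k t D i u).2 hu, (mem_bagFin_input G S k t D i v).2 hv⟩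
  bag_conn v := by
    have h : {i : Fin m | v ∈ bagFin (inputEnv G S k t D) i} = {i | v ∈ D.bag i} :=
      Set.ext fun i => mem_bagFin_input G S k t D i v
    have key : ∀ A B : Set (Fin m), A = B → (D.tree.induce B).Preconnected →
        (D.tree.induce A).Preconnected := by
      rintro A B rfl hA
      exact hA
    exact key _ _ h (D.connected v).preconnected
  root v hv := by
    by_contra h
    obtain ⟨i, hi, -⟩ := (bag_ne_zero G S k t D m ⟨v, hv⟩).1 h
    have := i.2
    omega

theorem describes_input (hD : D.WidthLE t) : (inputEnv G S k t D).Describes G S where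
  adj_iff := adj_ne_zero G S k t D
  term_iff v := by
    simp only [inputEnv, secludedInput]
    constructor
    · intro h
      by_contra hno
      refine h (if_neg ?_)
      rintro ⟨v', he, hv⟩
      exact hno (Fin.ext he ▸ hv)
    · intro h
      rw [if_pos ⟨v, rfl, h⟩]
      simp
  term_le v := secludedInput_arr_le G S k D (fun _ => false) 1 v
  bag_le i := secludedInput_arr_le G S k D (fun _ => false) 3 i
  tree_irrefl i hi := by
    by_contra h
    exact ((tree_ne_zero G S k t D ⟨i, hi⟩ ⟨i, hi⟩).1 h).ne rfl
  size_b i hi := by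
    rw [← card_bagFin]
    have h : bagFin (inputEnv G S k t D) i = D.bag ⟨i, hi⟩ :=
      Finset.ext fun v => mem_bagFin_input G S k t D ⟨i, hi⟩ v
    rw [h]
    refine (Nat.pow_le_pow_right (by norm_num) (hD ⟨i, hi⟩)).trans ?_
    simp [inputEnv, pow_succ, mul_comm]

/-- The previous power of two is still below 2n. The summand 1 is needed for n = 0 only. -/
theorem two_pow_clog_le : 2 ^ Nat.clog 2 (2 * n) ≤ 4 * n + 1 := by
  rcases Nat.eq_zero_or_pos n with rfl | hn
  · simp
  · have h := Nat.pow_pred_clog_lt_self (b := 2) (by norm_num) (show 1 < 2 * n by omega)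
    have hpos : 0 < Nat.clog 2 (2 * n) := Nat.clog_pos (by norm_num) (by omega)
    obtain ⟨c, hc⟩ : ∃ c, Nat.clog 2 (2 * n) = c + 1 := ⟨_, (Nat.succ_pred_eq_of_pos hpos).symm⟩
    rw [hc] at h ⊢
    rw [Nat.pred_succ] at h
    rw [pow_succ]
    omega

theorem weight_bound : n * 2 ^ Nat.clog 2 (2 * n) + 1 ≤ 4 * n ^ 2 + n + 1 := by
  have := Nat.mul_le_mul_left n (two_pow_clog_le (n := n))
  nlinarith

theorem digits_bound {N : ℕ} (hN : 1 ≤ N) (hn : n ≤ N) :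
    n * 2 ^ Nat.clog 2 (2 * n) + 1 ≤ 6 * N ^ 2 ∧
      (n + 1) * (n * 2 ^ Nat.clog 2 (2 * n) + 1) ≤ 12 * N ^ 3 := by
  have h₁ := weight_bound (n := n)
  have h₂ : n ^ 2 ≤ N ^ 2 := Nat.pow_le_pow_left hn 2
  have h₃ : N ≤ N ^ 2 := Nat.le_self_pow (by norm_num) N
  have h₄ : n * 2 ^ Nat.clog 2 (2 * n) + 1 ≤ 6 * N ^ 2 := by omega
  refine ⟨h₄, ?_⟩
  calc (n + 1) * (n * 2 ^ Nat.clog 2 (2 * n) + 1) ≤ (2 * N) * (6 * N ^ 2) :=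
        Nat.mul_le_mul (by omega) h₄
    _ = 12 * N ^ 3 := by ring

theorem valid_input : (inputEnv G S k t D).Valid := by
  have hm := pos_of_treeDecomp G D
  set N := n + m + k.size with hN
  have hN1 : 1 ≤ N := by omega
  obtain ⟨hW, hdig⟩ := digits_bound hN1 (show n ≤ N by omega)
  have h₁ : N ^ 2 ≤ N ^ 3 := Nat.pow_le_pow_right hN1 (by norm_num)
  have h₂ : N ≤ N ^ 2 := Nat.le_self_pow (by norm_num) N
  have h₃ := two_pow_clog_le (n := n)
  have h₄ := Nat.lt_two_pow_self (n := Nat.clog 2 (2 * n))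
  have hb : ∀ y, y ≠ 20 → (inputEnv G S k t D).b y = 12 * N ^ 3 := fun y hy => if_neg hy
  have hQ : (inputEnv G S k t D).Q =
      2 ^ (2 * (n + 1) * ((n + 1) * (n * 2 ^ Nat.clog 2 (2 * n) + 1))) := by
    rw [Env.Q_eq, Env.z, show (4 : ℕ) = 2 ^ 2 by norm_num, ← pow_mul, ← pow_mul, mul_assoc 2 (n + 1)]
    rfl
  constructor
  · rfl
  · rw [hQ]
    refine Nat.pow_lt_pow_right (by norm_num) ?_
    simp only [inputEnv]
    omega
  · refine (show m + 1 ≤ 2 ^ m from Nat.lt_two_pow_self).trans_lt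
      (Nat.pow_lt_pow_right (by norm_num) ?_)
    simp only [inputEnv]
    omega
  · rw [hb _ (by norm_num)]
    change n + 1 ≤ _
    omega
  · rw [hb _ (by norm_num)]
    change m ≤ _
    omega
  · rw [hb _ (by norm_num)]
    change Nat.clog 2 (2 * n) ≤ _
    omega
  · rw [hb _ (by norm_num)]
    change n * 2 ^ Nat.clog 2 (2 * n) + 1 ≤ _
    omega
  · rw [hb _ (by norm_num)]
    change n + 1 ≤ _
    omega
  · rw [hb _ (by norm_num)]
    exact hdig

theorem fits_input (ω : ℕ → Bool) : (secludedInput G S k D ω).Fits (inputEnv G S k t D).L := by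
  have hv := valid_input G S k t D
  have hm := hv.m_lt
  have hQ := hv.Q_lt
  have hn := (inputEnv G S k t D).n_lt_digits
  have hd := (inputEnv G S k t D).digits_lt_Q
  have hk : k < 2 ^ (inputEnv G S k t D).L := by
    refine (Nat.lt_size_self k).trans_le (Nat.pow_le_pow_right (by norm_num) ?_)
    simp only [inputEnv]
    omega
  have hn' : n < 2 ^ (inputEnv G S k t D).L := by
    change n < (inputEnv G S k t D).digits at hn
    omega
  have hm' : m + 1 < 2 ^ (inputEnv G S k t D).L := hm
  refine ⟨fun x => ?_, fun a i => ?_⟩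
  · simp only [secludedInput]
    split <;> omega
  · have := secludedInput_arr_le G S k D ω a i
    omega

theorem length_bound : (inputEnv G S k t D).L + 1 ≤ 51 * (n + m + k.size) ^ 4 := by
  have hm := pos_of_treeDecomp G D
  set N := n + m + k.size with hN
  have hN1 : 1 ≤ N := by omega
  obtain ⟨-, hdig⟩ := digits_bound hN1 (show n ≤ N by omega)
  have h₁ : N ≤ N ^ 4 := Nat.le_self_pow (by norm_num) N
  have h₂ : 2 * (n + 1) * ((n + 1) * (n * 2 ^ Nat.clog 2 (2 * n) + 1)) ≤ 48 * N ^ 4 := by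
    calc 2 * (n + 1) * ((n + 1) * (n * 2 ^ Nat.clog 2 (2 * n) + 1)) ≤
          (2 * (2 * N)) * (12 * N ^ 3) := Nat.mul_le_mul (by omega) hdig
      _ = 48 * N ^ 4 := by ring
  simp only [inputEnv]
  omega

end

end Secluded

theorem theorem11 :
    ∃ (P : Ram.Prog) (C d : ℕ),
      ∀ (n m : ℕ) (G : SimpleGraph (Fin n)) (S : Finset (Fin n)) (k t : ℕ)
        (D : TreeDecomp G (Fin m)), D.WidthLE t →
        (∀ ω : ℕ → Bool,
          Ram.HaltsWithin P (secludedInput G S k D ω) (C * 4 ^ t * (n + m + k.size) ^ d)) ∧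
        (∀ ω : ℕ → Bool, Ram.SaysYes P (secludedInput G S k D ω) →
          IsSecludedSteinerYes G (S : Set (Fin n)) k) ∧
        (IsSecludedSteinerYes G (S : Set (Fin n)) k →
          1 / 2 ≤ Ram.coinMeasure {ω | Ram.SaysYes P (secludedInput G S k D ω)}) := by
  obtain ⟨C, d, hsteps⟩ := Ram.Prog.exists_steps_le 20 Secluded.mainProg
  -- With N = n + m + `k.size`, the step bound is C * (4 * 4^t) * (12 * N^3)^d, and each step costs
  -- at most L + 1 ≤ 51 * N^4.
  refine ⟨Secluded.mainProg, C * 4 * 12 ^ d * 51, 3 * d + 4, fun n m G S k t D hD => ?_⟩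
  have hrun : ∀ ω : ℕ → Bool, ∃ c s', Ram.Exec Secluded.mainProg (secludedInput G S k D ω) c s' ∧
      c ≤ C * 4 * 12 ^ d * 51 * 4 ^ t * (n + m + k.size) ^ (3 * d + 4) ∧
      (s'.var 0 ≠ 0 ↔ Secluded.Accepts G S k (Secluded.weight (Nat.clog 2 (2 * n)) ω)) := by
    intro ω
    obtain ⟨c, s', he, hc, -, h⟩ := Secluded.wp_mainProg (e := Secluded.inputEnv G S k t D)
      (Secluded.valid_input G S k t D) (Secluded.describes_input G S k t D hD)
      (Secluded.decomp_input G S k t D) (s := secludedInput G S k D ω) rfl rfl rfl rfl rfl rfl rfl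
      (fun _ => rfl) (fun _ => rfl) (Secluded.fits_input G S k t D ω)
    refine ⟨c, s', he, hc.trans ?_, h⟩
    have hm := Secluded.pos_of_treeDecomp G D
    have hN : 1 ≤ (n + m + k.size) ^ 3 := Nat.one_le_pow _ _ (by omega)
    have h4 : 1 ≤ 4 ^ t := Nat.one_le_pow _ _ (by norm_num)
    have h₁ := hsteps (12 * (n + m + k.size) ^ 3) (4 * 4 ^ t) (by omega) (by omega)
    rw [Secluded.depth_mainProg, pow_one] at h₁
    refine (Nat.mul_le_mul h₁ (Secluded.length_bound G S k t D)).trans (le_of_eq ?_)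
    rw [mul_pow, ← pow_mul, pow_add]
    ring
  have hyes : ∀ ω, Ram.SaysYes Secluded.mainProg (secludedInput G S k D ω) ↔
      Secluded.Accepts G S k (Secluded.weight (Nat.clog 2 (2 * n)) ω) := by
    intro ω
    obtain ⟨c, s', he, -, h⟩ := hrun ω
    rw [← h]
    constructor
    -- Runs are deterministic once the coins are fixed, so any accepting run is the analysed one.
    · rintro ⟨c', s'', he', hne⟩
      rwa [(he.unique he').2]
    · exact fun hne => ⟨c, s', he, hne⟩
  refine ⟨fun ω => ?_, fun ω h => ?_, fun h => ?_⟩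
  · obtain ⟨c, s', he, hc, -⟩ := hrun ω
    exact ⟨c, s', he, hc⟩
  · exact Secluded.isSecludedSteinerYes_of_accepts ((hyes ω).1 h)
  · simp only [hyes]
    exact Secluded.half_le_accepts (Nat.le_pow_clog (by norm_num) _) h
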